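/- **Setting.** Let $n\ge 2$ and let $(\overline M,\overline\varphi,\overline\xi,\overline\eta,\overline g)$ be a $(2n+1)$-dimensional almost contact B-metric manifold: $\overline\varphi$ is a $(1,1)$-tensor field, $\overline\xi$ a vector field, $\overline\eta$ a 1-form and $\overline g$ a semi-Riemannian metric (all smooth) with $$\overline\varphi^2X=-X+\overline\eta(X)\overline\xi,\quad \overline\eta(\overline\xi)=1,\quad \overline g(\overline\varphi X,\overline\varphi Y)=-\overline g(X,Y)+\overline\eta(X)\overline\eta(Y).$$ Let $\overline{\widetilde g}(X,Y)=\overline g(X,\overline\varphi Y)+\overline\eta(X)\overline\eta(Y)$ be the associated metric, $\overline\nabla,\overline{\widetilde\nabla}$ the Levi-Civita connections of $\overline g,\overline{\widetilde g}$, and $\overline R,\overline{\widetilde R}$ their curvature tensors, where $R(X,Y,Z)=\nabla_X\nabla_YZ-\nabla_Y\nabla_XZ-\nabla_{[X,Y]}Z$. Assume that $\overline M$ is an $\mathcal F_0$-manifold, i.e. $\overline g((\overline\nabla_X\overline\varphi)Y,Z)=0$ for all $X,Y,Z$, and that it is of pointwise constant totally real sectional curvatures $\overline\nu(p),\overline{\widetilde\nu}(p)$: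 there are functions $\overline\nu,\overline{\widetilde\nu}$ on $\overline M$ such that $$\frac{\overline g(\overline R(x,y,y),x)}{\overline g(x,x)\overline g(y,y)-\overline g(x,y)^2}=\overline\nu(p),\qquad \frac{\overline{\widetilde g}(\overline{\widetilde R}(x,y,y),x)}{\overline g(x,x)\overline g(y,y)-\overline g(x,y)^2}=\overline{\widetilde\nu}(p)$$ for every $p$ and every $\overline g$-non-degenerate section $\alpha=\mathrm{span}\{x,y\}\subset T_p\overline M$ that is orthogonal to $\overline\xi$ and totally real ($\overline\varphi\alpha\perp\alpha$ with respect to $\overline g$). Let $(M,g)$ be a half lightlike submanifold of $(\overline M,\overline g)$: an immersed submanifold of codimension $2$ with induced metric $g$ whose radical distribution $\mathrm{Rad}(TM)=TM\cap TM^\perp$ has rank $1$, equipped with a screen distribution $S(TM)$ and a screen transversal bundle $S(TM^\perp)$, i.e. smooth distributions with $TM=\mathrm{Rad}(TM)\oplus S(TM)$ and $TM^\perp=\mathrm{Rad}(TM)\oplus S(TM^\perp)$. For a local section $\xi$ of $\mathrm{Rad}(TM)$ without zeros let $N$ be the unique local vector field along $M$ with $\overline g(N,\xi)=1$, $\overline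 g(N,N)=0$, $N\perp S(TM)$, $N\perp S(TM^\perp)$; these $N$ span the line bundle $\mathrm{ltr}(TM)$, and $T\overline M|_M=TM\oplus S(TM^\perp)\oplus\mathrm{ltr}(TM)$. Assume that $M$ is RSTHL, i.e. $\overline\varphi(\mathrm{Rad}(TM))=S(TM^\perp)$, and ascreen, i.e. $\overline\xi$ belongs to $\mathrm{Rad}(TM)\oplus\mathrm{ltr}(TM)$ along $M$. Fix a local section $\xi$ of $\mathrm{Rad}(TM)$ without zeros, on an open set $U\subset M$, and the corresponding $N$. Define the induced connection $\nabla$, the form $B$, the shape operator $A_N$ and the 1-form $\tau$ by $$\overline\nabla_XY=\nabla_XY+B(X,Y)N+(\text{section of }S(TM^\perp)),\qquad \overline\nabla_XN=-A_NX+\tau(X)N+(\text{section of }S(TM^\perp)),$$ for tangent vector fields $X,Y$ of $M$, with $\nabla_XY$ and $A_NX$ tangent to $M$. Let $R$ be the curvature tensor of $\nabla$, $P$ the projection of $TM$ on $S(TM)$ along $\mathrm{Rad}(TM)$, $\eta(X)=\overline g(X,N)$, $\mu=\overline\eta(\xi)$ and $(\nabla_XB)(Y,Z)=X(B(Y,Z))-B(\nabla_XY,Z)-B(Y,\nabla_XZ)$.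 Write $g(X,\overline\varphi Y)$ for $\overline g(X,\overline\varphi Y)$, and recall that $\overline\varphi$ preserves $S(TM)$. **Proposition 4.2.** For all smooth vector fields $X,Y,Z$ tangent to $M$ on $U$, with $\overline\nu,\overline{\widetilde\nu}$ evaluated at points of $M$, $$\begin{aligned} R(X,Y,Z)={}&-B(X,Z)A_NY+2B(X,\overline\varphi(PZ))\,\overline\varphi(A_NY)+B(Y,Z)A_NX-2B(Y,\overline\varphi(PZ))\,\overline\varphi(A_NX)\\ &-[\overline\nu\,\overline g(\overline\varphi Y,\overline\varphi Z)+\overline{\widetilde\nu}\,g(Y,\overline\varphi Z)]PX+[\overline\nu\,\overline g(\overline\varphi X,\overline\varphi Z)+\overline{\widetilde\nu}\,g(X,\overline\varphi Z)]PY\\ &-[\overline\nu\,g(Y,\overline\varphi Z)-\overline{\widetilde\nu}\,\overline g(\overline\varphi Y,\overline\varphi Z)]\,\overline\varphi(PX)+[\overline\nu\,g(X,\overline\varphi Z)-\overline{\widetilde\nu}\,\overline g(\overline\varphi X,\overline\varphi Z)]\,\overline\varphi(PY)\\ &+\tfrac12\{\overline\nu[g(Y,Z)\eta(X)-g(X,Z)\eta(Y)]-\overline{\widetilde\nu}[g(Y,\overline\varphi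 Z)\eta(X)-g(X,\overline\varphi Z)\eta(Y)]\}\,\xi \end{aligned}\tag{15}$$ and $$\begin{aligned} &(\nabla_XB)(Y,Z)-(\nabla_YB)(X,Z)+\tau(X)B(Y,Z)-\tau(Y)B(X,Z)\\ &\quad=\mu^2\{\overline\nu[g(X,Z)\eta(Y)-g(Y,Z)\eta(X)]-\overline{\widetilde\nu}[g(X,\overline\varphi Z)\eta(Y)-g(Y,\overline\varphi Z)\eta(X)]\}. \end{aligned}\tag{16}$$ -/

import Mathlib

open Bundle Set
open scoped Manifold ContDiff Topology

universe u

noncomputable section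

namespace LightlikeGeometry

/-! ### Vector fields, smoothness and curvature -/

/-- Model space of a `d`-dimensional manifold. -/
abbrev Model (d : ℕ) := EuclideanSpace ℝ (Fin d)

/-- (Not necessarily smooth) vector fields on the `d`-dimensional manifold `M`. -/
abbrev VField (d : ℕ) (M : Type*) [TopologicalSpace M] [ChartedSpace (Model d) M] :=
  (p : M) → TangentSpace (𝓡 d) p

/-- A linear connection on the tangent bundle of the `d`-dimensional manifold `M`;
`D Y p v` is the derivative of `Y` at `p` in the direction `v`. -/
abbrev Connection (d : ℕ) (M : Type u) [TopologicalSpace M] [ChartedSpace (Model d) M]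
    [IsManifold (𝓡 d) ∞ M] : Type u :=
  CovariantDerivative (𝓡 d) (Model d) (fun p : M ↦ TangentSpace (𝓡 d) p)

section Basic

variable {d : ℕ} {M : Type*} [TopologicalSpace M] [ChartedSpace (Model d) M]
  [IsManifold (𝓡 d) ∞ M]

/-- The vector field `X` is smooth on the set `U`. -/
def SmoothOn (X : VField d M) (U : Set M) : Prop :=
  ContMDiffOn (𝓡 d) (𝓡 d).tangent ∞ (fun p ↦ (⟨p, X p⟩ : TangentBundle (𝓡 d) M)) U

/-- The function `X(h)`, the derivative of the function `h` along the vector field `X`. -/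
def lieD (X : VField d M) (h : M → ℝ) (p : M) : ℝ := mvfderiv (𝓡 d) h p (X p)

/-- The curvature `R(X, Y, Z) = D_X D_Y Z - D_Y D_X Z - D_[X,Y] Z` of an operation
`(X, Y) ↦ D X Y = D_X Y` on vector fields. -/
def curvature (D : VField d M → VField d M → VField d M) (X Y Z : VField d M) : VField d M :=
  fun p ↦ D X (D Y Z) p - D Y (D X Z) p - D (VectorField.mlieBracket (𝓡 d) X Y) Z p

/-- The covariant derivative of a bilinear operation `B` from vector fields to functions,
`(D_X B)(Y, Z) = X(B(Y, Z)) - B(D_X Y, Z) - B(Y, D_X Z)`. -/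
def covDerivForm (D : VField d M → VField d M → VField d M) (B : VField d M → VField d M → M → ℝ)
    (X Y Z : VField d M) (p : M) : ℝ :=
  lieD X (B Y Z) p - B (D X Y) Z p - B Y (D X Z) p

/-- A smooth distribution given by its fibres: each vector of a fibre extends to a
smooth section defined near its base point. (Constancy of the rank is required where this is used.) -/
def IsSmoothDistribution (S : (p : M) → Submodule ℝ (TangentSpace (𝓡 d) p)) : Prop :=
  ∀ p, ∀ v ∈ S p, ∃ U : Set M, IsOpen U ∧ p ∈ U ∧ ∃ X : VField d M,
    SmoothOn X U ∧ X p = v ∧ ∀ q ∈ U, X q ∈ S q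

/-- `D_X Y` for a linear connection `D`. -/
def Connection.nabla (D : Connection d M) (X Y : VField d M) : VField d M := fun p ↦ D Y p (X p)

/-- The curvature tensor of type `(1,3)` of a linear connection at a point `p`, evaluated
on tangent vectors by means of extensions that are smooth near `p`. -/
def Connection.curvatureAt (D : Connection d M) (p : M) (x y z : TangentSpace (𝓡 d) p) :
    TangentSpace (𝓡 d) p :=
  curvature D.nabla (FiberBundle.extend (Model d) x) (FiberBundle.extend (Model d) y)
    (FiberBundle.extend (Model d) z) p

/-- `D` is the Levi-Civita connection of the field of bilinear forms `g`: `D` is a smooth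
linear connection, torsion-free and metric. -/
structure IsLeviCivita (g : (p : M) → TangentSpace (𝓡 d) p → TangentSpace (𝓡 d) p → ℝ)
    (D : Connection d M) : Prop where
  smooth : CovariantDerivative.ContMDiffCovariantDerivative D ∞
  torsion_free : D.torsion = 0
  metric : ∀ (p : M) (Y Z : VField d M),
    MDifferentiableAt (𝓡 d) (𝓡 d).tangent (fun q ↦ (⟨q, Y q⟩ : TangentBundle (𝓡 d) M)) p →
    MDifferentiableAt (𝓡 d) (𝓡 d).tangent (fun q ↦ (⟨q, Z q⟩ : TangentBundle (𝓡 d) M)) p →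
    ∀ v : TangentSpace (𝓡 d) p,
      mvfderiv (𝓡 d) (fun q ↦ g q (Y q) (Z q)) p v = g p (D Y p v) (Z p) + g p (Y p) (D Z p v)

end Basic

/-- A semi-Riemannian metric on the `d`-dimensional manifold `M`. -/
structure SemiRiemannianMetric (d : ℕ) (M : Type*) [TopologicalSpace M] [ChartedSpace (Model d) M]
    [IsManifold (𝓡 d) ∞ M] where
  val (p : M) : TangentSpace (𝓡 d) p →L[ℝ] TangentSpace (𝓡 d) p →L[ℝ] ℝ
  symm (p : M) (x y : TangentSpace (𝓡 d) p) : val p x y = val p y x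
  nondegenerate (p : M) (x : TangentSpace (𝓡 d) p) (hx : ∀ y, val p x y = 0) : x = 0
  smooth : ContMDiff (𝓡 d) ((𝓡 d).prod 𝓘(ℝ, Model d →L[ℝ] Model d →L[ℝ] ℝ)) ∞
    (fun p ↦ TotalSpace.mk' (Model d →L[ℝ] Model d →L[ℝ] ℝ)
      (E := fun p : M ↦ TangentSpace (𝓡 d) p →L[ℝ] TangentSpace (𝓡 d) p →L[ℝ] ℝ) p (val p))

/-! ### Almost contact B-metric manifolds -/

/-- An almost contact B-metric structure `(φ, ξ, η, g)` on the `(2n+1)`-dimensional manifold `M`. -/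
structure AlmostContactBMetric (n : ℕ) (M : Type*) [TopologicalSpace M]
    [ChartedSpace (Model (2 * n + 1)) M] [IsManifold (𝓡 (2 * n + 1)) ∞ M] where
  phi (p : M) : TangentSpace (𝓡 (2 * n + 1)) p →L[ℝ] TangentSpace (𝓡 (2 * n + 1)) p
  xi : VField (2 * n + 1) M
  eta (p : M) : TangentSpace (𝓡 (2 * n + 1)) p →L[ℝ] ℝ
  metric : SemiRiemannianMetric (2 * n + 1) M
  phi_smooth : ContMDiff (𝓡 (2 * n + 1))
    ((𝓡 (2 * n + 1)).prod 𝓘(ℝ, Model (2 * n + 1) →L[ℝ] Model (2 * n + 1))) ∞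
    (fun p ↦ TotalSpace.mk' (Model (2 * n + 1) →L[ℝ] Model (2 * n + 1))
      (E := fun p : M ↦ TangentSpace (𝓡 (2 * n + 1)) p →L[ℝ] TangentSpace (𝓡 (2 * n + 1)) p)
      p (phi p))
  xi_smooth : SmoothOn xi univ
  eta_smooth : ContMDiff (𝓡 (2 * n + 1))
    ((𝓡 (2 * n + 1)).prod 𝓘(ℝ, Model (2 * n + 1) →L[ℝ] ℝ)) ∞
    (fun p ↦ TotalSpace.mk' (Model (2 * n + 1) →L[ℝ] ℝ)
      (E := fun p : M ↦ TangentSpace (𝓡 (2 * n + 1)) p →L[ℝ] ℝ) p (eta p))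
  phi_sq (p : M) (x : TangentSpace (𝓡 (2 * n + 1)) p) : phi p (phi p x) = -x + eta p x • xi p
  eta_xi (p : M) : eta p (xi p) = 1
  metric_phi (p : M) (x y : TangentSpace (𝓡 (2 * n + 1)) p) :
    metric.val p (phi p x) (phi p y) = -metric.val p x y + eta p x * eta p y

namespace AlmostContactBMetric

variable {n : ℕ} {M : Type*} [TopologicalSpace M] [ChartedSpace (Model (2 * n + 1)) M]
  [IsManifold (𝓡 (2 * n + 1)) ∞ M] (A : AlmostContactBMetric n M)

/-- The B-metric `g`, as a function of two tangent vectors. -/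
def g (p : M) (x y : TangentSpace (𝓡 (2 * n + 1)) p) : ℝ := A.metric.val p x y

/-- The associated B-metric `g(x, φ y) + η(x) η(y)`. -/
def assocMetric (p : M) (x y : TangentSpace (𝓡 (2 * n + 1)) p) : ℝ :=
  A.g p x (A.phi p y) + A.eta p x * A.eta p y

/-- The class `F₀`: `F(X, Y, Z) = g((D_X φ) Y, Z)` vanishes, where `D` is the Levi-Civita
connection of `g` and `(D_X φ) Y = D_X (φ Y) - φ (D_X Y)`. -/
def IsF0 (D : Connection (2 * n + 1) M) : Prop :=
  ∀ (p : M) (Y : VField (2 * n + 1) M),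
    MDifferentiableAt (𝓡 (2 * n + 1)) (𝓡 (2 * n + 1)).tangent
      (fun q ↦ (⟨q, Y q⟩ : TangentBundle (𝓡 (2 * n + 1)) M)) p →
    ∀ x z : TangentSpace (𝓡 (2 * n + 1)) p,
      A.g p (D (fun q ↦ A.phi q (Y q)) p x - A.phi p (D Y p x)) z = 0

/-- The section spanned by `x` and `y` is non-degenerate, orthogonal to `ξ` and totally real
(its image under `φ` is orthogonal to it), all with respect to `g`. -/
structure IsTotallyRealSection (p : M) (x y : TangentSpace (𝓡 (2 * n + 1)) p) : Prop where
  nondegenerate : A.g p x x * A.g p y y - A.g p x y ^ 2 ≠ 0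
  orthogonal_xi : ∀ v ∈ Submodule.span ℝ {x, y}, A.g p v (A.xi p) = 0
  totally_real : ∀ v ∈ Submodule.span ℝ {x, y}, ∀ w ∈ Submodule.span ℝ {x, y},
    A.g p (A.phi p v) w = 0

/-- The manifold is of pointwise constant totally real sectional curvatures `ν` and `ν'` (of the
non-degenerate totally real sections orthogonal to `ξ`). Here `D` and `D'` are the Levi-Civita
connections of `g` and of the associated metric. -/
def HasConstTotallyRealCurvatures (D D' : Connection (2 * n + 1) M) (ν ν' : M → ℝ) : Prop :=
  ∀ (p : M) (x y : TangentSpace (𝓡 (2 * n + 1)) p), A.IsTotallyRealSection p x y →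
    A.g p (D.curvatureAt p x y y) x / (A.g p x x * A.g p y y - A.g p x y ^ 2) = ν p ∧
    A.assocMetric p (D'.curvatureAt p x y y) x / (A.g p x x * A.g p y y - A.g p x y ^ 2) = ν' p

end AlmostContactBMetric

/-! ### Half lightlike submanifolds

`f : M → Mb` is the inclusion (more generally, an immersion) of a `k`-dimensional manifold in an
`m`-dimensional manifold with semi-Riemannian metric `G`. -/

section Submanifold

variable {m k : ℕ} {Mb : Type*} [TopologicalSpace Mb] [ChartedSpace (Model m) Mb]
  [IsManifold (𝓡 m) ∞ Mb] {M : Type*} [TopologicalSpace M] [ChartedSpace (Model k) M]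

/-- The differential of `f` at `p`, as a linear map. -/
def dmap (m k : ℕ) {Mb : Type*} [TopologicalSpace Mb] [ChartedSpace (Model m) Mb]
    {M : Type*} [TopologicalSpace M] [ChartedSpace (Model k) M] (f : M → Mb) (p : M) :
    TangentSpace (𝓡 k) p →ₗ[ℝ] TangentSpace (𝓡 m) (f p) :=
  (mfderiv (𝓡 k) (𝓡 m) f p).toLinearMap

/-- The covariant derivative at `p`, in the direction `v ∈ T_p M`, of a vector field `V` along
`f : M → Mb` (that is, `V q ∈ T_{f q} Mb`) with respect to a linear connection `D` of `Mb`: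
in the frame `∂ᵢ` of the chart at `f p`, if `V = ∑ Vⁱ ∂ᵢ`, it is `∑ v(Vⁱ) ∂ᵢ + ∑ Vⁱ D_{df v} ∂ᵢ`.
The first sum is the derivative of `V` read in the trivialization; the second one is the derivative
of the field on `Mb` with constant coefficients `Vⁱ(p)`. -/
def covAlong (D : Connection m Mb) (f : M → Mb) (V : (q : M) → TangentSpace (𝓡 m) (f q)) (p : M)
    (v : TangentSpace (𝓡 k) p) : TangentSpace (𝓡 m) (f p) :=
  let e := trivializationAt (Model m) (fun y : Mb ↦ TangentSpace (𝓡 m) y) (f p)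
  e.symm (f p) (mvfderiv (𝓡 k) (fun q ↦ (e ⟨f q, V q⟩).2) p v) +
    D (FiberBundle.extend (Model m) (V p)) (f p) (dmap m k f p v)

/-- The radical subspace of `T_p M` for the induced metric: the vectors of `T_p M`
that are orthogonal to `T_p M`. -/
def radical (G : SemiRiemannianMetric m Mb) (f : M → Mb) (p : M) :
    Submodule ℝ (TangentSpace (𝓡 k) p) where
  carrier := {x | ∀ y : TangentSpace (𝓡 k) p, G.val (f p) (dmap m k f p x) (dmap m k f p y) = 0}
  add_mem' := by intro a b ha hb y; simp [ha y, hb y]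
  zero_mem' := by intro y; simp
  smul_mem' := by intro c a ha y; simp [ha y]

/-- The normal space of `M` at `p`: the vectors of `T_{f p} Mb` that are orthogonal to `T_p M`. -/
def normalSpace (G : SemiRiemannianMetric m Mb) (f : M → Mb) (p : M) :
    Submodule ℝ (TangentSpace (𝓡 m) (f p)) where
  carrier := {v | ∀ y : TangentSpace (𝓡 k) p, G.val (f p) v (dmap m k f p y) = 0}
  add_mem' := by intro a b ha hb y; simp [ha y, hb y]
  zero_mem' := by intro y; simp
  smul_mem' := by intro c a ha y; simp [ha y]

/-- A half lightlike submanifold: an immersion `f : M → Mb` of codimension two for which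
the radical distribution has rank one, together with a screen distribution `screen`, complementary
to the radical distribution in `TM`, and a screen transversal bundle `screenTr`,
complementary to the radical distribution in the normal bundle. (These
complements are orthogonal and non-degenerate automatically.) -/
structure HalfLightlike (G : SemiRiemannianMetric m Mb) (k : ℕ) (M : Type*) [TopologicalSpace M]
    [ChartedSpace (Model k) M] [IsManifold (𝓡 k) ∞ M] where
  f : M → Mb
  smooth : ContMDiff (𝓡 k) (𝓡 m) ∞ f
  immersion : ∀ p, Function.Injective (dmap m k f p)
  codim : k + 2 = m
  finrank_radical : ∀ p, Module.finrank ℝ (radical (k := k) G f p) = 1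
  screen (p : M) : Submodule ℝ (TangentSpace (𝓡 k) p)
  screen_smooth : IsSmoothDistribution screen
  screen_isCompl : ∀ p, IsCompl (screen p) (radical G f p)
  screenTr (p : M) : Submodule ℝ (TangentSpace (𝓡 m) (f p))
  screenTr_smooth : ∀ p, ∀ v ∈ screenTr p, ∃ U : Set M, IsOpen U ∧ p ∈ U ∧
    ∃ V : (q : M) → TangentSpace (𝓡 m) (f q),
      ContMDiffOn (𝓡 k) (𝓡 m).tangent ∞ (fun q ↦ (⟨f q, V q⟩ : TangentBundle (𝓡 m) Mb)) U ∧
      V p = v ∧ ∀ q ∈ U, V q ∈ screenTr q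
  screenTr_inf : ∀ p, screenTr p ⊓ (radical G f p).map (dmap m k f p) = ⊥
  screenTr_sup : ∀ p, screenTr p ⊔ (radical G f p).map (dmap m k f p) = normalSpace (k := k) G f p

end Submanifold

/-- Linear algebra of the lightlike transversal line: if `R = W ∩ Wᗮ` is a line, `S` a complement
of `R` in `W` and `T` a complement of `R` in `Wᗮ`, then `T` together with the null vectors
orthogonal to `S` and `T` that pair to `1` with a vector of `R` spans a complement of `W`. -/
theorem isCompl_transversal {V : Type*} [AddCommGroup V] [Module ℝ V] [FiniteDimensional ℝ V]
    (b : LinearMap.BilinForm ℝ V) (hb : b.Nondegenerate) (hs : b.IsSymm)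
    (W R S T : Submodule ℝ V) (hR : R = W ⊓ b.orthogonal W) (hR1 : Module.finrank ℝ R = 1)
    (hS : S ⊓ R = ⊥) (hS' : S ⊔ R = W) (hT : T ⊓ R = ⊥) (hT' : T ⊔ R = b.orthogonal W) :
    IsCompl W (T ⊔ Submodule.span ℝ {v | b v v = 0 ∧ (∀ s ∈ S, b v s = 0) ∧
      (∀ t ∈ T, b v t = 0) ∧ ∃ r ∈ R, b v r = 1}) := by
  have symm : ∀ x y, b x y = b y x := fun x y ↦ by simpa using hs.eq x y
  have hrefl : b.IsRefl := hs.isRefl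
  have mem_orth : ∀ (X : Submodule ℝ V) v, v ∈ b.orthogonal X ↔ ∀ x ∈ X, b x v = 0 := by
    intro X v; rfl
  have SW : S ≤ W := hS' ▸ le_sup_left
  have TW : T ≤ b.orthogonal W := hT' ▸ le_sup_left
  have RW : R ≤ W := hR ▸ inf_le_left
  have RW' : R ≤ b.orthogonal W := hR ▸ inf_le_right
  have WW' : ∀ w ∈ W, ∀ v ∈ b.orthogonal W, b w v = 0 := fun w hw v hv ↦ hv w hw
  obtain ⟨ξ, hξ, hξ0, hξs⟩ : ∃ ξ ∈ R, ξ ≠ 0 ∧ ∀ r ∈ R, ∃ c : ℝ, r = c • ξ := by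
    obtain ⟨ξ, h0, h⟩ := finrank_eq_one_iff'.1 hR1
    refine ⟨ξ, ξ.2, by simpa using h0, fun r hr ↦ ?_⟩
    obtain ⟨c, hc⟩ := h ⟨r, hr⟩
    exact ⟨c, by simpa using congrArg Subtype.val hc.symm⟩
  -- a vector orthogonal to `W` and to its orthogonal lies in `R`
  have key : ∀ v, (∀ s ∈ S, b v s = 0) → (∀ t ∈ T, b v t = 0) → b v ξ = 0 → v ∈ R := by
    intro v h1 h2 h3
    have h3' : ∀ r ∈ R, b v r = 0 := by
      intro r hr; obtain ⟨c, rfl⟩ := hξs r hr; simp [h3]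
    rw [hR]
    refine ⟨?_, ?_⟩
    · rw [← LinearMap.BilinForm.orthogonal_orthogonal hb hrefl W]
      refine (mem_orth _ _).2 fun x hx ↦ ?_
      rw [← hT'] at hx
      obtain ⟨t, ht, r, hr, rfl⟩ := Submodule.mem_sup.1 hx
      rw [symm]; simp [h2 t ht, h3' r hr]
    · refine (mem_orth _ _).2 fun x hx ↦ ?_
      rw [← hS'] at hx
      obtain ⟨s, hs, r, hr, rfl⟩ := Submodule.mem_sup.1 hx
      rw [symm]; simp [h1 s hs, h3' r hr]
  have ξS : ∀ s ∈ S, b ξ s = 0 := fun s hs ↦ by rw [symm]; exact WW' s (SW hs) ξ (RW' hξ)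
  have ξT : ∀ t ∈ T, b ξ t = 0 := fun t ht ↦ WW' ξ (RW hξ) t (TW ht)
  have ξξ : b ξ ξ = 0 := WW' ξ (RW hξ) ξ (RW' hξ)
  obtain ⟨N, hN0, hN1, hN2, hN3⟩ : ∃ N, b N N = 0 ∧ (∀ s ∈ S, b N s = 0) ∧ (∀ t ∈ T, b N t = 0) ∧
      b N ξ = 1 := by
    have : ∃ v ∈ b.orthogonal (S ⊔ T), b v ξ ≠ 0 := by
      by_contra! h
      have : ξ ∈ S ⊔ T := by
        rw [← LinearMap.BilinForm.orthogonal_orthogonal hb hrefl (S ⊔ T), mem_orth]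
        exact h
      obtain ⟨s, hs, t, ht, hst⟩ := Submodule.mem_sup.1 this
      have ht0 : t ∈ T ⊓ R := by
        refine ⟨ht, ?_⟩
        rw [hR]
        refine ⟨?_, TW ht⟩
        have : t = ξ - s := by rw [← hst]; abel
        rw [this]; exact W.sub_mem (RW hξ) (SW hs)
      rw [hT, Submodule.mem_bot] at ht0
      have : ξ ∈ S ⊓ R := ⟨by rw [← hst, ht0, add_zero]; exact hs, hξ⟩
      rw [hS, Submodule.mem_bot] at this
      exact hξ0 this
    obtain ⟨v, hv, hvξ⟩ := this
    set u := (b v ξ)⁻¹ • v with hu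
    have huξ : b u ξ = 1 := by simp [hu, hvξ]
    have huS : ∀ s ∈ S, b u s = 0 := fun s hs ↦ by
      have : b s v = 0 := hv s (Submodule.mem_sup_left hs)
      simp [hu, symm v s, this]
    have huT : ∀ t ∈ T, b u t = 0 := fun t ht ↦ by
      have : b t v = 0 := hv t (Submodule.mem_sup_right ht)
      simp [hu, symm v t, this]
    refine ⟨u - (b u u / 2) • ξ, ?_, ?_, ?_, ?_⟩
    · simp [huξ, ξξ, symm ξ u]; ring
    · intro s hs; simp [huS s hs, ξS s hs]
    · intro t ht; simp [huT t ht, ξT t ht]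
    · simp [huξ, ξξ]
  -- the line spanned by the null vectors is spanned by `N`
  have hspan : Submodule.span ℝ {v | b v v = 0 ∧ (∀ s ∈ S, b v s = 0) ∧
      (∀ t ∈ T, b v t = 0) ∧ ∃ r ∈ R, b v r = 1} = Submodule.span ℝ {N} := by
    apply le_antisymm
    · rw [Submodule.span_le]
      rintro v ⟨h0, h1, h2, r, hr, h3⟩
      obtain ⟨a, rfl⟩ := hξs r hr
      have hc : b v ξ ≠ 0 := by intro h; simp [h] at h3
      have hmem := key (v - (b v ξ) • N) (fun s hs ↦ by simp [h1 s hs, hN1 s hs])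
        (fun t ht ↦ by simp [h2 t ht, hN2 t ht]) (by simp [hN3])
      obtain ⟨e, he⟩ := hξs _ hmem
      have hv : v = (b v ξ) • N + e • ξ := by rw [← he]; abel
      have h00 : b v v = 2 * (b v ξ) * e := by
        have h' := congrArg (fun z ↦ b z v) hv
        simp only [map_add, map_smul, LinearMap.add_apply, LinearMap.smul_apply,
          smul_eq_mul] at h'
        have hNv : b N v = e := by
          rw [hv]; simp [hN0, hN3]
        rw [h', hNv, symm ξ v]; ring
      rw [h0] at h00
      have : e = 0 := by
        rcases mul_eq_zero.1 h00.symm with h | h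
        · exact absurd (by simpa using h) hc
        · exact h
      rw [SetLike.mem_coe, hv, this, zero_smul, add_zero]
      exact Submodule.smul_mem _ _ (Submodule.mem_span_singleton_self N)
    · rw [Submodule.span_singleton_le_iff_mem]
      exact Submodule.subset_span ⟨hN0, hN1, hN2, ξ, hξ, hN3⟩
  rw [hspan]
  refine ⟨?_, ?_⟩
  · rw [Submodule.disjoint_def]
    intro w hw hw'
    obtain ⟨t, ht, l, hl, rfl⟩ := Submodule.mem_sup.1 hw'
    obtain ⟨c, rfl⟩ := Submodule.mem_span_singleton.1 hl
    have h1 : b (t + c • N) ξ = 0 := WW' _ hw ξ (RW' hξ)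
    have h2 : c = 0 := by simpa [hN3, symm t ξ, ξT t ht] using h1
    rw [h2, zero_smul, add_zero] at hw ⊢
    have : t ∈ T ⊓ R := ⟨ht, by rw [hR]; exact ⟨hw, TW ht⟩⟩
    rwa [hT, Submodule.mem_bot] at this
  · rw [codisjoint_iff, ← LinearMap.BilinForm.orthogonal_orthogonal hb hrefl
      (W ⊔ (T ⊔ Submodule.span ℝ {N}))]
    have : b.orthogonal (W ⊔ (T ⊔ Submodule.span ℝ {N})) = ⊥ := by
      rw [eq_bot_iff]
      intro v hv
      have hvW : ∀ w ∈ W, b w v = 0 := fun w hw ↦ hv w (Submodule.mem_sup_left hw)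
      have hvT : ∀ t ∈ T, b v t = 0 := fun t ht ↦ by
        rw [symm]; exact hv t (Submodule.mem_sup_right (Submodule.mem_sup_left ht))
      have hvN : b N v = 0 := hv N (Submodule.mem_sup_right
        (Submodule.mem_sup_right (Submodule.mem_span_singleton_self N)))
      have hvR := key v (fun s hs ↦ by rw [symm]; exact hvW s (SW hs)) hvT
        (by rw [symm]; exact hvW ξ (RW hξ))
      obtain ⟨c, rfl⟩ := hξs v hvR
      have : c = 0 := by simpa [hN3] using hvN
      simp [this]
    rw [this]
    rw [eq_top_iff]
    intro x _
    rw [mem_orth]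
    intro y hy
    rw [Submodule.mem_bot] at hy
    simp [hy]

namespace HalfLightlike

variable {m k : ℕ} {Mb : Type*} [TopologicalSpace Mb] [ChartedSpace (Model m) Mb]
  [IsManifold (𝓡 m) ∞ Mb] {M : Type*} [TopologicalSpace M] [ChartedSpace (Model k) M]
  [IsManifold (𝓡 k) ∞ M] {G : SemiRiemannianMetric m Mb} (H : HalfLightlike G k M)

/-- The differential of the immersion, `T_p M → T_{f p} Mb`. -/
def d (p : M) : TangentSpace (𝓡 k) p →ₗ[ℝ] TangentSpace (𝓡 m) (H.f p) := dmap m k H.f p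

/-- The radical distribution. -/
def rad (p : M) : Submodule ℝ (TangentSpace (𝓡 k) p) := radical G H.f p

/-- `v` is the lightlike transversal vector at `p` that corresponds to `r ∈ Rad(T_p M)`: it is
null, orthogonal to the screen distribution and to the screen transversal bundle, and `G(v, r) = 1`. -/
structure IsLightlikeTransversal (p : M) (r : TangentSpace (𝓡 k) p)
    (v : TangentSpace (𝓡 m) (H.f p)) : Prop where
  null : G.val (H.f p) v v = 0
  screen : ∀ s ∈ H.screen p, G.val (H.f p) v (H.d p s) = 0
  screenTr : ∀ t ∈ H.screenTr p, G.val (H.f p) v t = 0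
  pairing : G.val (H.f p) v (H.d p r) = 1

/-- The lightlike transversal bundle `ltr(TM)`. -/
def ltr (p : M) : Submodule ℝ (TangentSpace (𝓡 m) (H.f p)) :=
  Submodule.span ℝ {v | ∃ r ∈ H.rad p, H.IsLightlikeTransversal p r v}

/-- The transversal bundle `tr(TM)`, the sum of the screen transversal bundle and `ltr(TM)`. -/
def tr (p : M) : Submodule ℝ (TangentSpace (𝓡 m) (H.f p)) := H.screenTr p ⊔ H.ltr p

/-- The transversal bundle is complementary to the tangent bundle. -/
theorem isCompl_tr (p : M) : IsCompl (LinearMap.range (H.d p)) (H.tr p) := by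
  let V := TangentSpace (𝓡 m) (H.f p)
  have : FiniteDimensional ℝ V := inferInstanceAs (FiniteDimensional ℝ (Model m))
  let b : LinearMap.BilinForm ℝ V := LinearMap.mk₂ ℝ (fun x y ↦ G.val (H.f p) x y)
    (by intros; simp) (by intros; simp) (by intros; simp) (by intros; simp)
  have hbv : ∀ x y, b x y = G.val (H.f p) x y := fun x y ↦ rfl
  have hsymm : b.IsSymm := ⟨fun x y ↦ by simp [hbv, G.symm (H.f p) x y]⟩
  have hnd : b.Nondegenerate := by
    refine ⟨fun x hx ↦ G.nondegenerate _ x hx, fun x hx ↦ G.nondegenerate _ x fun y ↦ ?_⟩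
    rw [G.symm]; exact hx y
  have hinj : Function.Injective (H.d p) := H.immersion p
  have horth : ∀ v, v ∈ b.orthogonal (LinearMap.range (H.d p)) ↔
      ∀ y, G.val (H.f p) v (H.d p y) = 0 := by
    intro v
    constructor
    · intro h y
      rw [G.symm]; exact h _ ⟨y, rfl⟩
    · rintro h _ ⟨y, rfl⟩
      change G.val (H.f p) (H.d p y) v = 0
      rw [G.symm]; exact h y
  have h := isCompl_transversal b hnd hsymm (LinearMap.range (H.d p))
    ((H.rad p).map (H.d p)) ((H.screen p).map (H.d p)) (H.screenTr p) ?_ ?_ ?_ ?_ ?_ ?_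
  · convert h using 1
    unfold tr ltr
    congr 2
    ext v
    constructor
    · rintro ⟨r, hr, h⟩
      refine ⟨h.null, ?_, h.screenTr, H.d p r, ⟨r, hr, rfl⟩, h.pairing⟩
      rintro _ ⟨s, hs, rfl⟩
      exact h.screen s hs
    · rintro ⟨h0, h1, h2, _, ⟨r, hr, rfl⟩, h3⟩
      exact ⟨r, hr, h0, fun s hs ↦ h1 _ ⟨s, hs, rfl⟩, h2, h3⟩
  · ext v
    constructor
    · rintro ⟨r, hr, rfl⟩
      exact ⟨⟨r, rfl⟩, (horth _).2 hr⟩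
    · rintro ⟨⟨r, rfl⟩, hr⟩
      exact ⟨r, (horth _).1 hr, rfl⟩
  · rw [← H.finrank_radical p]
    exact (LinearEquiv.finrank_eq (Submodule.equivMapOfInjective (H.d p) hinj (H.rad p))).symm
  · rw [← Submodule.map_inf _ hinj]
    have := (H.screen_isCompl p).inf_eq_bot
    unfold rad
    rw [this, Submodule.map_bot]
  · rw [← Submodule.map_sup]
    have := (H.screen_isCompl p).sup_eq_top
    unfold rad
    rw [this, Submodule.map_top]
  · exact H.screenTr_inf p
  · refine (H.screenTr_sup p).trans ?_
    ext v
    exact (horth v).symm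

/-- A vector orthogonal to the normal space is tangent to `M`. -/
theorem exists_d_eq (p : M) (v : TangentSpace (𝓡 m) (H.f p))
    (hv : ∀ w ∈ normalSpace (k := k) G H.f p, G.val (H.f p) v w = 0) : ∃ u, H.d p u = v := by
  let V := TangentSpace (𝓡 m) (H.f p)
  have : FiniteDimensional ℝ V := inferInstanceAs (FiniteDimensional ℝ (Model m))
  let b : LinearMap.BilinForm ℝ V := LinearMap.mk₂ ℝ (fun x y ↦ G.val (H.f p) x y)
    (by intros; simp) (by intros; simp) (by intros; simp) (by intros; simp)
  have hbv : ∀ x y, b x y = G.val (H.f p) x y := fun x y ↦ rfl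
  have hsymm : b.IsSymm := ⟨fun x y ↦ by simp [hbv, G.symm (H.f p) x y]⟩
  have hnd : b.Nondegenerate := by
    refine ⟨fun x hx ↦ G.nondegenerate _ x hx, fun x hx ↦ G.nondegenerate _ x fun y ↦ ?_⟩
    rw [G.symm]; exact hx y
  have h : v ∈ b.orthogonal (b.orthogonal (LinearMap.range (H.d p))) := by
    intro w hw
    change G.val (H.f p) w v = 0
    rw [G.symm]
    refine hv w fun y ↦ ?_
    rw [G.symm]
    exact hw _ ⟨y, rfl⟩
  rw [LinearMap.BilinForm.orthogonal_orthogonal hnd hsymm.isRefl] at h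
  exact h

/-- The projection of `T_{f p} Mb = T_p M ⊕ tr(TM)_p` onto `T_p M`. -/
def tan (p : M) : TangentSpace (𝓡 m) (H.f p) →ₗ[ℝ] TangentSpace (𝓡 k) p :=
  LinearMap.linearProjOfIsCompl (H.tr p) (H.d p)
    (H.immersion p) (H.isCompl_tr p)

/-- The projection `P` of `TM = S(TM) ⊕ Rad(TM)` onto the screen distribution `S(TM)`. -/
def P (X : VField k M) : VField k M := fun p ↦
  ((H.screen p).projectionOnto (H.rad p) (H.screen_isCompl p) (X p) : TangentSpace (𝓡 k) p)

variable (D : Connection m Mb)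

/-- The derivative `D_X Y` of a tangent vector field `Y` of `M`, as a vector field along `f`. -/
def ambient (X Y : VField k M) (p : M) : TangentSpace (𝓡 m) (H.f p) :=
  covAlong D H.f (fun q ↦ H.d q (Y q)) p (X p)

/-- The induced connection `∇` of `M`: the tangential part of `D_X Y`. -/
def nabla (X Y : VField k M) : VField k M := fun p ↦ H.tan p (H.ambient D X Y p)

/-- The second fundamental form: the transversal part of `D_X Y`. -/
def secondForm (X Y : VField k M) (p : M) : TangentSpace (𝓡 m) (H.f p) :=
  H.ambient D X Y p - H.d p (H.nabla D X Y p)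

/-- On the open set `U`, `ξ` is a smooth section of `Rad(TM)` and `N` is the corresponding
section of `ltr(TM)`, with `G(N, ξ) = 1` (so that `ξ` has no zeros on `U`). -/
structure IsNullPair (U : Set M) (ξ : VField k M) (N : (p : M) → TangentSpace (𝓡 m) (H.f p)) :
    Prop where
  isOpen : IsOpen U
  smooth : SmoothOn ξ U
  mem_rad : ∀ p ∈ U, ξ p ∈ H.rad p
  transversal : ∀ p ∈ U, H.IsLightlikeTransversal p (ξ p) (N p)

/-- The local second fundamental form `B`, relative to a local section `ξ` of `Rad(TM)` with
corresponding section `N` of `ltr(TM)`. As `G(N, ξ) = 1` and `ξ` is orthogonal to the screen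
transversal bundle, it is the coefficient of `N` in the Gauss formula
`D_X Y = ∇_X Y + B(X, Y) N + (section of the screen transversal bundle)`. -/
def B (ξ : VField k M) (X Y : VField k M) (p : M) : ℝ :=
  G.val (H.f p) (H.secondForm D X Y p) (H.d p (ξ p))

/-- The shape operator `A_N` of a section `N` of `ltr(TM)`: minus the tangential part of `D_X N`. -/
def shape (N : (p : M) → TangentSpace (𝓡 m) (H.f p)) (X : VField k M) : VField k M :=
  fun p ↦ -H.tan p (covAlong D H.f N p (X p))

/-- The one-form `τ` in the Weingarten formula
`D_X N = -A_N X + τ(X) N + (section of the screen transversal bundle)`,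
the coefficient of `N` being obtained by pairing the transversal part with `ξ`. -/
def tau (ξ : VField k M) (N : (p : M) → TangentSpace (𝓡 m) (H.f p)) (X : VField k M) (p : M) : ℝ :=
  G.val (H.f p) (covAlong D H.f N p (X p) + H.d p (H.shape D N X p)) (H.d p (ξ p))

/-- The one-form `η(X) = G(X, N)` on `M`, so that `X = P X + η(X) ξ`. -/
def eta (N : (p : M) → TangentSpace (𝓡 m) (H.f p)) (X : VField k M) (p : M) : ℝ :=
  G.val (H.f p) (H.d p (X p)) (N p)

end HalfLightlike

/-! ### Ascreen radical screen transversal half lightlike submanifolds -/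

namespace HalfLightlike

variable {n k : ℕ} {Mb : Type*} [TopologicalSpace Mb] [ChartedSpace (Model (2 * n + 1)) Mb]
  [IsManifold (𝓡 (2 * n + 1)) ∞ Mb] {M : Type*} [TopologicalSpace M] [ChartedSpace (Model k) M]
  [IsManifold (𝓡 k) ∞ M] {A : AlmostContactBMetric n Mb} (H : HalfLightlike A.metric k M)

/-- Radical screen transversal half lightlike: `φ(Rad(TM)) = S(TM^⊥)`. -/
def IsRSTHL : Prop :=
  ∀ p, ((H.rad p).map (H.d p)).map (A.phi (H.f p)).toLinearMap = H.screenTr p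

/-- Ascreen: the Reeb field belongs to `Rad(TM) ⊕ ltr(TM)`. -/
def IsAscreen : Prop := ∀ p, A.xi (H.f p) ∈ (H.rad p).map (H.d p) ⊔ H.ltr p

/-- The vector field `φ(P X)` of `M`: on an ascreen RSTHL submanifold `φ` maps `S(TM)` to
itself, see `d_phiP`, so that `φ(P X)` is tangent to `M`. -/
def phiP (X : VField k M) : VField k M := fun p ↦ H.tan p (A.phi (H.f p) (H.d p (H.P X p)))

/-- On an ascreen RSTHL submanifold, `φ(P X)` is tangent to `M`. -/
theorem d_phiP (h1 : H.IsRSTHL) (h2 : H.IsAscreen) (X : VField k M) (p : M) :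
    H.d p (H.phiP X p) = A.phi (H.f p) (H.d p (H.P X p)) := by
  set G := A.metric.val (H.f p) with hG
  set φ := A.phi (H.f p) with hφ
  have gsymm : ∀ x y, G x y = G y x := A.metric.symm (H.f p)
  have phi_tr : ∀ r ∈ H.rad p, φ (H.d p r) ∈ H.screenTr p := fun r hr ↦ by
    rw [← h1 p]; exact ⟨_, ⟨r, hr, rfl⟩, rfl⟩
  have tr_normal : ∀ t ∈ H.screenTr p, ∀ y, G t (H.d p y) = 0 := fun t ht ↦ by
    have : t ∈ normalSpace (k := k) A.metric H.f p := by
      rw [← H.screenTr_sup p]; exact Submodule.mem_sup_left ht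
    exact this
  have hs : H.P X p ∈ H.screen p := Subtype.prop _
  set s := H.P X p with hsdef
  have hltr : ∀ l ∈ H.ltr p, G l (H.d p s) = 0 := by
    intro l hl
    induction hl using Submodule.span_induction with
    | mem l hl => obtain ⟨r, _, h⟩ := hl; exact h.screen s hs
    | zero => simp
    | add a b _ _ ha hb => simp [ha, hb]
    | smul c a _ ha => simp [ha]
  have hxi : G (A.xi (H.f p)) (H.d p s) = 0 := by
    obtain ⟨_, ⟨r, hr, rfl⟩, l, hl, h⟩ := Submodule.mem_sup.1 (h2 p)
    rw [← h, map_add, add_apply, hltr l hl, add_zero]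
    exact hr s
  have hphixi : φ (A.xi (H.f p)) = 0 := by
    have e1 : φ (φ (A.xi (H.f p))) = 0 := by simp [hφ, A.phi_sq, A.eta_xi]
    have e2 := A.phi_sq (H.f p) (φ (A.xi (H.f p)))
    rw [← hφ, e1, map_zero] at e2
    have e3 : φ (A.xi (H.f p)) = A.eta (H.f p) (φ (A.xi (H.f p))) • A.xi (H.f p) := by
      rw [eq_comm, ← sub_eq_zero, sub_eq_neg_add]; exact e2.symm
    have e4 : A.eta (H.f p) (φ (A.xi (H.f p))) = 0 := by
      have e5 := e1
      rw [e3, map_smul, e3, smul_smul] at e5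
      have e6 := congrArg (A.eta (H.f p)) e5
      simpa [A.eta_xi] using e6
    rw [e3, e4, zero_smul]
  have eta_eq : ∀ x, A.eta (H.f p) x = G x (A.xi (H.f p)) := fun x ↦ by
    have := A.metric_phi (H.f p) x (A.xi (H.f p))
    rw [← hφ, hphixi, A.eta_xi, map_zero] at this
    linarith
  have hetas : A.eta (H.f p) (H.d p s) = 0 := by rw [eta_eq, gsymm]; exact hxi
  have orth : ∀ v ∈ normalSpace (k := k) A.metric H.f p, G (φ (H.d p s)) v = 0 := by
    intro v hv
    rw [← H.screenTr_sup p] at hv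
    obtain ⟨t, ht, _, ⟨r, hr, rfl⟩, rfl⟩ := Submodule.mem_sup.1 hv
    rw [map_add]
    have ht0 : G (φ (H.d p s)) t = 0 := by
      rw [← h1 p] at ht
      obtain ⟨_, ⟨r', hr', rfl⟩, rfl⟩ := ht
      have := A.metric_phi (H.f p) (H.d p s) (H.d p r')
      rw [hetas, zero_mul, add_zero, A.metric.symm _ (H.d p s) (H.d p r')] at this
      refine this.trans ?_
      rw [neg_eq_zero]; exact hr' s
    have hr0 : G (φ (H.d p s)) (H.d p r) = 0 := by
      have e := A.metric_phi (H.f p) (φ (H.d p s)) (H.d p r)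
      rw [← hφ, hφ, A.phi_sq, hetas, zero_smul, add_zero, ← hφ] at e
      have e1 : G (-(H.d p s)) (φ (H.d p r)) = 0 := by
        rw [gsymm, map_neg, tr_normal _ (phi_tr r hr), neg_zero]
      have e2 : A.eta (H.f p) (φ (H.d p s)) = 0 := by
        have e3 := A.metric_phi (H.f p) (H.d p s) (A.xi (H.f p))
        have e4 := congrArg (A.eta (H.f p)) (congrArg φ (A.phi_sq (H.f p) (H.d p s)))
        have e5 := congrArg (A.eta (H.f p)) (A.phi_sq (H.f p) (φ (H.d p s)))
        rw [← hφ] at e4 e5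
        rw [e4] at e5
        simp only [hetas, zero_smul, add_zero, map_neg, map_add, map_smul, A.eta_xi,
          smul_eq_mul, mul_one] at e5
        linarith
      rw [e2, zero_mul, add_zero] at e
      have e' : G (-(H.d p s)) (φ (H.d p r)) = -G (φ (H.d p s)) (H.d p r) := e
      rw [e1] at e'
      linarith
    have : dmap (2 * n + 1) k H.f p r = H.d p r := rfl
    rw [this, ht0, hr0, add_zero]
  obtain ⟨u, hu⟩ := H.exists_d_eq p _ orth
  have htan : H.tan p (φ (H.d p s)) = u := by
    rw [← hu]
    exact LinearMap.linearProjOfIsCompl_apply_left (q := H.tr p) (i := H.d p)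
      (H.immersion p) (H.isCompl_tr p) u
  change H.d p (H.tan p (φ (H.d p s))) = _
  rw [htan, hu]

/-- The vector field `φ X` along `M`, for a vector field `X` of `M`. -/
def phiD (X : VField k M) (p : M) : TangentSpace (𝓡 (2 * n + 1)) (H.f p) :=
  A.phi (H.f p) (H.d p (X p))

/-- The function `g(X, Y)`. -/
def gXY (X Y : VField k M) (p : M) : ℝ := A.g (H.f p) (H.d p (X p)) (H.d p (Y p))

/-- The function `g(X, φ Y)`. -/
def gXphiY (X Y : VField k M) (p : M) : ℝ := A.g (H.f p) (H.d p (X p)) (H.phiD Y p)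

/-- The function `g(φ X, φ Y)`. -/
def gphiXphiY (X Y : VField k M) (p : M) : ℝ := A.g (H.f p) (H.phiD X p) (H.phiD Y p)

/-- The function `μ = η(ξ)`, where `η` is the contact form of the ambient manifold. -/
def mu (ξ : VField k M) (p : M) : ℝ := A.eta (H.f p) (H.d p (ξ p))

end HalfLightlike

end LightlikeGeometry

end

noncomputable section

namespace LightlikeGeometry

set_option linter.unusedSectionVars false

/-! The ambient Levi-Civita connection is pulled back along the immersion, the curvature of the
pulled-back connection is the pulled-back ambient curvature (`covAlong_curvature`), and both
equations come from splitting this identity: its tangential part is (15), its pairing with ξ is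
(16).

Ambient curvature. On an F₀-manifold φ is parallel, hence so are the Reeb field and the associated
metric; by uniqueness of the Levi-Civita connection both metrics have the same one
(`connection_assocMetric`). The curvature vanishes when the Reeb field fills a slot. On the kernel
of the contact form, φ is a complex structure J that commutes with the curvature, so K(x,y,z,w) - i
K(x,y,z,Jw) is a curvature-like tensor, complex linear in each slot. Totally real g-orthonormal
pairs are exactly the orthonormal pairs of the complex metric h = g - i g(·,J·), so the hypothesis
says that the complex sectional curvature is ν - iν'. Over ℂ the values on orthonormal pairs
determine a curvature-like tensor, whence `eq_of_totallyReal` and the explicit formula `curv_eq`.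

Geometry of the submanifold. The ascreen condition forces the Reeb field to be (2μ)⁻¹ξ + μN, so φN =
-(2μ²)⁻¹φξ, while the screen transversal bundle is spanned by φξ, with g(φξ,φξ) = μ². Since φ is
parallel and self-adjoint, D_X N has no φξ component, A_N takes values in the screen, the φξ
coefficient of D_Y Z is μ⁻²B(Y,φPZ), and the tangential part of D_X(φξ) is 2μ²φ(A_N X). The powers
of μ cancel and leave the terms 2B(Y,φPZ)φ(A_N X) (`d_tan_curv`, `metric_curv_rad`).

In the formula for the ambient curvature, X minus its Reeb component has tangential part PX + ½η(X)ξ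
and pairs with ξ to -μ²η(X), while φX has tangential part φPX and is orthogonal to ξ. Substitution
gives the two equations. -/

/-! ### Smooth germs along a map -/

/-- The real function `h` is smooth near `p`. -/
def FunSmoothNear (k : ℕ) {M : Type*} [TopologicalSpace M] [ChartedSpace (Model k) M]
    (h : M → ℝ) (p : M) : Prop :=
  ∀ᶠ q in 𝓝 p, ContMDiffAt (𝓡 k) 𝓘(ℝ, ℝ) ∞ h q

/-- The vector field `V` along `f` is smooth near `p`. -/
def SmoothNear {m : ℕ} (k : ℕ) {Mb : Type*} [TopologicalSpace Mb] [ChartedSpace (Model m) Mb]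
    [IsManifold (𝓡 m) ∞ Mb] {M : Type*} [TopologicalSpace M] [ChartedSpace (Model k) M]
    (f : M → Mb) (V : (q : M) → TangentSpace (𝓡 m) (f q)) (p : M) : Prop :=
  ∀ᶠ q in 𝓝 p, ContMDiffAt (𝓡 k) (𝓡 m).tangent ∞
    (fun q ↦ (⟨f q, V q⟩ : TangentBundle (𝓡 m) Mb)) q

section Functions

variable {k : ℕ} {M : Type*} [TopologicalSpace M] [ChartedSpace (Model k) M]
  {h h' : M → ℝ} {p : M}

theorem FunSmoothNear.contMDiffAt (hh : FunSmoothNear k h p) :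
    ContMDiffAt (𝓡 k) 𝓘(ℝ, ℝ) ∞ h p := Filter.Eventually.self_of_nhds hh

theorem FunSmoothNear.mdifferentiableAt (hh : FunSmoothNear k h p) :
    MDifferentiableAt (𝓡 k) 𝓘(ℝ, ℝ) h p := hh.contMDiffAt.mdifferentiableAt (by simp)

/-- `ContMDiffAt` of order ∞ at a single point only gives C^m on a neighbourhood that depends on m.
Requiring it at all nearby points makes the condition open, which iterated derivatives need. -/
theorem FunSmoothNear.eventually (hh : FunSmoothNear k h p) :
    ∀ᶠ q in 𝓝 p, FunSmoothNear k h q := Filter.Eventually.eventually_nhds hh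

theorem FunSmoothNear.congr (hh : FunSmoothNear k h p) (e : ∀ᶠ q in 𝓝 p, h q = h' q) :
    FunSmoothNear k h' p := by
  filter_upwards [hh, Filter.Eventually.eventually_nhds e] with q hq eq
  exact hq.congr_of_eventuallyEq (eq.mono fun _ h ↦ h.symm)

theorem FunSmoothNear.add (hh : FunSmoothNear k h p) (hh' : FunSmoothNear k h' p) :
    FunSmoothNear k (fun q ↦ h q + h' q) p := by
  filter_upwards [hh, hh'] with q a b using a.add b

theorem FunSmoothNear.mul (hh : FunSmoothNear k h p) (hh' : FunSmoothNear k h' p) :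
    FunSmoothNear k (fun q ↦ h q * h' q) p := by
  filter_upwards [hh, hh'] with q a b
  exact a.mul b

theorem FunSmoothNear.neg (hh : FunSmoothNear k h p) : FunSmoothNear k (fun q ↦ -h q) p := by
  filter_upwards [hh] with q a
  exact a.neg

theorem FunSmoothNear.const (c : ℝ) : FunSmoothNear k (fun _ : M ↦ c) p :=
  Filter.Eventually.of_forall fun _ ↦ contMDiffAt_const

theorem FunSmoothNear.inv (hh : FunSmoothNear k h p) (h0 : h p ≠ 0) :
    FunSmoothNear k (fun q ↦ (h q)⁻¹) p := by
  have : ∀ᶠ q in 𝓝 p, h q ≠ 0 := hh.contMDiffAt.continuousAt.eventually_ne h0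
  filter_upwards [hh, this] with q a b
  exact a.inv₀ b

theorem mvfderiv_congr {F : Type*} [NormedAddCommGroup F] [NormedSpace ℝ F]
    {h h' : M → F} (e : ∀ᶠ q in 𝓝 p, h q = h' q) :
    mvfderiv (𝓡 k) h p = mvfderiv (𝓡 k) h' p := by
  have h1 : h =ᶠ[𝓝 p] h' := e
  unfold mvfderiv
  rw [h1.mfderiv_eq, e.self_of_nhds]

end Functions

/-! ### Constant-coefficient extensions of tangent vectors -/

section Extend

variable {m : ℕ} {Mb : Type*} [TopologicalSpace Mb] [ChartedSpace (Model m) Mb]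
  [IsManifold (𝓡 m) ∞ Mb] {y : Mb}

/-- The local vector field with constant coefficients in the trivialization at `y` that extends the
tangent vector `u` at `y`; it is linear in `u`. -/
def localExt (u : TangentSpace (𝓡 m) y) : VField m Mb := fun z ↦
  (trivializationAt (Model m) (TangentSpace (𝓡 m)) y).symmL ℝ z
    ((trivializationAt (Model m) (TangentSpace (𝓡 m)) y).continuousLinearMapAt ℝ y u)

theorem continuousLinearMapAt_self_eq (u : TangentSpace (𝓡 m) y) :
    (trivializationAt (Model m) (TangentSpace (𝓡 m)) y).continuousLinearMapAt ℝ y u =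
      (trivializationAt (Model m) (TangentSpace (𝓡 m)) y ⟨y, u⟩).2 :=
  congrFun ((trivializationAt (Model m) (TangentSpace (𝓡 m)) y).coe_linearMapAt_of_mem (R := ℝ)
    (FiberBundle.mem_baseSet_trivializationAt' y)) u

theorem localExt_eq_symm (u : TangentSpace (𝓡 m) y) {z : Mb}
    (hz : z ∈ (trivializationAt (Model m) (TangentSpace (𝓡 m)) y).baseSet) :
    localExt u z = (trivializationAt (Model m) (TangentSpace (𝓡 m)) y).symm z
      (trivializationAt (Model m) (TangentSpace (𝓡 m)) y ⟨y, u⟩).2 := by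
  rw [localExt, Trivialization.symmL_apply _ hz, continuousLinearMapAt_self_eq]

theorem eventually_mem_baseSet (m : ℕ) {Mb : Type*} [TopologicalSpace Mb]
    [ChartedSpace (Model m) Mb] [IsManifold (𝓡 m) ∞ Mb] (y : Mb) :
    ∀ᶠ z in 𝓝 y, z ∈ (trivializationAt (Model m) (TangentSpace (𝓡 m)) y).baseSet :=
  (trivializationAt (Model m) (TangentSpace (𝓡 m)) y).open_baseSet.mem_nhds
    (FiberBundle.mem_baseSet_trivializationAt' y)

theorem extend_eventuallyEq (u : TangentSpace (𝓡 m) y) :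
    ∀ᶠ z in 𝓝 y, (FiberBundle.extend (Model m) u : VField m Mb) z = localExt u z := by
  filter_upwards [eventually_mem_baseSet m y] with z hz
  rw [localExt_eq_symm u hz]
  rfl

@[simp]
theorem localExt_self (u : TangentSpace (𝓡 m) y) : localExt u y = u := by
  rw [← (extend_eventuallyEq u).self_of_nhds, FiberBundle.extend_apply_self]

/-- An identity of fields on the whole manifold and not only of germs, because `symmL` is a linear
map over every point. -/
theorem localExt_add (u v : TangentSpace (𝓡 m) y) :
    localExt (u + v) = localExt u + localExt v := by
  funext z
  simp only [Pi.add_apply, localExt, map_add]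

theorem localExt_smul (c : ℝ) (u : TangentSpace (𝓡 m) y) :
    localExt (c • u) = c • localExt u := by
  funext z
  simp only [Pi.smul_apply, localExt, map_smul]

theorem contMDiffAt_localExt (u : TangentSpace (𝓡 m) y) {z : Mb}
    (hz : z ∈ (trivializationAt (Model m) (TangentSpace (𝓡 m)) y).baseSet) :
    ContMDiffAt (𝓡 m) (𝓡 m).tangent ∞
      (fun q ↦ (⟨q, localExt u q⟩ : TangentBundle (𝓡 m) Mb)) z := by
  set e := trivializationAt (Model m) (TangentSpace (𝓡 m)) y with he
  refine (e.contMDiffAt_section_iff (IB := 𝓡 m) (n := ∞) hz).2 ?_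
  refine (contMDiffAt_const (c := (e ⟨y, u⟩).2)).congr_of_eventuallyEq ?_
  filter_upwards [e.open_baseSet.mem_nhds hz] with q hq
  rw [localExt_eq_symm u hq, ← he, e.apply_mk_symm hq]

theorem smoothNear_localExt (u : TangentSpace (𝓡 m) y) : SmoothNear (f := id) m (localExt u) y := by
  filter_upwards [eventually_mem_baseSet m y] with q hq
  exact contMDiffAt_localExt u hq

end Extend

/-! ### Vector fields along a map: coordinates and induction on generators -/

section Fields

variable {m k : ℕ} {Mb : Type*} [TopologicalSpace Mb] [ChartedSpace (Model m) Mb]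
  [IsManifold (𝓡 m) ∞ Mb] {M : Type*} [TopologicalSpace M] [ChartedSpace (Model k) M]
  {f : M → Mb} {V W : (q : M) → TangentSpace (𝓡 m) (f q)} {p : M}

theorem SmoothNear.contMDiffAt (hV : SmoothNear k f V p) :
    ContMDiffAt (𝓡 k) (𝓡 m).tangent ∞
      (fun q ↦ (⟨f q, V q⟩ : TangentBundle (𝓡 m) Mb)) p := Filter.Eventually.self_of_nhds hV

theorem SmoothNear.mdifferentiableAt (hV : SmoothNear k f V p) :
    MDifferentiableAt (𝓡 k) (𝓡 m).tangent
      (fun q ↦ (⟨f q, V q⟩ : TangentBundle (𝓡 m) Mb)) p :=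
  hV.contMDiffAt.mdifferentiableAt (by simp)

theorem SmoothNear.eventually (hV : SmoothNear k f V p) :
    ∀ᶠ q in 𝓝 p, SmoothNear k f V q := Filter.Eventually.eventually_nhds hV

theorem SmoothNear.congr (hV : SmoothNear k f V p) (e : ∀ᶠ q in 𝓝 p, V q = W q) :
    SmoothNear k f W p := by
  filter_upwards [hV, Filter.Eventually.eventually_nhds e] with q hq eq
  refine hq.congr_of_eventuallyEq (eq.mono fun q h ↦ ?_)
  simp only [h]

/-- Coordinates of a vector field along `f` in the trivialization of the tangent bundle at `y`. -/
def coord (y : Mb) (V : (q : M) → TangentSpace (𝓡 m) (f q)) (q : M) : Model m :=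
  (trivializationAt (Model m) (TangentSpace (𝓡 m)) y ⟨f q, V q⟩).2

theorem contMDiffAt_along_iff {y : Mb} {q : M}
    (hq : f q ∈ (trivializationAt (Model m) (TangentSpace (𝓡 m)) y).baseSet) :
    ContMDiffAt (𝓡 k) (𝓡 m).tangent ∞ (fun q ↦ (⟨f q, V q⟩ : TangentBundle (𝓡 m) Mb)) q ↔
      ContMDiffAt (𝓡 k) (𝓡 m) ∞ f q ∧ ContMDiffAt (𝓡 k) 𝓘(ℝ, Model m) ∞ (coord y V) q := by
  refine ((trivializationAt (Model m) (TangentSpace (𝓡 m)) y).contMDiffAt_iff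
    (IB := 𝓡 m) (IM := 𝓡 k) (n := ∞) (f := fun q ↦ (⟨f q, V q⟩ : TangentBundle (𝓡 m) Mb))
    (x₀ := q) ?_)
  rw [Trivialization.mem_source]; exact hq

end Fields

section Fields

variable {m k : ℕ} {Mb : Type*} [TopologicalSpace Mb] [ChartedSpace (Model m) Mb]
  [IsManifold (𝓡 m) ∞ Mb] {M : Type*} [TopologicalSpace M] [ChartedSpace (Model k) M]
  {f : M → Mb} {V W : (q : M) → TangentSpace (𝓡 m) (f q)} {p : M}

/-- The coordinate vector at `y` of the trivialization of the tangent bundle at `y`. -/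
def frameVec (y : Mb) (i : Fin m) : TangentSpace (𝓡 m) y :=
  (trivializationAt (Model m) (TangentSpace (𝓡 m)) y).symmL ℝ y (EuclideanSpace.single i 1)

/-- Fields along `f` are locally generated, over functions on the source, by pull-backs of fields of
the target. This underlies `SmoothNear.induction`. -/
theorem eq_sum_coord {y : Mb} {q : M}
    (hq : f q ∈ (trivializationAt (Model m) (TangentSpace (𝓡 m)) y).baseSet) :
    V q = ∑ i, coord y V q i • localExt (frameVec y i) (f q) := by
  set e := trivializationAt (Model m) (TangentSpace (𝓡 m)) y with he
  have h1 : ∀ i, localExt (frameVec y i) (f q) = e.symmL ℝ (f q) (EuclideanSpace.single i 1) := by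
    intro i
    exact congrArg (e.symmL ℝ (f q))
      (e.continuousLinearMapAt_symmL (FiberBundle.mem_baseSet_trivializationAt' y) _)
  have h2 : (coord y V q) = ∑ i, coord y V q i • (EuclideanSpace.single i (1 : ℝ)) := by
    ext j
    simp [Finset.sum_apply, Pi.single_apply]
  have h3 : V q = e.symmL ℝ (f q) (coord y V q) := by
    rw [e.symmL_apply hq, coord, ← he, e.symm_apply_apply_mk hq]
  simp only [h1, ← map_smul]
  rw [← map_sum, ← h2, h3]

theorem funSmoothNear_coord (hV : SmoothNear k f V p) (i : Fin m) :
    FunSmoothNear k (fun q ↦ coord (f p) V q i) p := by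
  have hc : ∀ᶠ q in 𝓝 p, f q ∈ (trivializationAt (Model m) (TangentSpace (𝓡 m)) (f p)).baseSet := by
    have : ContMDiffAt (𝓡 k) (𝓡 m) ∞ f p :=
      ((contMDiffAt_along_iff (FiberBundle.mem_baseSet_trivializationAt' (f p))).1
        hV.contMDiffAt).1
    exact this.continuousAt.eventually (eventually_mem_baseSet m (f p))
  filter_upwards [hV, hc] with q hq hcq
  have h := ((contMDiffAt_along_iff hcq).1 hq).2
  have := (EuclideanSpace.proj (𝕜 := ℝ) i : Model m →L[ℝ] ℝ).contMDiff (n := ∞)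
  exact this.contMDiffAt.comp q h

theorem SmoothNear.map (hV : SmoothNear k f V p) :
    ∀ᶠ q in 𝓝 p, ContMDiffAt (𝓡 k) (𝓡 m) ∞ f q := by
  filter_upwards [hV] with q hq
  exact ((contMDiffAt_along_iff (FiberBundle.mem_baseSet_trivializationAt' (f q))).1 hq).1

theorem coord_add (y : Mb) {q : M}
    (hq : f q ∈ (trivializationAt (Model m) (TangentSpace (𝓡 m)) y).baseSet) :
    coord y (fun q ↦ V q + W q) q = coord y V q + coord y W q := by
  have h := (trivializationAt (Model m) (TangentSpace (𝓡 m)) y).coe_linearMapAt_of_mem (R := ℝ) hq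
  have h' := map_add ((trivializationAt (Model m) (TangentSpace (𝓡 m)) y).linearMapAt ℝ (f q))
    (V q) (W q)
  rw [h] at h'
  exact h'

theorem coord_smul (y : Mb) {q : M} (h : M → ℝ)
    (hq : f q ∈ (trivializationAt (Model m) (TangentSpace (𝓡 m)) y).baseSet) :
    coord y (fun q ↦ h q • V q) q = h q • coord y V q := by
  have e := (trivializationAt (Model m) (TangentSpace (𝓡 m)) y).coe_linearMapAt_of_mem (R := ℝ) hq
  have h' := map_smul ((trivializationAt (Model m) (TangentSpace (𝓡 m)) y).linearMapAt ℝ (f q))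
    (h q) (V q)
  rw [e] at h'
  exact h'

theorem SmoothNear.add (hV : SmoothNear k f V p) (hW : SmoothNear k f W p) :
    SmoothNear k f (fun q ↦ V q + W q) p := by
  filter_upwards [hV, hW, Filter.Eventually.eventually_nhds hV.map] with q a b c
  have hb := FiberBundle.mem_baseSet_trivializationAt' (F := Model m)
    (E := (TangentSpace (𝓡 m) : Mb → Type _)) (f q)
  rw [contMDiffAt_along_iff hb] at a b ⊢
  refine ⟨a.1, (a.2.add b.2).congr_of_eventuallyEq ?_⟩
  filter_upwards [a.1.continuousAt.eventually (eventually_mem_baseSet m (f q))] with z hz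
  rw [coord_add (f q) hz]; rfl

theorem SmoothNear.smul {h : M → ℝ} (hh : FunSmoothNear k h p) (hV : SmoothNear k f V p) :
    SmoothNear k f (fun q ↦ h q • V q) p := by
  filter_upwards [hV, hh, Filter.Eventually.eventually_nhds hV.map] with q a b c
  have hb := FiberBundle.mem_baseSet_trivializationAt' (F := Model m)
    (E := (TangentSpace (𝓡 m) : Mb → Type _)) (f q)
  rw [contMDiffAt_along_iff hb] at a ⊢
  refine ⟨a.1, (b.smul a.2).congr_of_eventuallyEq ?_⟩
  filter_upwards [a.1.continuousAt.eventually (eventually_mem_baseSet m (f q))] with z hz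
  rw [coord_smul (f q) h hz]; rfl

theorem SmoothNear.comp {σ : VField m Mb} (hσ : SmoothNear (f := id) m σ (f p))
    (hf : ∀ᶠ q in 𝓝 p, ContMDiffAt (𝓡 k) (𝓡 m) ∞ f q) :
    SmoothNear k f (fun q ↦ σ (f q)) p := by
  filter_upwards [hf.self_of_nhds.continuousAt.eventually hσ, hf] with q a b
  exact ContMDiffAt.comp q a b

theorem FunSmoothNear.comp {h : Mb → ℝ} (hh : FunSmoothNear m h (f p))
    (hf : ∀ᶠ q in 𝓝 p, ContMDiffAt (𝓡 k) (𝓡 m) ∞ f q) :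
    FunSmoothNear k (fun q ↦ h (f q)) p := by
  filter_upwards [hf.self_of_nhds.continuousAt.eventually hh, hf] with q a b
  exact ContMDiffAt.comp q a b

/-- An identity that depends only on germs and is additive need only be checked on a function times
the pull-back of a constant-coefficient field. The metric, torsion and curvature identities along
`f` are all reduced in this way to identities on the target. -/
theorem SmoothNear.induction
    {P : ((q : M) → TangentSpace (𝓡 m) (f q)) → Prop}
    (congr : ∀ V W, (∀ᶠ q in 𝓝 p, V q = W q) → P V → P W)
    (add : ∀ V W, SmoothNear k f V p → SmoothNear k f W p → P V → P W → P (fun q ↦ V q + W q))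
    (smul : ∀ h, FunSmoothNear k h p → ∀ u : TangentSpace (𝓡 m) (f p),
      P (fun q ↦ h q • localExt u (f q)))
    (hV : SmoothNear k f V p) : P V := by
  classical
  have hc : ∀ᶠ q in 𝓝 p, f q ∈ (trivializationAt (Model m) (TangentSpace (𝓡 m)) (f p)).baseSet :=
    hV.map.self_of_nhds.continuousAt.eventually (eventually_mem_baseSet m (f p))
  have main : ∀ s : Finset (Fin m),
      SmoothNear k f (fun q ↦ ∑ i ∈ s, coord (f p) V q i • localExt (frameVec (f p) i) (f q)) p ∧
      P (fun q ↦ ∑ i ∈ s, coord (f p) V q i • localExt (frameVec (f p) i) (f q)) := by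
    intro s
    induction s using Finset.induction_on with
    | empty =>
      constructor
      · refine (SmoothNear.smul (FunSmoothNear.const 0) hV).congr (Filter.Eventually.of_forall ?_)
        intro q; simp
      · refine congr _ _ ?_ (smul (fun _ ↦ 0) (FunSmoothNear.const 0) 0)
        exact Filter.Eventually.of_forall fun q ↦ by simp
    | insert i s hi ih =>
      have h1 : SmoothNear k f
          (fun q ↦ coord (f p) V q i • localExt (frameVec (f p) i) (f q)) p :=
        SmoothNear.smul (funSmoothNear_coord hV i) (SmoothNear.comp (smoothNear_localExt _) hV.map)
      have h2 := add _ _ h1 ih.1 (smul _ (funSmoothNear_coord hV i) _) ih.2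
      simp only [Finset.sum_insert hi]
      exact ⟨h1.add ih.1, h2⟩
  refine congr _ _ ?_ (main Finset.univ).2
  filter_upwards [hc] with q hq
  exact (eq_sum_coord hq).symm

end Fields

/-! ### Germ, sum and Leibniz rules for a connection -/

section Connection

variable {m : ℕ} {Mb : Type*} [TopologicalSpace Mb] [ChartedSpace (Model m) Mb]
  [IsManifold (𝓡 m) ∞ Mb] (D : Connection m Mb) {σ τ : VField m Mb} {y : Mb}

theorem connection_congr (hσ : SmoothNear (f := id) m σ y) (e : ∀ᶠ z in 𝓝 y, σ z = τ z) :
    D σ y = D τ y :=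
  D.isCovariantDerivativeOnUniv.congr_of_eventuallyEq hσ.mdifferentiableAt
    (hσ.congr e).mdifferentiableAt Filter.univ_mem e

theorem connection_add (hσ : SmoothNear (f := id) m σ y) (hτ : SmoothNear (f := id) m τ y) :
    D (fun z ↦ σ z + τ z) y = D σ y + D τ y :=
  D.isCovariantDerivativeOnUniv.add hσ.mdifferentiableAt hτ.mdifferentiableAt

theorem connection_smul {h : Mb → ℝ} (hh : FunSmoothNear m h y)
    (hσ : SmoothNear (f := id) m σ y) (v : TangentSpace (𝓡 m) y) :
    D (fun z ↦ h z • σ z) y v = h y • D σ y v + mvfderiv (𝓡 m) h y v • σ y := by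
  have := D.isCovariantDerivativeOnUniv.leibniz hσ.mdifferentiableAt hh.mdifferentiableAt
  exact congrArg (fun L : TangentSpace (𝓡 m) y →L[ℝ] TangentSpace (𝓡 m) y ↦ L v) this

theorem connection_localExt_add (u v : TangentSpace (𝓡 m) y) :
    D (localExt (u + v)) y = D (localExt u) y + D (localExt v) y := by
  rw [localExt_add]
  exact connection_add D (smoothNear_localExt u) (smoothNear_localExt v)

theorem connection_localExt_smul (c : ℝ) (u : TangentSpace (𝓡 m) y) :
    D (localExt (c • u)) y = c • D (localExt u) y := by
  rw [localExt_smul]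
  exact D.isCovariantDerivativeOnUniv.smul_const c (smoothNear_localExt u).mdifferentiableAt

end Connection

/-! ### The covariant derivative along a map -/

section Along

variable {m k : ℕ} {Mb : Type*} [TopologicalSpace Mb] [ChartedSpace (Model m) Mb]
  [IsManifold (𝓡 m) ∞ Mb] {M : Type*} [TopologicalSpace M] [ChartedSpace (Model k) M]
  (D : Connection m Mb)
  {f : M → Mb} {V W : (q : M) → TangentSpace (𝓡 m) (f q)} {p : M}

/-- With `symmL` and `localExt` in place of `symm` and `extend`, both terms are manifestly linear in
the field. -/
theorem covAlong_eq (V : (q : M) → TangentSpace (𝓡 m) (f q)) (p : M)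
    (v : TangentSpace (𝓡 k) p) :
    covAlong D f V p v =
      (trivializationAt (Model m) (TangentSpace (𝓡 m)) (f p)).symmL ℝ (f p)
        (mvfderiv (𝓡 k) (coord (f p) V) p v) + D (localExt (V p)) (f p) (dmap m k f p v) := by
  have h := connection_congr D (smoothNear_localExt (V p))
    ((extend_eventuallyEq (V p)).mono fun _ h ↦ h.symm)
  rw [h, Trivialization.symmL_apply _ (FiberBundle.mem_baseSet_trivializationAt' _)]
  rfl

theorem SmoothNear.coord (hV : SmoothNear k f V p) :
    MDifferentiableAt (𝓡 k) 𝓘(ℝ, Model m) (coord (f p) V) p := by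
  have := ((contMDiffAt_along_iff (FiberBundle.mem_baseSet_trivializationAt' (f p))).1
    hV.contMDiffAt).2
  exact this.mdifferentiableAt (by simp)

theorem covAlong_congr (e : ∀ᶠ q in 𝓝 p, V q = W q) (v : TangentSpace (𝓡 k) p) :
    covAlong D f V p v = covAlong D f W p v := by
  have : ∀ᶠ q in 𝓝 p, LightlikeGeometry.coord (f p) V q = LightlikeGeometry.coord (f p) W q :=
    e.mono fun q h ↦ by rw [LightlikeGeometry.coord, LightlikeGeometry.coord, h]
  rw [covAlong_eq, covAlong_eq, mvfderiv_congr this, e.self_of_nhds]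

theorem covAlong_add (hV : SmoothNear k f V p) (hW : SmoothNear k f W p)
    (v : TangentSpace (𝓡 k) p) :
    covAlong D f (fun q ↦ V q + W q) p v = covAlong D f V p v + covAlong D f W p v := by
  have hc : ∀ᶠ q in 𝓝 p, LightlikeGeometry.coord (f p) (fun q ↦ V q + W q) q =
      LightlikeGeometry.coord (f p) V q + LightlikeGeometry.coord (f p) W q := by
    filter_upwards [hV.map.self_of_nhds.continuousAt.eventually (eventually_mem_baseSet m (f p))]
      with q hq using coord_add (f p) hq
  rw [covAlong_eq, covAlong_eq, covAlong_eq, mvfderiv_congr hc,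
    mvfderiv_fun_add hV.coord hW.coord, connection_localExt_add]
  simp only [add_apply, map_add]
  abel

theorem covAlong_smul {h : M → ℝ} (hh : FunSmoothNear k h p) (hV : SmoothNear k f V p)
    (v : TangentSpace (𝓡 k) p) :
    covAlong D f (fun q ↦ h q • V q) p v =
      mvfderiv (𝓡 k) h p v • V p + h p • covAlong D f V p v := by
  have hb := FiberBundle.mem_baseSet_trivializationAt' (F := Model m)
    (E := (TangentSpace (𝓡 m) : Mb → Type _)) (f p)
  have hc : ∀ᶠ q in 𝓝 p, LightlikeGeometry.coord (f p) (fun q ↦ h q • V q) q =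
      h q • LightlikeGeometry.coord (f p) V q := by
    filter_upwards [hV.map.self_of_nhds.continuousAt.eventually (eventually_mem_baseSet m (f p))]
      with q hq using coord_smul (f p) h hq
  have h3 : V p = (trivializationAt (Model m) (TangentSpace (𝓡 m)) (f p)).symmL ℝ (f p)
      (LightlikeGeometry.coord (f p) V p) := by
    rw [Trivialization.symmL_apply _ hb, LightlikeGeometry.coord,
      Trivialization.symm_apply_apply_mk _ hb]
  rw [covAlong_eq, covAlong_eq, mvfderiv_congr hc,
    mvfderiv_fun_smul hh.mdifferentiableAt hV.coord, connection_localExt_smul]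
  simp only [add_apply, map_add, smul_apply, map_smul,
    ContinuousLinearMap.smulRight_apply, smul_add, ← h3]
  abel

theorem mvfderiv_comp_dmap {h : Mb → ℝ} (hh : FunSmoothNear m h (f p))
    (hf : ContMDiffAt (𝓡 k) (𝓡 m) ∞ f p) (v : TangentSpace (𝓡 k) p) :
    mvfderiv (𝓡 k) (fun q ↦ h (f q)) p v = mvfderiv (𝓡 m) h (f p) (dmap m k f p v) :=
  mvfderiv_comp_apply p hh.mdifferentiableAt (hf.mdifferentiableAt (by simp)) v

/-- Together with additivity and the Leibniz rule, this chain rule characterises the pulled-back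
connection. -/
theorem covAlong_comp {σ : VField m Mb} (hσ : SmoothNear (f := id) m σ (f p))
    (hf : ∀ᶠ q in 𝓝 p, ContMDiffAt (𝓡 k) (𝓡 m) ∞ f q) (v : TangentSpace (𝓡 k) p) :
    covAlong D f (fun q ↦ σ (f q)) p v = D σ (f p) (dmap m k f p v) := by
  have hfc := hf.self_of_nhds.continuousAt
  -- The coordinates of `localExt u` are constant near the point, so only the connection term
  -- survives.
  have key : ∀ u : TangentSpace (𝓡 m) (f p),
      covAlong D f (fun q ↦ localExt u (f q)) p v = D (localExt u) (f p) (dmap m k f p v) := by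
    intro u
    have hc : ∀ᶠ q in 𝓝 p, LightlikeGeometry.coord (f p) (fun q ↦ localExt u (f q)) q =
        (trivializationAt (Model m) (TangentSpace (𝓡 m)) (f p) ⟨f p, u⟩).2 := by
      filter_upwards [hfc.eventually (eventually_mem_baseSet m (f p))] with q hq
      rw [LightlikeGeometry.coord, localExt_eq_symm u hq, Trivialization.apply_mk_symm _ hq]
    rw [covAlong_eq, mvfderiv_congr hc, mvfderiv_const, localExt_self]
    simp
  refine SmoothNear.induction (f := id) (P := fun σ ↦ covAlong D f (fun q ↦ σ (f q)) p v =
    D σ (f p) (dmap m k f p v) ∧ SmoothNear (f := id) m σ (f p)) ?_ ?_ ?_ hσ |>.1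
  · rintro σ τ e ⟨h, h'⟩
    refine ⟨?_, h'.congr e⟩
    rw [← connection_congr D h' e, ← h]
    exact covAlong_congr D ((hfc.eventually e).mono fun _ h ↦ h.symm) v
  · rintro σ τ hσ hτ ⟨h1, h1'⟩ ⟨h2, h2'⟩
    refine ⟨?_, hσ.add hτ⟩
    rw [covAlong_add D (hσ.comp hf) (hτ.comp hf), h1, h2]
    exact congrArg (fun L : TangentSpace (𝓡 m) (f p) →L[ℝ] TangentSpace (𝓡 m) (f p) ↦
      L (dmap m k f p v)) (connection_add D hσ hτ).symm
  · intro h hh u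
    refine ⟨?_, SmoothNear.smul hh (smoothNear_localExt u)⟩
    change TangentSpace (𝓡 m) (f p) at u
    have h1 := covAlong_smul D (hh.comp hf)
      (SmoothNear.comp (f := f) (p := p) (σ := localExt (y := f p) u) (smoothNear_localExt u) hf) v
    have h2 := connection_smul D hh (smoothNear_localExt (y := f p) u) (dmap m k f p v)
    rw [key u, mvfderiv_comp_dmap hh hf.self_of_nhds] at h1
    exact h1.trans ((add_comm _ _).trans h2.symm)

end Along

theorem two_le_infty : (2 : WithTop ℕ∞) ≤ ∞ := ENat.LEInfty.out

theorem three_le_infty : (3 : WithTop ℕ∞) ≤ ∞ := ENat.LEInfty.out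

/-! ### Smoothness of derived fields, and the bracket as a commutator of derivations -/

section Smoothness

variable {m k : ℕ} {Mb : Type*} [TopologicalSpace Mb] [ChartedSpace (Model m) Mb]
  [IsManifold (𝓡 m) ∞ Mb] {M : Type*} [TopologicalSpace M] [ChartedSpace (Model k) M]
  [IsManifold (𝓡 k) ∞ M]
  {D : Connection m Mb}
  {f : M → Mb} {V W : (q : M) → TangentSpace (𝓡 m) (f q)} {p : M} {X Y : VField k M}

theorem SmoothNear.dmap (hX : SmoothNear (f := id) k X p)
    (hf : ∀ᶠ q in 𝓝 p, ContMDiffAt (𝓡 k) (𝓡 m) ∞ f q) :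
    SmoothNear k f (fun q ↦ dmap m k f q (X q)) p := by
  filter_upwards [hX, hf] with q hX hf
  exact ContMDiffAt.clm_apply_of_inCoordinates (b₁ := id) (b₂ := f)
    (ϕ := fun q ↦ mfderiv (𝓡 k) (𝓡 m) f q) (hf.mfderiv_const (m := ∞) (by simp)) hX hf

theorem FunSmoothNear.mvfderiv {h : M → ℝ} (hh : FunSmoothNear k h p)
    (hX : SmoothNear (f := id) k X p) :
    FunSmoothNear k (fun q ↦ mvfderiv (𝓡 k) h q (X q)) p := by
  filter_upwards [hX, hh] with q hX hf
  have := ContMDiffAt.clm_apply_of_inCoordinates (b₁ := id) (b₂ := h)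
    (ϕ := fun q ↦ mfderiv (𝓡 k) 𝓘(ℝ, ℝ) h q) (hf.mfderiv_const (m := ∞) (by simp)) hX hf
  exact (contMDiff_snd_tangentBundle_modelSpace ℝ 𝓘(ℝ, ℝ)).contMDiffAt.comp q this

/-- Multiplication by a bump function. The smoothness of a connection is used through its values on
globally smooth fields, so germs must first be globalised. -/
theorem SmoothNear.exists_global [T2Space Mb] {σ : VField m Mb} {y : Mb}
    (hσ : SmoothNear (f := id) m σ y) :
    ∃ σ' : VField m Mb, ContMDiff (𝓡 m) (𝓡 m).tangent ∞
      (fun q ↦ (⟨q, σ' q⟩ : TangentBundle (𝓡 m) Mb)) ∧ ∀ᶠ z in 𝓝 y, σ z = σ' z := by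
  obtain ⟨u, hu, huo, hyu⟩ := eventually_nhds_iff.1 hσ
  obtain ⟨χ, -, hχ⟩ := (SmoothBumpFunction.nhds_basis_tsupport (I := 𝓡 m) y).mem_iff.1
    (huo.mem_nhds hyu)
  refine ⟨(χ : Mb → ℝ) • σ, ContMDiffOn.smul_section_of_tsupport χ.contMDiff.contMDiffOn huo hχ
    fun z hz ↦ (hu z hz).contMDiffWithinAt, ?_⟩
  filter_upwards [χ.eventuallyEq_one] with z hz
  simp [hz]

theorem contMDiffAt_connection [T2Space Mb]
    (hD : CovariantDerivative.ContMDiffCovariantDerivative D ∞) {σ : VField m Mb} {y : Mb}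
    (hσ : SmoothNear (f := id) m σ y) :
    ContMDiffAt (𝓡 m) ((𝓡 m).prod 𝓘(ℝ, Model m →L[ℝ] Model m)) ∞
      (fun z ↦ TotalSpace.mk' (Model m →L[ℝ] Model m)
        (E := fun z : Mb ↦ TangentSpace (𝓡 m) z →L[ℝ] TangentSpace (𝓡 m) z) z (D σ z)) y := by
  obtain ⟨σ', h1, h2⟩ := hσ.exists_global
  have := (hD.contMDiff.contMDiff (σ := σ') h1.contMDiffOn).contMDiffAt (x := y) Filter.univ_mem
  refine this.congr_of_eventuallyEq ?_
  filter_upwards [Filter.Eventually.eventually_nhds h2, hσ.eventually] with z hz hσz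
  rw [connection_congr D hσz hz]

theorem SmoothNear.connection [T2Space Mb]
    (hD : CovariantDerivative.ContMDiffCovariantDerivative D ∞) {σ : VField m Mb}
    (hσ : SmoothNear (f := id) m σ (f p)) (hW : SmoothNear k f W p) :
    SmoothNear k f (fun q ↦ D σ (f q) (W q)) p := by
  filter_upwards [hW, hW.map, hW.map.self_of_nhds.continuousAt.eventually hσ.eventually]
    with q h1 h2 h3
  have := (contMDiffAt_connection hD h3).comp q h2
  exact ContMDiffAt.clm_bundle_apply (b := f) this h1

theorem SmoothNear.covAlong [T2Space Mb]
    (hD : CovariantDerivative.ContMDiffCovariantDerivative D ∞)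
    (hV : SmoothNear k f V p) (hX : SmoothNear (f := id) k X p) :
    SmoothNear k f (fun q ↦ covAlong D f V q (X q)) p := by
  have hf := hV.map
  have hf' := Filter.Eventually.eventually_nhds hf
  refine SmoothNear.induction (P := fun V ↦ SmoothNear k f V p ∧
    SmoothNear k f (fun q ↦ LightlikeGeometry.covAlong D f V q (X q)) p) ?_ ?_ ?_ hV |>.2
  · rintro V W e ⟨h1, h2⟩
    refine ⟨h1.congr e, h2.congr ?_⟩
    filter_upwards [Filter.Eventually.eventually_nhds e] with q hq
    exact covAlong_congr D hq _
  · rintro V W hV hW ⟨-, h1⟩ ⟨-, h2⟩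
    refine ⟨hV.add hW, (h1.add h2).congr ?_⟩
    filter_upwards [hV.eventually, hW.eventually] with q a b
    exact (covAlong_add D a b _).symm
  · intro h hh u
    have hu : SmoothNear k f (fun q ↦ localExt u (f q)) p := (smoothNear_localExt u).comp hf
    refine ⟨hu.smul hh, ?_⟩
    have h1 := (hu.smul (hh.mvfderiv hX)).add
      (((smoothNear_localExt u).connection hD (hX.dmap hf)).smul hh)
    refine h1.congr ?_
    filter_upwards [hh.eventually, hu.eventually, hf',
      hf.self_of_nhds.continuousAt.eventually (smoothNear_localExt u).eventually] with q a b c d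
    rw [covAlong_smul D a b, covAlong_comp D d c]

theorem SmoothNear.mlieBracket (hX : SmoothNear (f := id) k X p)
    (hY : SmoothNear (f := id) k Y p) :
    SmoothNear (f := id) k (VectorField.mlieBracket (𝓡 k) X Y) p := by
  -- The exponents ∞ + 1 and ∞ agree definitionally.
  have : IsManifold (𝓡 k) (((⊤ : ℕ∞) : WithTop ℕ∞) + 1) M := ‹IsManifold (𝓡 k) ∞ M›
  have : IsManifold (𝓡 k) (minSmoothness ℝ 2) M :=
    IsManifold.of_le (n := ∞) (by rw [minSmoothness_of_isRCLikeNormedField]; exact two_le_infty)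
  filter_upwards [hX, hY] with q a b
  exact ContMDiffAt.mlieBracket_vectorField (m := ⊤) (n := ⊤) a b (by simp)

/-- Derived from the Jacobi identity: expand [X,[Y,hZ]] = [[X,Y],hZ] + [Y,[X,hZ]] by the Leibniz
rule and subtract h times the identity for Z. The terms with a single bracket cancel, and what
remains is a multiple of Z. -/
theorem mvfderiv_mlieBracket {h : M → ℝ} (hh : FunSmoothNear k h p)
    (hX : SmoothNear (f := id) k X p) (hY : SmoothNear (f := id) k Y p) :
    mvfderiv (𝓡 k) h p (VectorField.mlieBracket (𝓡 k) X Y p) =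
      mvfderiv (𝓡 k) (fun q ↦ mvfderiv (𝓡 k) h q (Y q)) p (X p) -
        mvfderiv (𝓡 k) (fun q ↦ mvfderiv (𝓡 k) h q (X q)) p (Y p) := by
  -- The coefficient of Z can be read off only if Z(p) ≠ 0; when the tangent space is zero, both
  -- sides vanish.
  by_cases hz : ∀ v : TangentSpace (𝓡 k) p, v = 0
  · rw [hz (VectorField.mlieBracket (𝓡 k) X Y p), hz (X p), hz (Y p)]
    simp
  push Not at hz
  obtain ⟨v, hv⟩ := hz
  have : IsManifold (𝓡 k) (minSmoothness ℝ 3) M :=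
    IsManifold.of_le (n := ∞) (by rw [minSmoothness_of_isRCLikeNormedField]; exact three_le_infty)
  have : IsManifold (𝓡 k) 2 M := IsManifold.of_le (n := ∞) two_le_infty
  set Z : VField k M := localExt v with hZ
  have hZs : SmoothNear (f := id) k Z p := smoothNear_localExt v
  have step : ∀ {Y : VField k M}, SmoothNear (f := id) k Y p → ∀ᶠ q in 𝓝 p,
      VectorField.mlieBracket (𝓡 k) Y (h • Z) q =
        ((fun q ↦ mvfderiv (𝓡 k) h q (Y q)) • Z + h • VectorField.mlieBracket (𝓡 k) Y Z) q := by
    intro Y hY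
    filter_upwards [hh.eventually, hZs.eventually] with q a b
    exact VectorField.mlieBracket_smul_right a.mdifferentiableAt b.mdifferentiableAt
  have step2 : ∀ {X Y : VField k M}, SmoothNear (f := id) k X p → SmoothNear (f := id) k Y p →
      VectorField.mlieBracket (𝓡 k) X (VectorField.mlieBracket (𝓡 k) Y (h • Z)) p =
      (mvfderiv (𝓡 k) (fun q ↦ mvfderiv (𝓡 k) h q (Y q)) p (X p) • v +
        mvfderiv (𝓡 k) h p (Y p) • VectorField.mlieBracket (𝓡 k) X Z p) +
      (mvfderiv (𝓡 k) h p (X p) • VectorField.mlieBracket (𝓡 k) Y Z p +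
        h p • VectorField.mlieBracket (𝓡 k) X (VectorField.mlieBracket (𝓡 k) Y Z) p) := by
    intro X Y hX hY
    have hYh := hh.mvfderiv hY
    have hYZ := hY.mlieBracket hZs
    rw [Filter.EventuallyEq.mlieBracket_vectorField_eq (Filter.Eventually.of_forall fun _ ↦ rfl)
      (step hY), VectorField.mlieBracket_add_right
      (W := (fun q ↦ mvfderiv (𝓡 k) h q (Y q)) • Z)
      (W₁ := h • VectorField.mlieBracket (𝓡 k) Y Z)
      (hZs.smul hYh).mdifferentiableAt (hYZ.smul hh).mdifferentiableAt,
      VectorField.mlieBracket_smul_right hYh.mdifferentiableAt hZs.mdifferentiableAt,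
      VectorField.mlieBracket_smul_right hh.mdifferentiableAt hYZ.mdifferentiableAt]
    simp [hZ]
  have c2 : ∀ {V : VField k M}, SmoothNear (f := id) k V p →
      ContMDiffAt (𝓡 k) (𝓡 k).tangent (minSmoothness ℝ 2)
        (fun q ↦ (⟨q, V q⟩ : TangentBundle (𝓡 k) M)) p := by
    intro V hV
    exact hV.contMDiffAt.of_le (by rw [minSmoothness_of_isRCLikeNormedField]; exact two_le_infty)
  have J := VectorField.leibniz_identity_mlieBracket_apply (c2 hX) (c2 hY) (c2 (hZs.smul hh))
  have J' := VectorField.leibniz_identity_mlieBracket_apply (c2 hX) (c2 hY) (c2 hZs)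
  have e3 := VectorField.mlieBracket_smul_right (V := VectorField.mlieBracket (𝓡 k) X Y)
    hh.mdifferentiableAt hZs.mdifferentiableAt
  have J2 : VectorField.mlieBracket (𝓡 k) X (VectorField.mlieBracket (𝓡 k) Y (h • Z)) p =
      VectorField.mlieBracket (𝓡 k) (VectorField.mlieBracket (𝓡 k) X Y) (h • Z) p +
      VectorField.mlieBracket (𝓡 k) Y (VectorField.mlieBracket (𝓡 k) X (h • Z)) p := J
  rw [step2 hX hY, step2 hY hX, e3, J', hZ, localExt_self] at J2
  have : (mvfderiv (𝓡 k) h p (VectorField.mlieBracket (𝓡 k) X Y p) -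
      (mvfderiv (𝓡 k) (fun q ↦ mvfderiv (𝓡 k) h q (Y q)) p (X p) -
        mvfderiv (𝓡 k) (fun q ↦ mvfderiv (𝓡 k) h q (X q)) p (Y p))) • v = 0 := by
    linear_combination (norm := module) (-1 : ℝ) • J2
  exact sub_eq_zero.1 ((smul_eq_zero.1 this).resolve_right hv)

end Smoothness

/-! ### Parallel metrics and endomorphisms along a map -/

section ParallelTensors

variable {m k : ℕ} {Mb : Type*} [TopologicalSpace Mb] [ChartedSpace (Model m) Mb]
  [IsManifold (𝓡 m) ∞ Mb] {M : Type*} [TopologicalSpace M] [ChartedSpace (Model k) M]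
  {D : Connection m Mb} {G : SemiRiemannianMetric m Mb}
  {f : M → Mb} {V W : (q : M) → TangentSpace (𝓡 m) (f q)} {p : M}

theorem SmoothNear.metric (hV : SmoothNear k f V p) (hW : SmoothNear k f W p) :
    FunSmoothNear k (fun q ↦ G.val (f q) (V q) (W q)) p := by
  filter_upwards [hV, hW, hV.map] with q a b hf
  have : ContMDiffAt (𝓡 k) ((𝓡 m).prod 𝓘(ℝ)) ∞
      (fun q ↦ TotalSpace.mk' ℝ (E := Bundle.Trivial Mb ℝ) (f q) (G.val (f q) (V q) (W q))) q := by
    apply ContMDiffAt.clm_bundle_apply₂ (F₁ := Model m) (F₂ := Model m)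
    · exact ContMDiffAt.comp q G.smooth.contMDiffAt hf
    · exact a
    · exact b
  simp only [contMDiffAt_totalSpace] at this
  exact this.2

theorem SmoothNear.endomorphism {φ : (y : Mb) → TangentSpace (𝓡 m) y →L[ℝ] TangentSpace (𝓡 m) y}
    (hφ : ContMDiff (𝓡 m) ((𝓡 m).prod 𝓘(ℝ, Model m →L[ℝ] Model m)) ∞
      (fun y ↦ TotalSpace.mk' (Model m →L[ℝ] Model m)
        (E := fun y : Mb ↦ TangentSpace (𝓡 m) y →L[ℝ] TangentSpace (𝓡 m) y) y (φ y)))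
    (hV : SmoothNear k f V p) : SmoothNear k f (fun q ↦ φ (f q) (V q)) p := by
  filter_upwards [hV, hV.map] with q a hf
  exact ContMDiffAt.clm_bundle_apply (b := f) (hφ.contMDiffAt.comp q hf) a

/-- Both sides obey the same sum and product rules in `V` and in `W`. Induction on `V`, then on `W`,
reduces the claim to pulled-back fields, where it is the metric property on the target. -/
theorem mvfderiv_metric (hG : IsLeviCivita (fun p x y ↦ G.val p x y) D)
    (hV : SmoothNear k f V p) (hW : SmoothNear k f W p) (v : TangentSpace (𝓡 k) p) :
    mvfderiv (𝓡 k) (fun q ↦ G.val (f q) (V q) (W q)) p v =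
      G.val (f p) (covAlong D f V p v) (W p) + G.val (f p) (V p) (covAlong D f W p v) := by
  have hf := hV.map
  have add_left : ∀ {V V' W : (q : M) → TangentSpace (𝓡 m) (f q)}, SmoothNear k f V p →
      SmoothNear k f V' p → SmoothNear k f W p →
      mvfderiv (𝓡 k) (fun q ↦ G.val (f q) (V q + V' q) (W q)) p v =
        mvfderiv (𝓡 k) (fun q ↦ G.val (f q) (V q) (W q)) p v +
        mvfderiv (𝓡 k) (fun q ↦ G.val (f q) (V' q) (W q)) p v := by
    intro V V' W hV hV' hW
    simp only [map_add, add_apply]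
    rw [mvfderiv_fun_add (hV.metric hW).mdifferentiableAt (hV'.metric hW).mdifferentiableAt]
    rfl
  refine SmoothNear.induction (P := fun V ↦ ∀ W, SmoothNear k f W p →
    mvfderiv (𝓡 k) (fun q ↦ G.val (f q) (V q) (W q)) p v =
      G.val (f p) (covAlong D f V p v) (W p) + G.val (f p) (V p) (covAlong D f W p v))
      ?_ ?_ ?_ hV W hW
  · rintro V V' e h W hW
    rw [← e.self_of_nhds, ← covAlong_congr D e, ← h W hW]
    exact congrArg (fun L : TangentSpace (𝓡 k) p →L[ℝ] ℝ ↦ L v)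
      (mvfderiv_congr (e.mono fun q hq ↦ by rw [hq]))
  · rintro V V' hV hV' h h' W hW
    rw [add_left hV hV' hW, h W hW, h' W hW, covAlong_add D hV hV']
    simp only [map_add, add_apply]
    abel
  intro h hh u W hW
  have hu : SmoothNear k f (fun q ↦ localExt u (f q)) p := (smoothNear_localExt u).comp hf
  refine SmoothNear.induction (P := fun W ↦
    mvfderiv (𝓡 k) (fun q ↦ G.val (f q) (h q • localExt u (f q)) (W q)) p v =
      G.val (f p) (covAlong D f (fun q ↦ h q • localExt u (f q)) p v) (W p) +
      G.val (f p) (h p • localExt u (f p)) (covAlong D f W p v)) ?_ ?_ ?_ hW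
  · rintro V V' e h
    rw [← e.self_of_nhds, ← covAlong_congr D e, ← h]
    exact congrArg (fun L : TangentSpace (𝓡 k) p →L[ℝ] ℝ ↦ L v)
      (mvfderiv_congr (e.mono fun q hq ↦ by rw [hq]))
  · rintro V V' hV hV' h1 h2
    -- Symmetry of the metric turns additivity in the second slot into `add_left`.
    have e : (fun q ↦ G.val (f q) (h q • localExt u (f q)) (V q + V' q)) =
        fun q ↦ G.val (f q) (V q + V' q) (h q • localExt u (f q)) :=
      funext fun q ↦ G.symm _ _ _
    have e' : ∀ V : (q : M) → TangentSpace (𝓡 m) (f q),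
        (fun q ↦ G.val (f q) (V q) (h q • localExt u (f q))) =
        fun q ↦ G.val (f q) (h q • localExt u (f q)) (V q) := fun V ↦
      funext fun q ↦ G.symm _ _ _
    rw [e, add_left hV hV' (hu.smul hh), e' V, e' V', h1, h2, covAlong_add D hV hV']
    simp only [map_add]
    abel
  · intro h' hh' u'
    have hu' : SmoothNear k f (fun q ↦ localExt u' (f q)) p := (smoothNear_localExt u').comp hf
    have e : (fun q ↦ G.val (f q) (h q • localExt u (f q)) (h' q • localExt u' (f q))) =
        fun q ↦ (h q * h' q) * G.val (f q) (localExt u (f q)) (localExt u' (f q)) := by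
      funext q
      simp only [map_smul, smul_apply, smul_eq_mul]
      ring
    have hb : FunSmoothNear m (fun z ↦ G.val z (localExt u z) (localExt u' z)) (f p) :=
      SmoothNear.metric (f := id) (smoothNear_localExt u) (smoothNear_localExt u')
    have hm := hG.metric (f p) (localExt u) (localExt u')
      (smoothNear_localExt u).mdifferentiableAt (smoothNear_localExt u').mdifferentiableAt
      (dmap m k f p v)
    have hc := mvfderiv_comp_dmap hb hf.self_of_nhds v
    have h1 : MDifferentiableAt (𝓡 k) 𝓘(ℝ, ℝ)
        (fun q ↦ G.val (f q) (localExt u (f q)) (localExt u' (f q))) p :=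
      (hu.metric hu').mdifferentiableAt
    rw [e, mvfderiv_fun_mul (hh.mul hh').mdifferentiableAt h1,
      mvfderiv_fun_mul hh.mdifferentiableAt hh'.mdifferentiableAt,
      covAlong_smul D hh hu, covAlong_smul D hh' hu', covAlong_comp D (smoothNear_localExt u) hf,
      covAlong_comp D (smoothNear_localExt u') hf]
    simp only [add_apply, smul_apply, hc, map_add, map_smul, smul_eq_mul]
    rw [hm]
    ring

theorem covAlong_endomorphism
    {φ : (y : Mb) → TangentSpace (𝓡 m) y →L[ℝ] TangentSpace (𝓡 m) y}
    (hφ : ContMDiff (𝓡 m) ((𝓡 m).prod 𝓘(ℝ, Model m →L[ℝ] Model m)) ∞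
      (fun y ↦ TotalSpace.mk' (Model m →L[ℝ] Model m)
        (E := fun y : Mb ↦ TangentSpace (𝓡 m) y →L[ℝ] TangentSpace (𝓡 m) y) y (φ y)))
    (hpar : ∀ (y : Mb) (σ : VField m Mb), SmoothNear (f := id) m σ y → ∀ v,
      D (fun z ↦ φ z (σ z)) y v = φ y (D σ y v))
    (hV : SmoothNear k f V p) (v : TangentSpace (𝓡 k) p) :
    covAlong D f (fun q ↦ φ (f q) (V q)) p v = φ (f p) (covAlong D f V p v) := by
  have hf := hV.map
  refine SmoothNear.induction (P := fun V ↦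
    covAlong D f (fun q ↦ φ (f q) (V q)) p v = φ (f p) (covAlong D f V p v)) ?_ ?_ ?_ hV
  · intro V W e h
    rw [← covAlong_congr D e, ← h]
    exact covAlong_congr D (e.mono fun q hq ↦ by rw [hq]) v
  · intro V W hV hW h h'
    simp only [map_add]
    rw [covAlong_add D (hV.endomorphism hφ) (hW.endomorphism hφ), h, h', covAlong_add D hV hW,
      map_add]
  · intro h hh u
    have hu : SmoothNear k f (fun q ↦ localExt u (f q)) p := (smoothNear_localExt u).comp hf
    have hφu : SmoothNear (f := id) m (fun z ↦ φ z (localExt u z)) (f p) :=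
      SmoothNear.endomorphism (f := id) hφ (smoothNear_localExt u)
    have h1 := covAlong_comp D hφu hf v
    simp only [map_smul]
    rw [covAlong_smul D hh (hu.endomorphism hφ), h1, hpar _ _ (smoothNear_localExt u),
      covAlong_smul D hh hu, covAlong_comp D (smoothNear_localExt u) hf]
    simp only [map_add, map_smul]

end ParallelTensors

/-! ### Vanishing torsion along a map -/

section Torsion

variable {m k : ℕ} {Mb : Type*} [TopologicalSpace Mb] [ChartedSpace (Model m) Mb]
  [IsManifold (𝓡 m) ∞ Mb] {M : Type*} [TopologicalSpace M] [ChartedSpace (Model k) M]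
  [IsManifold (𝓡 k) ∞ M] {D : Connection m Mb}
  {f : M → Mb} {V W : (q : M) → TangentSpace (𝓡 m) (f q)} {p : M} {X Y : VField k M}

/-- The coordinate functions of the chart at `y` suffice: the derivative of that chart at `y` is the
identity of the model space. -/
theorem eq_zero_of_forall_mvfderiv {y : Mb} {v : TangentSpace (𝓡 m) y}
    (h : ∀ φ : Mb → ℝ, FunSmoothNear m φ y → mvfderiv (𝓡 m) φ y v = 0) : v = 0 := by
  have key : ∀ i, (id v : Model m).ofLp i = 0 := by
    intro i
    have hs : FunSmoothNear m (fun z ↦ (extChartAt (𝓡 m) y z) i) y := by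
      filter_upwards [chart_source_mem_nhds (Model m) y] with z hz
      exact ((EuclideanSpace.proj (𝕜 := ℝ) i : Model m →L[ℝ] ℝ).contMDiff (n := ∞)).contMDiffAt.comp
        z (contMDiffAt_extChartAt' hz)
    have h1 := h _ hs
    have h2 : HasMFDerivAt (𝓡 m) 𝓘(ℝ, Model m) (extChartAt (𝓡 m) y) y
        (ContinuousLinearMap.id ℝ (Model m)) := by
      have := (mdifferentiableAt_extChartAt (I := 𝓡 m) (mem_chart_source (Model m) y)).hasMFDerivAt
      rwa [mfderiv_extChartAt_self] at this
    have h3 := ((EuclideanSpace.proj (𝕜 := ℝ) i : Model m →L[ℝ] ℝ).hasMFDerivAt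
      (x := extChartAt (𝓡 m) y y)).comp y h2
    have h4 : mfderiv (𝓡 m) 𝓘(ℝ, ℝ) (fun z ↦ (extChartAt (𝓡 m) y z) i) y = _ := h3.mfderiv
    unfold mvfderiv at h1
    rw [h4] at h1
    exact h1
  exact (PiLp.ext key : (id v : Model m) = 0)

theorem nabla_sub_nabla_eq_mlieBracket (hT : D.torsion = 0) {y : Mb} {σ τ : VField m Mb}
    (hσ : SmoothNear (f := id) m σ y) (hτ : SmoothNear (f := id) m τ y) :
    D τ y (σ y) - D σ y (τ y) = VectorField.mlieBracket (𝓡 m) σ τ y :=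
  (CovariantDerivative.torsion_eq_zero_iff D).1 hT hσ.mdifferentiableAt hτ.mdifferentiableAt

/-- The Hessian of a function with respect to a connection. -/
def hessian (D : Connection m Mb) (h : Mb → ℝ) (y : Mb) (u w : TangentSpace (𝓡 m) y) : ℝ :=
  mvfderiv (𝓡 m) (fun z ↦ mvfderiv (𝓡 m) h z (localExt w z)) y u -
    mvfderiv (𝓡 m) h y (D (localExt w) y u)

/-- The skew part of the Hessian is, up to sign, dh applied to the torsion. -/
theorem hessian_symm (hT : D.torsion = 0) {h : Mb → ℝ} {y : Mb} (hh : FunSmoothNear m h y)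
    (u w : TangentSpace (𝓡 m) y) : hessian D h y u w = hessian D h y w u := by
  have h1 := mvfderiv_mlieBracket hh (smoothNear_localExt u) (smoothNear_localExt w)
  have h2 := nabla_sub_nabla_eq_mlieBracket hT (smoothNear_localExt u) (smoothNear_localExt w)
  rw [← h2, map_sub] at h1
  simp only [localExt_self] at h1
  unfold hessian
  linarith

/-- Isolates a term depending only on the pointwise values of the velocity and of `V`; by symmetry
of the Hessian it cancels in `covAlong_dmap_sub`. -/
theorem mvfderiv_covAlong {h : Mb → ℝ} (hh : FunSmoothNear m h (f p))
    (hV : SmoothNear k f V p) (v : TangentSpace (𝓡 k) p) :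
    mvfderiv (𝓡 k) (fun q ↦ mvfderiv (𝓡 m) h (f q) (V q)) p v =
      mvfderiv (𝓡 m) h (f p) (covAlong D f V p v) + hessian D h (f p) (dmap m k f p v) (V p) := by
  have hf := hV.map
  have hs : ∀ u : TangentSpace (𝓡 m) (f p),
      FunSmoothNear m (fun z ↦ mvfderiv (𝓡 m) h z (localExt u z)) (f p) :=
    fun u ↦ hh.mvfderiv (smoothNear_localExt u)
  refine SmoothNear.induction (P := fun V ↦ FunSmoothNear k
      (fun q ↦ mvfderiv (𝓡 m) h (f q) (V q)) p ∧
    mvfderiv (𝓡 k) (fun q ↦ mvfderiv (𝓡 m) h (f q) (V q)) p v =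
      mvfderiv (𝓡 m) h (f p) (covAlong D f V p v) + hessian D h (f p) (dmap m k f p v) (V p))
      ?_ ?_ ?_ hV |>.2
  · rintro V W e ⟨h1, h2⟩
    have e' : ∀ᶠ q in 𝓝 p, mvfderiv (𝓡 m) h (f q) (V q) = mvfderiv (𝓡 m) h (f q) (W q) :=
      e.mono fun q hq ↦ by rw [hq]
    refine ⟨h1.congr e', ?_⟩
    rw [← mvfderiv_congr e', h2, covAlong_congr D e, e.self_of_nhds]
  · rintro V W hV hW ⟨h1, h1'⟩ ⟨h2, h2'⟩
    simp only [map_add]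
    refine ⟨h1.add h2, ?_⟩
    rw [mvfderiv_fun_add h1.mdifferentiableAt h2.mdifferentiableAt, add_apply, h1', h2',
      covAlong_add D hV hW, map_add]
    have : hessian D h (f p) (dmap m k f p v) (V p + W p) =
        hessian D h (f p) (dmap m k f p v) (V p) + hessian D h (f p) (dmap m k f p v) (W p) := by
      unfold hessian
      rw [connection_localExt_add, localExt_add]
      simp only [Pi.add_apply, map_add, add_apply]
      rw [mvfderiv_fun_add (hs _).mdifferentiableAt (hs _).mdifferentiableAt, add_apply]
      ring
    rw [this]
    ring
  · intro a ha u
    have hu : SmoothNear k f (fun q ↦ localExt u (f q)) p := (smoothNear_localExt u).comp hf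
    have hc := mvfderiv_comp_dmap (hs u) hf.self_of_nhds v
    simp only [map_smul, smul_eq_mul]
    refine ⟨ha.mul ((hs u).comp hf), ?_⟩
    rw [mvfderiv_fun_mul ha.mdifferentiableAt ((hs u).comp hf).mdifferentiableAt, add_apply,
      smul_apply, smul_apply, hc, covAlong_smul D ha hu, covAlong_comp D (smoothNear_localExt u) hf,
      localExt_self]
    have : hessian D h (f p) (dmap m k f p v) (a p • u) =
        a p * hessian D h (f p) (dmap m k f p v) u := by
      unfold hessian
      rw [connection_localExt_smul, localExt_smul]
      simp only [Pi.smul_apply, map_smul, smul_apply, smul_eq_mul]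
      rw [mvfderiv_fun_mul (FunSmoothNear.const (a p)).mdifferentiableAt (hs _).mdifferentiableAt,
        add_apply, mvfderiv_const]
      simp
      ring
    rw [this]
    unfold hessian
    simp only [map_add, map_smul, smul_eq_mul]
    ring

/-- Both sides are tested on functions `h` of the target. Evaluating [X,Y] on h ∘ f by commuting
derivatives yields dh of the left-hand side plus two Hessian terms that cancel. -/
theorem covAlong_dmap_sub (hT : D.torsion = 0)
    (hf : ∀ᶠ q in 𝓝 p, ContMDiffAt (𝓡 k) (𝓡 m) ∞ f q)
    (hX : SmoothNear (f := id) k X p) (hY : SmoothNear (f := id) k Y p) :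
    covAlong D f (fun q ↦ dmap m k f q (Y q)) p (X p) -
      covAlong D f (fun q ↦ dmap m k f q (X q)) p (Y p) =
      dmap m k f p (VectorField.mlieBracket (𝓡 k) X Y p) := by
  rw [← sub_eq_zero]
  refine eq_zero_of_forall_mvfderiv fun h hh ↦ ?_
  have hfc := hf.self_of_nhds.continuousAt
  have key : ∀ Z : VField k M, ∀ᶠ q in 𝓝 p,
      mvfderiv (𝓡 k) (fun q ↦ h (f q)) q (Z q) = mvfderiv (𝓡 m) h (f q) (dmap m k f q (Z q)) := by
    intro Z
    filter_upwards [hf, hfc.eventually hh.eventually] with q a b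
    exact mvfderiv_comp_dmap b a (Z q)
  have h1 := mvfderiv_mlieBracket (hh.comp hf) hX hY
  rw [mvfderiv_congr (key Y), mvfderiv_congr (key X), mvfderiv_comp_dmap hh hf.self_of_nhds,
    mvfderiv_covAlong (D := D) hh (hY.dmap hf), mvfderiv_covAlong (D := D) hh (hX.dmap hf),
    hessian_symm hT hh] at h1
  rw [map_sub, map_sub]
  linarith

end Torsion

/-! ### Curvature along a map -/

section Curvature

variable {m k : ℕ} {Mb : Type*} [TopologicalSpace Mb] [T2Space Mb] [ChartedSpace (Model m) Mb]
  [IsManifold (𝓡 m) ∞ Mb] {M : Type*} [TopologicalSpace M] [ChartedSpace (Model k) M]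
  [IsManifold (𝓡 k) ∞ M] {D : Connection m Mb}
  {f : M → Mb} {V W : (q : M) → TangentSpace (𝓡 m) (f q)} {p : M} {X Y : VField k M}
  {σ : VField m Mb} {y : Mb}

/-- The second covariant derivative of a vector field. -/
def secondCov (D : Connection m Mb) (σ : VField m Mb) (y : Mb) (u w : TangentSpace (𝓡 m) y) :
    TangentSpace (𝓡 m) y :=
  D (fun z ↦ D σ z (localExt w z)) y u - D σ y (D (localExt w) y u)

theorem SmoothNear.nabla (hD : CovariantDerivative.ContMDiffCovariantDerivative D ∞)
    {τ : VField m Mb} (hσ : SmoothNear (f := id) m σ y) (hτ : SmoothNear (f := id) m τ y) :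
    SmoothNear (f := id) m (fun z ↦ D σ z (τ z)) y :=
  SmoothNear.connection (f := id) hD hσ hτ

theorem secondCov_add_left (u u' w : TangentSpace (𝓡 m) y) :
    secondCov D σ y (u + u') w = secondCov D σ y u w + secondCov D σ y u' w := by
  simp only [secondCov, map_add]
  abel

theorem secondCov_smul_left (c : ℝ) (u w : TangentSpace (𝓡 m) y) :
    secondCov D σ y (c • u) w = c • secondCov D σ y u w := by
  simp only [secondCov, map_smul, smul_sub]

theorem secondCov_add_right (hD : CovariantDerivative.ContMDiffCovariantDerivative D ∞)
    (hσ : SmoothNear (f := id) m σ y) (u w w' : TangentSpace (𝓡 m) y) :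
    secondCov D σ y u (w + w') = secondCov D σ y u w + secondCov D σ y u w' := by
  unfold secondCov
  rw [connection_localExt_add, localExt_add]
  simp only [Pi.add_apply, map_add, add_apply]
  rw [connection_add D (hσ.nabla hD (smoothNear_localExt w))
    (hσ.nabla hD (smoothNear_localExt w')), add_apply]
  abel

theorem secondCov_smul_right (hD : CovariantDerivative.ContMDiffCovariantDerivative D ∞)
    (hσ : SmoothNear (f := id) m σ y) (c : ℝ) (u w : TangentSpace (𝓡 m) y) :
    secondCov D σ y u (c • w) = c • secondCov D σ y u w := by
  unfold secondCov
  rw [connection_localExt_smul, localExt_smul]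
  simp only [Pi.smul_apply, map_smul, smul_apply]
  rw [connection_smul D (FunSmoothNear.const c) (hσ.nabla hD (smoothNear_localExt w)),
    mvfderiv_const, smul_sub]
  simp

theorem secondCov_add (hD : CovariantDerivative.ContMDiffCovariantDerivative D ∞)
    {σ τ : VField m Mb}
    (hσ : SmoothNear (f := id) m σ y) (hτ : SmoothNear (f := id) m τ y)
    (u w : TangentSpace (𝓡 m) y) :
    secondCov D (σ + τ) y u w = secondCov D σ y u w + secondCov D τ y u w := by
  unfold secondCov
  have e : ∀ᶠ z in 𝓝 y, D (σ + τ) z (localExt w z) =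
      D σ z (localExt w z) + D τ z (localExt w z) := by
    filter_upwards [hσ.eventually, hτ.eventually] with z a b
    rw [← add_apply, ← connection_add D a b]
    rfl
  have e' : D (σ + τ) y = D σ y + D τ y := connection_add D hσ hτ
  have hs : SmoothNear (f := id) m (σ + τ) y := hσ.add hτ
  rw [connection_congr D (hs.nabla hD (smoothNear_localExt w)) e, e',
    connection_add D (hσ.nabla hD (smoothNear_localExt w)) (hτ.nabla hD (smoothNear_localExt w))]
  simp only [add_apply]
  abel

theorem secondCov_smul (hD : CovariantDerivative.ContMDiffCovariantDerivative D ∞)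
    {σ : VField m Mb} (hσ : SmoothNear (f := id) m σ y) (c : ℝ) (u w : TangentSpace (𝓡 m) y) :
    secondCov D (c • σ) y u w = c • secondCov D σ y u w := by
  unfold secondCov
  have e' : ∀ z, SmoothNear (f := id) m σ z → D (c • σ) z = c • D σ z := fun z hz ↦
    D.isCovariantDerivativeOnUniv.smul_const c hz.mdifferentiableAt
  have e : ∀ᶠ z in 𝓝 y, D (c • σ) z (localExt w z) = c • D σ z (localExt w z) := by
    filter_upwards [hσ.eventually] with z a
    rw [e' z a]
    rfl
  have hs : SmoothNear (f := id) m (c • σ) y := hσ.smul (FunSmoothNear.const c)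
  rw [connection_congr D (hs.nabla hD (smoothNear_localExt w)) e, e' y hσ,
    connection_smul D (FunSmoothNear.const c) (hσ.nabla hD (smoothNear_localExt w)),
    mvfderiv_const, smul_sub]
  simp

/-- The curvature tensor, as the antisymmetrized second covariant derivative of a local
extension. -/
def curv (D : Connection m Mb) (y : Mb) (u w z : TangentSpace (𝓡 m) y) : TangentSpace (𝓡 m) y :=
  secondCov D (localExt z) y u w - secondCov D (localExt z) y w u

theorem curv_add (hD : CovariantDerivative.ContMDiffCovariantDerivative D ∞)
    (u w z z' : TangentSpace (𝓡 m) y) :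
    curv D y u w (z + z') = curv D y u w z + curv D y u w z' := by
  unfold curv
  rw [localExt_add, secondCov_add hD (smoothNear_localExt z) (smoothNear_localExt z'),
    secondCov_add hD (smoothNear_localExt z) (smoothNear_localExt z')]
  abel

theorem curv_smul (hD : CovariantDerivative.ContMDiffCovariantDerivative D ∞) (c : ℝ)
    (u w z : TangentSpace (𝓡 m) y) : curv D y u w (c • z) = c • curv D y u w z := by
  unfold curv
  rw [localExt_smul, secondCov_smul hD (smoothNear_localExt z),
    secondCov_smul hD (smoothNear_localExt z), smul_sub]

theorem curv_swap (u w z : TangentSpace (𝓡 m) y) : curv D y u w z = -curv D y w u z := by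
  unfold curv
  abel

theorem curv_add_left (hD : CovariantDerivative.ContMDiffCovariantDerivative D ∞)
    (u u' w z : TangentSpace (𝓡 m) y) :
    curv D y (u + u') w z = curv D y u w z + curv D y u' w z := by
  unfold curv
  rw [secondCov_add_left, secondCov_add_right hD (smoothNear_localExt z)]
  abel

theorem curv_smul_left (hD : CovariantDerivative.ContMDiffCovariantDerivative D ∞) (c : ℝ)
    (u w z : TangentSpace (𝓡 m) y) : curv D y (c • u) w z = c • curv D y u w z := by
  unfold curv
  rw [secondCov_smul_left, secondCov_smul_right hD (smoothNear_localExt z), smul_sub]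

/-- Vanishing torsion replaces the derivative along [u,w] by the derivatives along D_u w and D_w u,
which are the correction terms in `secondCov`. -/
theorem curvatureAt_eq_curv (hD : CovariantDerivative.ContMDiffCovariantDerivative D ∞)
    (hT : D.torsion = 0) (u w z : TangentSpace (𝓡 m) y) :
    D.curvatureAt y u w z = curv D y u w z := by
  have hz := smoothNear_localExt z
  have hez := extend_eventuallyEq z
  have h1 : ∀ w : TangentSpace (𝓡 m) y, ∀ᶠ q in 𝓝 y,
      D (localExt z) q (localExt w q) = D (FiberBundle.extend (Model m) z) q
        (FiberBundle.extend (Model m) w q) := by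
    intro w
    filter_upwards [Filter.Eventually.eventually_nhds hez, hz.eventually, extend_eventuallyEq w]
      with q a b c
    rw [c, connection_congr D b (a.mono fun _ h ↦ h.symm)]
  unfold Connection.curvatureAt curvature Connection.nabla
  rw [← connection_congr D (hz.nabla hD (smoothNear_localExt w)) (h1 w),
    ← connection_congr D (hz.nabla hD (smoothNear_localExt u)) (h1 u),
    ← connection_congr D hz (hez.mono fun _ h ↦ h.symm),
    Filter.EventuallyEq.mlieBracket_vectorField_eq (extend_eventuallyEq u) (extend_eventuallyEq w),
    ← nabla_sub_nabla_eq_mlieBracket hT (smoothNear_localExt u) (smoothNear_localExt w),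
    map_sub]
  simp only [FiberBundle.extend_apply_self, localExt_self]
  unfold curv secondCov
  abel

/-- The product rule for the contraction of the field of endomorphisms Dσ with `W`, the derivative
of Dσ being `secondCov`. -/
theorem covAlong_connection (hD : CovariantDerivative.ContMDiffCovariantDerivative D ∞)
    (hσ : SmoothNear (f := id) m σ (f p)) (hW : SmoothNear k f W p) (v : TangentSpace (𝓡 k) p) :
    covAlong D f (fun q ↦ D σ (f q) (W q)) p v =
      D σ (f p) (covAlong D f W p v) + secondCov D σ (f p) (dmap m k f p v) (W p) := by
  have hf := hW.map
  refine SmoothNear.induction (P := fun W ↦ covAlong D f (fun q ↦ D σ (f q) (W q)) p v =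
      D σ (f p) (covAlong D f W p v) + secondCov D σ (f p) (dmap m k f p v) (W p)) ?_ ?_ ?_ hW
  · intro V W e h
    rw [← covAlong_congr D (e.mono fun q hq ↦ by rw [hq] :
      ∀ᶠ q in 𝓝 p, D σ (f q) (V q) = D σ (f q) (W q)), h, covAlong_congr D e, e.self_of_nhds]
  · intro V W hV hW h h'
    simp only [map_add]
    rw [covAlong_add D (hσ.connection hD hV) (hσ.connection hD hW), h, h', covAlong_add D hV hW,
      map_add, secondCov_add_right hD hσ]
    abel
  · intro h hh u
    have hu : SmoothNear k f (fun q ↦ localExt u (f q)) p := (smoothNear_localExt u).comp hf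
    have h1 := covAlong_comp D (hσ.nabla hD (smoothNear_localExt u)) hf v
    simp only [map_smul]
    rw [covAlong_smul D hh (hσ.connection hD hu), h1, covAlong_smul D hh hu,
      covAlong_comp D (smoothNear_localExt u) hf, localExt_self,
      secondCov_smul_right hD hσ, map_add, map_smul, map_smul]
    unfold secondCov
    rw [smul_sub]
    abel

/-- The curvature of the pulled-back connection is the pulled-back curvature. Restricted to tangent
fields of the submanifold, it is the common source of the Gauss and Codazzi equations. -/
theorem covAlong_curvature (hD : CovariantDerivative.ContMDiffCovariantDerivative D ∞)
    (hT : D.torsion = 0) (hX : SmoothNear (f := id) k X p) (hY : SmoothNear (f := id) k Y p)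
    (hV : SmoothNear k f V p) :
    covAlong D f (fun q ↦ covAlong D f V q (Y q)) p (X p) -
      covAlong D f (fun q ↦ covAlong D f V q (X q)) p (Y p) -
      covAlong D f V p (VectorField.mlieBracket (𝓡 k) X Y p) =
      curv D (f p) (dmap m k f p (X p)) (dmap m k f p (Y p)) (V p) := by
  have hf := hV.map
  have hf' := Filter.Eventually.eventually_nhds hf
  refine SmoothNear.induction (P := fun V ↦
      covAlong D f (fun q ↦ covAlong D f V q (Y q)) p (X p) -
      covAlong D f (fun q ↦ covAlong D f V q (X q)) p (Y p) -
      covAlong D f V p (VectorField.mlieBracket (𝓡 k) X Y p) =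
      curv D (f p) (dmap m k f p (X p)) (dmap m k f p (Y p)) (V p)) ?_ ?_ ?_ hV
  · intro V W e h
    have e' : ∀ X : VField k M, ∀ᶠ q in 𝓝 p, covAlong D f V q (X q) = covAlong D f W q (X q) := by
      intro X
      filter_upwards [Filter.Eventually.eventually_nhds e] with q hq
      exact covAlong_congr D hq _
    rw [← covAlong_congr D (e' Y), ← covAlong_congr D (e' X), ← covAlong_congr D e, h,
      e.self_of_nhds]
  · intro V W hV hW h h'
    have e' : ∀ X : VField k M, ∀ᶠ q in 𝓝 p, covAlong D f (fun q ↦ V q + W q) q (X q) =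
        covAlong D f V q (X q) + covAlong D f W q (X q) := by
      intro X
      filter_upwards [hV.eventually, hW.eventually] with q a b
      exact covAlong_add D a b _
    rw [covAlong_congr D (e' Y), covAlong_congr D (e' X), covAlong_add D hV hW,
      covAlong_add D (hV.covAlong hD hY) (hW.covAlong hD hY),
      covAlong_add D (hV.covAlong hD hX) (hW.covAlong hD hX), curv_add hD, ← h, ← h']
    abel
  · intro h hh u
    have hu : SmoothNear k f (fun q ↦ localExt u (f q)) p := (smoothNear_localExt u).comp hf
    have hσ := smoothNear_localExt u
    -- After antisymmetrisation in X and Y the two mixed first-order terms cancel, the second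
    -- derivatives of h are absorbed by the bracket, and D of the connection terms by vanishing
    -- torsion.
    have step : ∀ {X Y : VField k M}, SmoothNear (f := id) k X p → SmoothNear (f := id) k Y p →
        covAlong D f (fun q ↦ covAlong D f (fun q ↦ h q • localExt u (f q)) q (Y q)) p (X p) =
        mvfderiv (𝓡 k) (fun q ↦ mvfderiv (𝓡 k) h q (Y q)) p (X p) • u +
        mvfderiv (𝓡 k) h p (Y p) • D (localExt u) (f p) (dmap m k f p (X p)) +
        (mvfderiv (𝓡 k) h p (X p) • D (localExt u) (f p) (dmap m k f p (Y p)) +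
        h p • (D (localExt u) (f p)
          (covAlong D f (fun q ↦ dmap m k f q (Y q)) p (X p)) +
          secondCov D (localExt u) (f p) (dmap m k f p (X p)) (dmap m k f p (Y p)))) := by
      intro X Y hX hY
      have e : ∀ᶠ q in 𝓝 p, covAlong D f (fun q ↦ h q • localExt u (f q)) q (Y q) =
          mvfderiv (𝓡 k) h q (Y q) • localExt u (f q) +
          h q • D (localExt u) (f q) (dmap m k f q (Y q)) := by
        filter_upwards [hh.eventually, hu.eventually, hf',
          hf.self_of_nhds.continuousAt.eventually hσ.eventually] with q a b c d
        rw [covAlong_smul D a b, covAlong_comp D d c]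
      have h1 := hσ.connection hD (hY.dmap hf)
      rw [covAlong_congr D e, covAlong_add D (hu.smul (hh.mvfderiv hY)) (h1.smul hh),
        covAlong_smul D (hh.mvfderiv hY) hu, covAlong_smul D hh h1,
        covAlong_comp D hσ hf, covAlong_connection hD hσ (hY.dmap hf), localExt_self]
    rw [step hX hY, step hY hX, covAlong_smul D hh hu, covAlong_comp D hσ hf,
      ← covAlong_dmap_sub hT hf hX hY, mvfderiv_mlieBracket hh hX hY]
    simp only [localExt_self, curv_smul hD, map_sub]
    unfold curv
    module

end Curvature

/-! ### Symmetries of the ambient curvature and uniqueness of the Levi-Civita connection -/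

section BaseCurvature

variable {m : ℕ} {Mb : Type*} [TopologicalSpace Mb] [T2Space Mb] [ChartedSpace (Model m) Mb]
  [IsManifold (𝓡 m) ∞ Mb] {D D' : Connection m Mb} {G : SemiRiemannianMetric m Mb}
  {σ τ ρ : VField m Mb} {y : Mb}

theorem eventually_contMDiffAt_id (y : Mb) :
    ∀ᶠ q in 𝓝 y, ContMDiffAt (𝓡 m) (𝓡 m) ∞ (id : Mb → Mb) q :=
  Filter.Eventually.of_forall fun _ ↦ contMDiffAt_id

theorem dmap_id (v : TangentSpace (𝓡 m) y) : dmap m m (id : Mb → Mb) y v = v := by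
  unfold dmap
  rw [mfderiv_id]
  rfl

theorem covAlong_id (hσ : SmoothNear (f := id) m σ y) (v : TangentSpace (𝓡 m) y) :
    covAlong D (id : Mb → Mb) σ y v = D σ y v := by
  have := covAlong_comp D (f := id) hσ (eventually_contMDiffAt_id y) v
  rw [dmap_id] at this
  exact this

theorem nabla_curvature (hD : CovariantDerivative.ContMDiffCovariantDerivative D ∞)
    (hT : D.torsion = 0) (hσ : SmoothNear (f := id) m σ y) (hτ : SmoothNear (f := id) m τ y)
    (hρ : SmoothNear (f := id) m ρ y) :
    D (fun z ↦ D ρ z (τ z)) y (σ y) - D (fun z ↦ D ρ z (σ z)) y (τ y) -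
      D ρ y (VectorField.mlieBracket (𝓡 m) σ τ y) = curv D y (σ y) (τ y) (ρ y) := by
  have h := covAlong_curvature (f := id) hD hT hσ hτ hρ
  have e : ∀ τ : VField m Mb, ∀ᶠ z in 𝓝 y,
      covAlong D (id : Mb → Mb) ρ z (τ z) = D ρ z (τ z) := fun τ ↦
    hρ.eventually.mono fun z hz ↦ covAlong_id hz _
  rw [covAlong_congr D (e τ), covAlong_congr D (e σ), covAlong_id hρ, dmap_id, dmap_id,
    covAlong_id (hρ.nabla hD hτ), covAlong_id (hρ.nabla hD hσ)] at h
  exact h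

theorem mvfderiv_metric_id (hG : IsLeviCivita (fun p x y ↦ G.val p x y) D)
    (hσ : SmoothNear (f := id) m σ y) (hτ : SmoothNear (f := id) m τ y)
    (v : TangentSpace (𝓡 m) y) :
    mvfderiv (𝓡 m) (fun z ↦ G.val z (σ z) (τ z)) y v =
      G.val y (D σ y v) (τ y) + G.val y (σ y) (D τ y v) :=
  hG.metric y σ τ hσ.mdifferentiableAt hτ.mdifferentiableAt v

theorem connection_zero (D : Connection m Mb) (y : Mb) :
    D (fun z ↦ (0 : TangentSpace (𝓡 m) z)) y = 0 := by
  have h : SmoothNear (f := id) m (localExt (0 : TangentSpace (𝓡 m) y)) y := smoothNear_localExt _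
  have := connection_localExt_smul D (0 : ℝ) (0 : TangentSpace (𝓡 m) y)
  rw [localExt_smul, zero_smul, zero_smul] at this
  exact this

theorem SmoothNear.zero : SmoothNear (f := id) m (fun z : Mb ↦ (0 : TangentSpace (𝓡 m) z)) y := by
  have h : SmoothNear (f := id) m (localExt (0 : TangentSpace (𝓡 m) y)) y := smoothNear_localExt _
  refine h.congr (Filter.Eventually.of_forall fun z ↦ ?_)
  simp [localExt]

theorem SmoothNear.mlieBracket_id (hσ : SmoothNear (f := id) m σ y)
    (hτ : SmoothNear (f := id) m τ y) :
    SmoothNear (f := id) m (VectorField.mlieBracket (𝓡 m) σ τ) y := hσ.mlieBracket hτ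

/-- Using vanishing torsion twice, the cyclic sum of curvatures becomes the cyclic sum of iterated
brackets, which is zero by the Jacobi identity. -/
theorem bianchi (hD : CovariantDerivative.ContMDiffCovariantDerivative D ∞)
    (hT : D.torsion = 0) (u v w : TangentSpace (𝓡 m) y) :
    curv D y u v w + curv D y v w u + curv D y w u v = 0 := by
  have hs : ∀ u : TangentSpace (𝓡 m) y, SmoothNear (f := id) m (localExt u) y :=
    smoothNear_localExt
  have key : ∀ u v w : TangentSpace (𝓡 m) y,
      D (fun z ↦ D (localExt w) z (localExt v z)) y u -
        D (fun z ↦ D (localExt v) z (localExt w z)) y u =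
      D (VectorField.mlieBracket (𝓡 m) (localExt v) (localExt w)) y u := by
    intro u v w
    have e : ∀ᶠ z in 𝓝 y, D (localExt w) z (localExt v z) =
        D (localExt v) z (localExt w z) +
          VectorField.mlieBracket (𝓡 m) (localExt v) (localExt w) z := by
      filter_upwards [(hs v).eventually, (hs w).eventually] with z a b
      rw [← nabla_sub_nabla_eq_mlieBracket hT a b]
      abel
    rw [connection_congr D ((hs w).nabla hD (hs v)) e,
      connection_add D ((hs v).nabla hD (hs w)) ((hs v).mlieBracket_id (hs w)), add_apply]
    abel
  have br : ∀ u v w : TangentSpace (𝓡 m) y,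
      D (VectorField.mlieBracket (𝓡 m) (localExt v) (localExt w)) y u -
        D (localExt u) y (VectorField.mlieBracket (𝓡 m) (localExt v) (localExt w) y) =
      VectorField.mlieBracket (𝓡 m) (localExt u)
        (VectorField.mlieBracket (𝓡 m) (localExt v) (localExt w)) y := by
    intro u v w
    have := nabla_sub_nabla_eq_mlieBracket hT (hs u) ((hs v).mlieBracket_id (hs w))
    rwa [localExt_self] at this
  have c : ∀ u v w : TangentSpace (𝓡 m) y, curv D y u v w =
      D (fun z ↦ D (localExt w) z (localExt v z)) y u -
      D (fun z ↦ D (localExt w) z (localExt u z)) y v -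
      D (localExt w) y (VectorField.mlieBracket (𝓡 m) (localExt u) (localExt v) y) := by
    intro u v w
    have := nabla_curvature hD hT (hs u) (hs v) (hs w)
    simp only [localExt_self] at this
    exact this.symm
  have : IsManifold (𝓡 m) (minSmoothness ℝ 3) Mb := by
    rw [minSmoothness_of_isRCLikeNormedField]
    exact IsManifold.of_le three_le_infty
  have jac := VectorField.leibniz_identity_mlieBracket_apply (I := 𝓡 m)
    (U := localExt u) (V := localExt v) (W := localExt w) (x := y)
    (by rw [minSmoothness_of_isRCLikeNormedField]
        exact (hs u).contMDiffAt.of_le two_le_infty)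
    (by rw [minSmoothness_of_isRCLikeNormedField]
        exact (hs v).contMDiffAt.of_le two_le_infty)
    (by rw [minSmoothness_of_isRCLikeNormedField]
        exact (hs w).contMDiffAt.of_le two_le_infty)
  -- The Jacobi identity comes in Leibniz form; two swaps make it cyclic.
  rw [VectorField.mlieBracket_swap (V := VectorField.mlieBracket (𝓡 m) (localExt u) (localExt v)),
    VectorField.mlieBracket_swap (V := localExt u) (W := localExt w)] at jac
  have n := br v w u
  have jac' : VectorField.mlieBracket (𝓡 m) (localExt v)
      (-VectorField.mlieBracket (𝓡 m) (localExt w) (localExt u)) y =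
      - VectorField.mlieBracket (𝓡 m) (localExt v)
      (VectorField.mlieBracket (𝓡 m) (localExt w) (localExt u)) y := by
    have := VectorField.mlieBracket_const_smul_right (I := 𝓡 m) (c := (-1 : ℝ))
      (V := localExt v) (x := y)
      (((hs w).mlieBracket_id (hs u)).mdifferentiableAt)
    simpa using this
  rw [Pi.neg_apply, jac', ← br u v w, ← br v w u, ← br w u v, ← key u v w, ← key v w u,
    ← key w u v] at jac
  rw [c u v w, c v w u, c w u v]
  rw [← sub_eq_zero] at jac
  rw [← jac]
  abel

/-- Differentiate the function g(w,z) along [u,v] in two ways; the products of first derivatives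
cancel. -/
theorem metric_curv_antisymm (hG : IsLeviCivita (fun p x y ↦ G.val p x y) D)
    (u v w z : TangentSpace (𝓡 m) y) :
    G.val y (curv D y u v w) z = -G.val y w (curv D y u v z) := by
  have hD := hG.smooth
  have hT := hG.torsion_free
  have hs : ∀ u : TangentSpace (𝓡 m) y, SmoothNear (f := id) m (localExt u) y :=
    smoothNear_localExt
  have hh : FunSmoothNear m (fun q ↦ G.val q (localExt w q) (localExt z q)) y :=
    SmoothNear.metric (f := id) (hs w) (hs z)
  have fn : ∀ {σ τ : VField m Mb}, SmoothNear (f := id) m σ y → SmoothNear (f := id) m τ y →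
      MDifferentiableAt (𝓡 m) 𝓘(ℝ, ℝ) (fun q ↦ G.val q (σ q) (τ q)) y := fun h h' ↦
    (SmoothNear.metric (f := id) h h').mdifferentiableAt
  have h := mvfderiv_mlieBracket hh (hs u) (hs v)
  have step : ∀ u v : TangentSpace (𝓡 m) y,
      mvfderiv (𝓡 m) (fun q ↦ mvfderiv (𝓡 m)
        (fun q ↦ G.val q (localExt w q) (localExt z q)) q (localExt v q)) y u =
      G.val y (D (fun q ↦ D (localExt w) q (localExt v q)) y u) z +
      G.val y (D (localExt w) y v) (D (localExt z) y u) +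
      (G.val y (D (localExt w) y u) (D (localExt z) y v) +
      G.val y w (D (fun q ↦ D (localExt z) q (localExt v q)) y u)) := by
    intro u v
    have e : ∀ᶠ q in 𝓝 y, mvfderiv (𝓡 m)
        (fun q ↦ G.val q (localExt w q) (localExt z q)) q (localExt v q) =
        G.val q (D (localExt w) q (localExt v q)) (localExt z q) +
        G.val q (localExt w q) (D (localExt z) q (localExt v q)) := by
      filter_upwards [(hs w).eventually, (hs z).eventually] with q a b
      exact mvfderiv_metric_id hG a b _
    have h1 := (hs w).nabla hD (hs v)
    have h2 := (hs z).nabla hD (hs v)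
    rw [mvfderiv_congr e, mvfderiv_fun_add (fn h1 (hs z)) (fn (hs w) h2), add_apply,
      mvfderiv_metric_id hG h1 (hs z), mvfderiv_metric_id hG (hs w) h2]
    simp only [localExt_self]
  have c : ∀ w : TangentSpace (𝓡 m) y, curv D y u v w =
      D (fun z ↦ D (localExt w) z (localExt v z)) y u -
      D (fun z ↦ D (localExt w) z (localExt u z)) y v -
      D (localExt w) y (VectorField.mlieBracket (𝓡 m) (localExt u) (localExt v) y) := by
    intro w
    have := nabla_curvature hD hT (hs u) (hs v) (hs w)
    simp only [localExt_self] at this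
    exact this.symm
  rw [mvfderiv_metric_id hG (hs w) (hs z)] at h
  simp only [localExt_self, step] at h
  rw [c w, c z]
  simp only [map_sub, sub_apply]
  linarith

/-- The octahedron argument: combine the four Bianchi sums of u, v, w, z with skewness in the first
and in the last two slots. -/
theorem metric_curv_pair (hG : IsLeviCivita (fun p x y ↦ G.val p x y) D)
    (u v w z : TangentSpace (𝓡 m) y) :
    G.val y (curv D y u v w) z = G.val y (curv D y w z u) v := by
  have b : ∀ u v w z : TangentSpace (𝓡 m) y, G.val y (curv D y u v w) z +
      G.val y (curv D y v w u) z + G.val y (curv D y w u v) z = 0 := by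
    intro u v w z
    rw [← add_apply, ← map_add, ← add_apply, ← map_add, bianchi hG.smooth hG.torsion_free]
    simp
  have a : ∀ u v w z : TangentSpace (𝓡 m) y, G.val y (curv D y u v w) z =
      -G.val y (curv D y u v z) w := by
    intro u v w z
    rw [metric_curv_antisymm hG, G.symm]
  have s : ∀ u v w z : TangentSpace (𝓡 m) y, G.val y (curv D y u v w) z =
      -G.val y (curv D y v u w) z := by
    intro u v w z
    rw [curv_swap, map_neg, neg_apply]
  have b1 := b u v w z
  have b2 := b v w z u
  have b3 := b w z u v
  have b4 := b z u v w
  have := a v w z u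
  have := a w z v u
  have := a z v w u
  have := a w z u v
  have := a z u w v
  have := a u w z v
  have := s u w z v
  have := a z u v w
  have := a u v z w
  have := a v z u w
  have := s v z u w
  have := s z v u w
  have := s w u v z
  linarith

theorem curv_endomorphism (hD : CovariantDerivative.ContMDiffCovariantDerivative D ∞)
    (hT : D.torsion = 0)
    {φ : (y : Mb) → TangentSpace (𝓡 m) y →L[ℝ] TangentSpace (𝓡 m) y}
    (hφ : ContMDiff (𝓡 m) ((𝓡 m).prod 𝓘(ℝ, Model m →L[ℝ] Model m)) ∞
      (fun y ↦ TotalSpace.mk' (Model m →L[ℝ] Model m)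
        (E := fun y : Mb ↦ TangentSpace (𝓡 m) y →L[ℝ] TangentSpace (𝓡 m) y) y (φ y)))
    (hpar : ∀ (y : Mb) (σ : VField m Mb), SmoothNear (f := id) m σ y → ∀ v,
      D (fun z ↦ φ z (σ z)) y v = φ y (D σ y v))
    (u v w : TangentSpace (𝓡 m) y) : curv D y u v (φ y w) = φ y (curv D y u v w) := by
  have hs : ∀ u : TangentSpace (𝓡 m) y, SmoothNear (f := id) m (localExt u) y :=
    smoothNear_localExt
  have hφw : SmoothNear (f := id) m (fun z ↦ φ z (localExt w z)) y :=
    SmoothNear.endomorphism (f := id) hφ (hs w)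
  have h := nabla_curvature hD hT (hs u) (hs v) hφw
  have e : ∀ v : TangentSpace (𝓡 m) y, ∀ᶠ z in 𝓝 y,
      D (fun z ↦ φ z (localExt w z)) z (localExt v z) =
        φ z (D (localExt w) z (localExt v z)) := by
    intro v
    filter_upwards [(hs w).eventually] with z a
    exact hpar z _ a _
  rw [connection_congr D (hφw.nabla hD (hs v)) (e v),
    connection_congr D (hφw.nabla hD (hs u)) (e u),
    hpar y _ (hs w), hpar y _ ((hs w).nabla hD (hs v)), hpar y _ ((hs w).nabla hD (hs u)),
    ← map_sub, ← map_sub, nabla_curvature hD hT (hs u) (hs v) (hs w)] at h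
  simp only [localExt_self] at h
  exact h.symm

/-- Uniqueness of the Levi-Civita connection. -/
theorem connection_eq_of_metric {h : (p : Mb) → TangentSpace (𝓡 m) p → TangentSpace (𝓡 m) p → ℝ}
    (hadd : ∀ p x x' z, h p (x + x') z = h p x z + h p x' z)
    (hsymm : ∀ p x z, h p x z = h p z x)
    (hnd : ∀ p x, (∀ z, h p x z = 0) → x = 0)
    (hT : D.torsion = 0) (hT' : D'.torsion = 0)
    (hm : ∀ (y : Mb) (σ τ : VField m Mb), SmoothNear (f := id) m σ y →
      SmoothNear (f := id) m τ y → ∀ v, mvfderiv (𝓡 m) (fun z ↦ h z (σ z) (τ z)) y v =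
      h y (D σ y v) (τ y) + h y (σ y) (D τ y v))
    (hm' : ∀ (y : Mb) (σ τ : VField m Mb), SmoothNear (f := id) m σ y →
      SmoothNear (f := id) m τ y → ∀ v, mvfderiv (𝓡 m) (fun z ↦ h z (σ z) (τ z)) y v =
      h y (D' σ y v) (τ y) + h y (σ y) (D' τ y v))
    (hσ : SmoothNear (f := id) m σ y) (v : TangentSpace (𝓡 m) y) : D' σ y v = D σ y v := by
  have hsub : ∀ p x x' z, h p (x - x') z = h p x z - h p x' z := by
    intro p x x' z
    have := hadd p (x - x') x' z
    rw [sub_add_cancel] at this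
    linarith
  -- The difference S(v,σ) = D'_v σ - D_v σ is symmetric, since both torsions vanish.
  have t1 : ∀ {σ τ : VField m Mb}, SmoothNear (f := id) m σ y → SmoothNear (f := id) m τ y →
      D' τ y (σ y) - D τ y (σ y) = D' σ y (τ y) - D σ y (τ y) := by
    intro σ τ hσ hτ
    have a := nabla_sub_nabla_eq_mlieBracket hT hσ hτ
    have b := nabla_sub_nabla_eq_mlieBracket hT' hσ hτ
    rw [← a] at b
    linear_combination (norm := module) b
  -- The form h(S(v,σ),τ) is skew in σ and τ, since both connections preserve h.
  have t2 : ∀ {σ τ : VField m Mb}, SmoothNear (f := id) m σ y → SmoothNear (f := id) m τ y →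
      ∀ v, h y (D' σ y v - D σ y v) (τ y) = -h y (D' τ y v - D τ y v) (σ y) := by
    intro σ τ hσ hτ v
    have a := hm y σ τ hσ hτ v
    rw [hm' y σ τ hσ hτ v] at a
    rw [hsub, hsub, hsymm y _ (σ y), hsymm y (D τ y v) (σ y)]
    linarith
  rw [← sub_eq_zero]
  refine hnd y _ fun w ↦ ?_
  have hv := smoothNear_localExt v
  have hw := smoothNear_localExt w
  have e1 := t2 hσ hw v
  have e2 := t1 hv hw
  have e3 := t2 hv hσ w
  have e4 := t1 hw hσ
  have e5 := t2 hw hv (σ y)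
  have e6 := t1 hv hσ
  rw [localExt_self] at e1 e2 e3 e4 e5 e6
  rw [localExt_self] at e2 e5
  -- Alternating the skewness and the symmetry three times returns to the same term with the
  -- opposite sign.
  have key : h y (D' σ y v - D σ y v) w = -h y (D' σ y v - D σ y v) w := by
    conv_lhs => rw [e1, e2, e3, e4, e5, ← e6, neg_neg]
  linarith

theorem curv_congr (h : ∀ (y : Mb) (σ : VField m Mb), SmoothNear (f := id) m σ y → ∀ v,
    D' σ y v = D σ y v) (hD : CovariantDerivative.ContMDiffCovariantDerivative D ∞)
    (hD' : CovariantDerivative.ContMDiffCovariantDerivative D' ∞)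
    (u v w : TangentSpace (𝓡 m) y) : curv D' y u v w = curv D y u v w := by
  have hs : ∀ u : TangentSpace (𝓡 m) y, SmoothNear (f := id) m (localExt u) y :=
    smoothNear_localExt
  have key : ∀ u v : TangentSpace (𝓡 m) y,
      secondCov D' (localExt w) y u v = secondCov D (localExt w) y u v := by
    intro u v
    have e : ∀ᶠ z in 𝓝 y, D' (localExt w) z (localExt v z) = D (localExt w) z (localExt v z) := by
      filter_upwards [(hs w).eventually] with z a
      exact h z _ a _
    unfold secondCov
    rw [connection_congr D' ((hs w).nabla hD' (hs v)) e, h y _ ((hs w).nabla hD (hs v)),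
      h y _ (hs v), h y _ (hs w)]
  unfold curv
  rw [key, key]

end BaseCurvature

/-! ### Algebra of curvature-like tensors -/

section CurvatureAlgebra

/-- A density argument on a line: the product of the two polynomials vanishes identically and the
second is nonzero, because its leading coefficient is. It removes non-degeneracy conditions below.
-/
theorem eq_zero_of_quadratic {a b c b₀ b₁ b₂ : ℂ} (hb : b₂ ≠ 0)
    (h : ∀ t : ℂ, b₀ + b₁ * t + b₂ * t ^ 2 ≠ 0 → a + b * t + c * t ^ 2 = 0) : a = 0 := by
  open Polynomial in
  have key : (C a + C b * X + C c * X ^ 2) * (C b₀ + C b₁ * X + C b₂ * X ^ 2) = 0 := by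
    refine Polynomial.funext fun t ↦ ?_
    simp only [eval_mul, eval_add, eval_C, eval_X, eval_pow, eval_zero, mul_eq_zero]
    by_cases ht : b₀ + b₁ * t + b₂ * t ^ 2 = 0
    · exact Or.inr ht
    · exact Or.inl (h t ht)
  rcases mul_eq_zero.1 key with h1 | h1
  · have := congrArg (Polynomial.eval 0) h1
    simpa using this
  · have := congrArg (fun p ↦ Polynomial.coeff p 2) h1
    simp at this
    exact absurd this hb

/-- The algebraic symmetries of a curvature tensor over a ring. -/
structure IsCurvatureLike (𝕜 : Type*) [CommRing 𝕜] {V : Type*} [AddCommGroup V] [Module 𝕜 V]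
    (T : V → V → V → V → 𝕜) : Prop where
  add : ∀ x x' y z w, T (x + x') y z w = T x y z w + T x' y z w
  smul : ∀ (c : 𝕜) x y z w, T (c • x) y z w = c * T x y z w
  swap : ∀ x y z w, T x y z w = -T y x z w
  pair : ∀ x y z w, T x y z w = T z w x y
  bianchi : ∀ x y z w, T x y z w + T y z x w + T z x y w = 0

namespace IsCurvatureLike

section Field

variable {𝕜 : Type*} [Field 𝕜] [CharZero 𝕜] {V : Type*} [AddCommGroup V] [Module 𝕜 V]
  {T : V → V → V → V → 𝕜}

theorem swap' (hT : IsCurvatureLike 𝕜 T) (x y z w : V) : T x y z w = -T x y w z := by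
  rw [hT.pair, hT.swap, hT.pair w]

theorem add_two (hT : IsCurvatureLike 𝕜 T) (x y y' z w : V) :
    T x (y + y') z w = T x y z w + T x y' z w := by
  rw [hT.swap, hT.add, hT.swap y, hT.swap y']
  ring

theorem smul_two (hT : IsCurvatureLike 𝕜 T) (c : 𝕜) (x y z w : V) :
    T x (c • y) z w = c * T x y z w := by
  rw [hT.swap, hT.smul, hT.swap y]
  ring

theorem add_three (hT : IsCurvatureLike 𝕜 T) (x y z z' w : V) :
    T x y (z + z') w = T x y z w + T x y z' w := by
  rw [hT.pair, hT.add, hT.pair z, hT.pair z']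

theorem smul_three (hT : IsCurvatureLike 𝕜 T) (c : 𝕜) (x y z w : V) :
    T x y (c • z) w = c * T x y z w := by
  rw [hT.pair, hT.smul, hT.pair z]

theorem add_four (hT : IsCurvatureLike 𝕜 T) (x y z w w' : V) :
    T x y z (w + w') = T x y z w + T x y z w' := by
  rw [hT.pair, hT.add_two, hT.pair z, hT.pair z]

theorem smul_four (hT : IsCurvatureLike 𝕜 T) (c : 𝕜) (x y z w : V) :
    T x y z (c • w) = c * T x y z w := by
  rw [hT.pair, hT.smul_two, hT.pair z]

theorem neg_four (hT : IsCurvatureLike 𝕜 T) (x y z w : V) : T x y z (-w) = -T x y z w := by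
  rw [← neg_one_smul 𝕜, hT.smul_four]
  ring

theorem self_eq_zero (hT : IsCurvatureLike 𝕜 T) (x z w : V) : T x x z w = 0 := by
  have := hT.swap x x z w
  have h2 : 2 * T x x z w = 0 := by linear_combination this
  simpa using h2

theorem self_eq_zero' (hT : IsCurvatureLike 𝕜 T) (x y z : V) : T x y z z = 0 := by
  rw [hT.pair, hT.self_eq_zero]

/-- A curvature-like tensor is determined by its sectional values. -/
theorem eq_zero (hT : IsCurvatureLike 𝕜 T) (h : ∀ x y, T x y y x = 0) (x y z w : V) :
    T x y z w = 0 := by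
  -- Polarise in the outer pair, then in the inner pair; the tensor then changes sign under exchange
  -- of slots two and three, so the three terms of the Bianchi sum are equal.
  have h1 : ∀ x y w, T x y y w = 0 := by
    intro x y w
    have e := h (x + w) y
    have e' : T w y y x = T x y y w := by rw [hT.pair, hT.swap, hT.swap', neg_neg]
    rw [hT.add, hT.add_four, hT.add_four, h x y, h w y, e'] at e
    have h2 : 2 * T x y y w = 0 := by linear_combination e
    simpa using h2
  have h2 : ∀ x y z, T x y z w = -T x z y w := by
    intro x y z
    have e := h1 x (y + z) w
    rw [hT.add_two, hT.add_three, hT.add_three, h1, h1] at e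
    linear_combination e
  have e := hT.bianchi x y z w
  have e1 : T y z x w = T x y z w := by rw [h2 y z x, hT.swap y x, neg_neg]
  have e2 : T z x y w = T x y z w := by rw [hT.swap z x, h2 x z y, neg_neg]
  rw [e1, e2] at e
  have h3 : 3 * T x y z w = 0 := by linear_combination e
  simpa using h3

end Field

section Complex

variable {V : Type*} [AddCommGroup V] [Module ℂ V] {T : V → V → V → V → ℂ}

/-- Over ℂ every non-isotropic vector can be normalised, so Gram–Schmidt handles all pairs with `h x
x ≠ 0` that span a non-degenerate plane. Other pairs are reached by perturbing one vector along a
line, which gives a quadratic polynomial in the parameter. -/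
theorem eq_zero_of_orthonormal (hT : IsCurvatureLike ℂ T) (h : V →ₗ[ℂ] V →ₗ[ℂ] ℂ)
    (hs : ∀ x y, h x y = h y x) (hnd : ∀ x, (∀ y, h x y = 0) → x = 0)
    (hdim : ∀ x : V, ∃ v : V, ∀ c : ℂ, v ≠ c • x)
    (ho : ∀ x y, h x x = 1 → h y y = 1 → h x y = 0 → T x y y x = 0) (x y z w : V) :
    T x y z w = 0 := by
  have polar : ∀ x y, h (x + y) (x + y) = h x x + 2 * h x y + h y y := by
    intro x y
    simp only [map_add, LinearMap.add_apply, hs y x]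
    ring
  have unit : ∀ x, h x x ≠ 0 → ∃ (s : ℂ) (x' : V), x = s • x' ∧ h x' x' = 1 := by
    intro x hx
    obtain ⟨s, hs⟩ := IsAlgClosed.exists_pow_nat_eq (h x x) (n := 2) (by norm_num)
    have s0 : s ≠ 0 := by
      rintro rfl
      exact hx (by rw [← hs]; simp)
    refine ⟨s, s⁻¹ • x, by rw [smul_smul, mul_inv_cancel₀ s0, one_smul], ?_⟩
    simp only [map_smul, LinearMap.smul_apply, smul_eq_mul, ← hs]
    field_simp
  obtain ⟨x₀, hx₀⟩ : ∃ x, h x x ≠ 0 := by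
    by_contra! h0
    obtain ⟨v, hv⟩ := hdim 0
    refine hv 0 ?_
    rw [smul_zero]
    refine hnd v fun y ↦ ?_
    have := polar v y
    rw [h0, h0, h0] at this
    have h2 : 2 * h v y = 0 := by linear_combination -this
    simpa using h2
  -- Otherwise, by polarisation, h vanishes on the complement of x, so by non-degeneracy that
  -- complement is zero and the space is the line through x, against `hdim`.
  have comp : ∀ x, h x x ≠ 0 → ∃ y, h x y = 0 ∧ h y y ≠ 0 := by
    intro x hx
    by_contra! h0
    obtain ⟨v, hv⟩ := hdim x
    have dec : ∀ y, h x (y - (h x y / h x x) • x) = 0 := by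
      intro y
      simp only [map_sub, map_smul, smul_eq_mul]
      field_simp
      ring
    refine hv (h x v / h x x) (sub_eq_zero.1 (hnd _ fun y ↦ ?_))
    have hv1 := dec v
    have hy1 := dec y
    set v' := v - (h x v / h x x) • x
    set y' := y - (h x y / h x x) • x with hy'
    have e := polar v' y'
    rw [h0 v' hv1, h0 y' hy1, h0 (v' + y') (by rw [map_add, hv1, hy1, add_zero])] at e
    have e2 : 2 * h v' y' = 0 := by linear_combination -e
    have e3 : h v' y' = 0 := by simpa using e2
    have e4 : y = y' + (h x y / h x x) • x := by rw [hy']; abel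
    rw [e4, map_add, e3, map_smul, hs v' x, hv1]
    simp
  -- Gram–Schmidt: subtracting a multiple of x from y does not change T(x,y,y,x), and scaling
  -- multiplies it by squares.
  have step1 : ∀ x y, h x x ≠ 0 → h x x * h y y - h x y ^ 2 ≠ 0 → T x y y x = 0 := by
    intro x y hx hΔ
    obtain ⟨s, x', rfl, hx'⟩ := unit x hx
    obtain ⟨c, y1, rfl, hc⟩ : ∃ (c : ℂ) (y1 : V), y = y1 + c • x' ∧ h x' y1 = 0 :=
      ⟨h x' y, y - h x' y • x', by abel, by simp [hx']⟩
    have hy1 : h y1 y1 ≠ 0 := by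
      intro h0
      apply hΔ
      simp only [map_add, map_smul, LinearMap.add_apply, LinearMap.smul_apply, smul_eq_mul, hx',
        hc, h0, hs y1 x']
      ring
    obtain ⟨t, y', rfl, hy'⟩ := unit y1 hy1
    have s0 : t ≠ 0 := by
      rintro rfl
      simp at hy1
    have hxy : h x' y' = 0 := by
      simpa [s0] using hc
    have := ho x' y' hx' hy' hxy
    simp only [hT.add_two, hT.add_three, hT.smul, hT.smul_two, hT.smul_three, hT.smul_four,
      hT.self_eq_zero, hT.self_eq_zero', this]
    ring
  -- Moving y along `y₀` orthogonal to x gives a Gram determinant with leading coefficient `h x x *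
  -- h y₀ y₀`, hence one that is not identically zero.
  have step2 : ∀ x y, h x x ≠ 0 → T x y y x = 0 := by
    intro x y hx
    obtain ⟨y₀, hxy, hy⟩ := comp x hx
    refine eq_zero_of_quadratic (b := T x y y₀ x + T x y₀ y x) (c := T x y₀ y₀ x)
      (b₀ := h x x * h y y - h x y ^ 2) (b₁ := 2 * h x x * h y y₀) (b₂ := h x x * h y₀ y₀)
      (mul_ne_zero hx hy) fun t ht ↦ ?_
    have := step1 x (y + t • y₀) hx (by
      convert ht using 1
      simp only [map_add, map_smul, LinearMap.add_apply, LinearMap.smul_apply, smul_eq_mul, hxy,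
        hs y₀ y]
      ring)
    simp only [hT.add_two, hT.add_three, hT.smul_two, hT.smul_three] at this
    linear_combination this
  -- An isotropic x is treated in the same way, by moving it towards the non-isotropic `x₀`.
  refine hT.eq_zero (fun x y ↦ ?_) x y z w
  refine eq_zero_of_quadratic (b := T x y y x₀ + T x₀ y y x) (c := T x₀ y y x₀)
      (b₀ := h x x) (b₁ := 2 * h x x₀) (b₂ := h x₀ x₀) hx₀ fun t ht ↦ ?_
  have := step2 (x + t • x₀) y (by
      convert ht using 1
      simp only [map_add, map_smul, LinearMap.add_apply, LinearMap.smul_apply, smul_eq_mul,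
        hs x₀ x]
      ring)
  simp only [hT.add, hT.add_four, hT.smul, hT.smul_four] at this
  linear_combination this

end Complex

section Real

variable {V : Type*} [AddCommGroup V] [Module ℝ V] {K : V → V → V → V → ℝ} {J : V →ₗ[ℝ] V}

/-- Linearity in the last pair passes to the first pair by pair symmetry. To move J across the
pairs, apply Bianchi with J on the last slot and on each of the first three: the sum of the last
three relations, compared with the first one, gives the claim. -/
theorem apply_J (hK : IsCurvatureLike ℝ K) (hJK : ∀ x y z w, K x y (J z) w = K x y z (J w))
    (x y z w : V) : K (J x) y z w = K x y (J z) w := by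
  have p : ∀ x y z w, K (J x) y z w = K x (J y) z w := by
    intro x y z w
    rw [hK.pair, hJK, hK.pair z]
  have b0 := hK.bianchi x y z (J w)
  have b1 := hK.bianchi (J x) y z w
  have b2 := hK.bianchi (J y) z x w
  have b3 := hK.bianchi (J z) x y w
  rw [← p] at b1 b2 b3
  rw [← hJK, ← hJK, ← hJK] at b0
  linarith

/-- A curvature-like tensor on a real space with complex structure `J` and Norden metric `g`,
complex linear in each slot, with constant values on totally real orthonormal pairs. -/
theorem eq_of_totallyReal (hK : IsCurvatureLike ℝ K) (hJ : ∀ x, J (J x) = -x)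
    (g : V →ₗ[ℝ] V →ₗ[ℝ] ℝ) (hg : ∀ x y, g x y = g y x) (hgJ : ∀ x y, g (J x) y = g x (J y))
    (hnd : ∀ x, (∀ y, g x y = 0) → x = 0)
    (hdim : ∀ x : V, ∃ v : V, ∀ a b : ℝ, v ≠ a • x + b • J x)
    (hJK : ∀ x y z w, K x y (J z) w = K x y z (J w)) (ν ν' : ℝ)
    (ho : ∀ x y, g x x = 1 → g y y = 1 → g x y = 0 → g x (J x) = 0 → g y (J y) = 0 →
      g x (J y) = 0 → K x y y x = ν ∧ K x y y (J x) = ν') (x y z w : V) :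
    K x y z w =
      ν * (g y z * g x w - g y (J z) * g x (J w)) - ν' * (g y z * g x (J w) + g y (J z) * g x w) -
      (ν * (g x z * g y w - g x (J z) * g y (J w)) -
        ν' * (g x z * g y (J w) + g x (J z) * g y w)) := by
  have hJ2 : J * J = -1 := LinearMap.ext hJ
  let ρ : ℂ →ₐ[ℝ] Module.End ℝ V := Complex.lift ⟨J, hJ2⟩
  -- The imaginary unit acts as J.
  let : Module ℂ V := Module.compHom V ρ.toRingHom
  have smul_def : ∀ (c : ℂ) (v : V), c • v = c.re • v + c.im • J v := by
    intro c v
    change (Complex.liftAux J hJ2 c) v = _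
    rw [Complex.liftAux_apply]
    rfl
  -- The sign of the imaginary part is forced by h(Jx,y) = i h(x,y), given g(Jx,Jy) = -g(x,y).
  let h : V →ₗ[ℂ] V →ₗ[ℂ] ℂ := LinearMap.mk₂ ℂ (fun x y ↦ (⟨g x y, -g x (J y)⟩ : ℂ))
    (fun x x' y ↦ by apply Complex.ext <;> simp; ring)
    (fun c x y ↦ by apply Complex.ext <;> simp [smul_def, hgJ, hJ] <;> ring)
    (fun x y y' ↦ by apply Complex.ext <;> simp; ring)
    (fun c x y ↦ by apply Complex.ext <;> simp [smul_def, hJ] <;> ring)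
  have h_apply : ∀ x y, h x y = (⟨g x y, -g x (J y)⟩ : ℂ) := fun x y ↦ rfl
  have h_symm : ∀ x y, h x y = h y x := by
    intro x y
    rw [h_apply, h_apply, hg x y, ← hgJ, hg (J x) y]
  have K1 := hK.apply_J hJK
  have hL : IsCurvatureLike ℂ (fun x y z w ↦ (⟨K x y z w, -K x y z (J w)⟩ : ℂ)) := by
    constructor
    · intro x x' y z w
      apply Complex.ext <;> simp [hK.add]
      ring
    · intro c x y z w
      apply Complex.ext <;> simp [smul_def, hK.add, hK.smul, K1, hJK, hJ, hK.neg_four] <;> ring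
    · intro x y z w
      apply Complex.ext <;> simp [hK.swap x y]
    · intro x y z w
      apply Complex.ext
      · exact hK.pair x y z w
      · change -K x y z (J w) = -K z w x (J y)
        rw [← hJK, hK.pair, K1, hJK]
    · intro x y z w
      apply Complex.ext
      · exact hK.bianchi x y z w
      · have := hK.bianchi x y z (J w)
        simp only [Complex.add_im, Complex.zero_im]
        linarith
  have hπ : IsCurvatureLike ℂ (fun x y z w ↦ h y z * h x w - h x z * h y w) := by
    constructor
    · intro x x' y z w
      simp only [map_add, LinearMap.add_apply]
      ring
    · intro c x y z w
      simp only [map_smul, LinearMap.smul_apply, smul_eq_mul]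
      ring
    · intro x y z w
      ring
    · intro x y z w
      rw [h_symm z x, h_symm z y, h_symm w x, h_symm w y]
      ring
    · intro x y z w
      rw [h_symm z x, h_symm y x, h_symm z y]
      ring
  -- The complex sectional curvature K(x,y,y,x) - i K(x,y,y,Jx) on an h-orthonormal pair. The tensor
  -- is compared with the model of constant curvature c.
  set c : ℂ := ⟨ν, -ν'⟩ with hc
  have hT : IsCurvatureLike ℂ (fun x y z w ↦ (⟨K x y z w, -K x y z (J w)⟩ : ℂ) -
      c * (h y z * h x w - h x z * h y w)) := by
    constructor
    · intro x x' y z w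
      linear_combination hL.add x x' y z w - c * hπ.add x x' y z w
    · intro a x y z w
      linear_combination hL.smul a x y z w - c * hπ.smul a x y z w
    · intro x y z w
      linear_combination hL.swap x y z w - c * hπ.swap x y z w
    · intro x y z w
      linear_combination hL.pair x y z w - c * hπ.pair x y z w
    · intro x y z w
      linear_combination hL.bianchi x y z w - c * hπ.bianchi x y z w
  have key := hT.eq_zero_of_orthonormal h h_symm
    (fun x hx ↦ hnd x fun y ↦ congrArg Complex.re (hx y))
    (fun x ↦ by
      obtain ⟨v, hv⟩ := hdim x
      exact ⟨v, fun c ↦ by rw [smul_def]; exact hv _ _⟩)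
    -- The real parts of h-orthonormality say that the pair is g-orthonormal, the imaginary parts
    -- that it is totally real.
    (fun x y hx hy hxy ↦ by
      have a1 := congrArg Complex.re hx
      have a2 := congrArg Complex.im hx
      have b1 := congrArg Complex.re hy
      have b2 := congrArg Complex.im hy
      have c1 := congrArg Complex.re hxy
      have c2 := congrArg Complex.im hxy
      simp only [h_apply, Complex.one_re, Complex.one_im, Complex.zero_re, Complex.zero_im,
        neg_eq_zero] at a1 a2 b1 b2 c1 c2
      obtain ⟨e1, e2⟩ := ho x y a1 b1 c1 a2 b2 c2
      change (⟨K x y y x, -K x y y (J x)⟩ : ℂ) - c * (h y y * h x x - h x y * h y x) = 0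
      rw [hx, hy, hxy, e1, e2, hc]
      ring) x y z w
  have := congrArg Complex.re key
  simp only [h_apply, hc, Complex.sub_re, Complex.sub_im, Complex.mul_re, Complex.mul_im,
    Complex.zero_re] at this
  linear_combination this

end Real

end IsCurvatureLike

end CurvatureAlgebra

/-! ### The curvature of F₀-manifolds of constant totally real curvatures -/

namespace AlmostContactBMetric

variable {n : ℕ} {Mb : Type*} [TopologicalSpace Mb] [ChartedSpace (Model (2 * n + 1)) Mb]
  [IsManifold (𝓡 (2 * n + 1)) ∞ Mb] (A : AlmostContactBMetric n Mb) {p : Mb}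

/-- Since φ²(xi) = 0, the formula for φ² at φ(xi) shows that φ(xi) = a·xi with a = η(φ(xi));
applying φ again gives a²·xi = 0. -/
theorem phi_xi (p : Mb) : A.phi p (A.xi p) = 0 := by
  have e1 : A.phi p (A.phi p (A.xi p)) = 0 := by simp [A.phi_sq, A.eta_xi]
  have e2 := A.phi_sq p (A.phi p (A.xi p))
  rw [e1, map_zero] at e2
  have e3 : A.phi p (A.xi p) = A.eta p (A.phi p (A.xi p)) • A.xi p := by
    linear_combination (norm := module) e2
  have e4 : A.eta p (A.phi p (A.xi p)) = 0 := by
    have e5 := e1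
    rw [e3, map_smul, e3, smul_smul] at e5
    have e6 := congrArg (A.eta p) e5
    simpa [A.eta_xi] using e6
  rw [e3, e4, zero_smul]

theorem metric_xi (x : TangentSpace (𝓡 (2 * n + 1)) p) : A.metric.val p x (A.xi p) = A.eta p x := by
  have := A.metric_phi p x (A.xi p)
  rw [phi_xi, A.eta_xi, map_zero] at this
  linarith

/-- Compare the two ways of expanding φ³x. -/
theorem eta_phi (x : TangentSpace (𝓡 (2 * n + 1)) p) : A.eta p (A.phi p x) = 0 := by
  have e1 := congrArg (A.phi p) (A.phi_sq p x)
  have e2 := A.phi_sq p (A.phi p x)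
  rw [e1, map_add, map_smul, phi_xi, smul_zero, add_zero, map_neg] at e2
  have e3 : A.eta p (A.phi p x) • A.xi p = 0 := by linear_combination (norm := module) -e2
  have := congrArg (A.eta p) e3
  simpa [A.eta_xi] using this

theorem metric_phi_left (x y : TangentSpace (𝓡 (2 * n + 1)) p) :
    A.metric.val p (A.phi p x) y = A.metric.val p x (A.phi p y) := by
  have h := A.metric_phi p x (A.phi p y)
  rw [eta_phi, A.phi_sq, map_add, map_smul, map_neg, metric_xi, eta_phi] at h
  simp only [smul_zero, mul_zero, add_zero] at h
  linarith

theorem xi_smoothNear (p : Mb) : SmoothNear (f := id) (2 * n + 1) A.xi p :=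
  Filter.Eventually.of_forall fun _ ↦ A.xi_smooth.contMDiffAt Filter.univ_mem

variable {A} {D D' : Connection (2 * n + 1) Mb}

theorem IsF0.parallel (hF : A.IsF0 D) (y : Mb) (σ : VField (2 * n + 1) Mb)
    (hσ : SmoothNear (f := id) (2 * n + 1) σ y) (v : TangentSpace (𝓡 (2 * n + 1)) y) :
    D (fun z ↦ A.phi z (σ z)) y v = A.phi y (D σ y v) := by
  rw [← sub_eq_zero]
  exact A.metric.nondegenerate y _ fun z ↦ hF y σ hσ.mdifferentiableAt v z

/-- As φ(xi) = 0 and φ is parallel, φ kills D(xi), so D(xi) is a multiple of xi; the constant length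
of xi makes the factor zero. -/
theorem IsF0.connection_xi [T2Space Mb] (hF : A.IsF0 D) (hD : IsLeviCivita A.g D) (y : Mb)
    (v : TangentSpace (𝓡 (2 * n + 1)) y) : D A.xi y v = 0 := by
  have hx := A.xi_smoothNear y
  have h1 := hF.parallel y A.xi hx v
  have e : ∀ᶠ z in 𝓝 y, (0 : TangentSpace (𝓡 (2 * n + 1)) z) = A.phi z (A.xi z) :=
    Filter.Eventually.of_forall fun z ↦ (A.phi_xi z).symm
  rw [← connection_congr D SmoothNear.zero e, connection_zero] at h1
  have h2 := A.phi_sq y (D A.xi y v)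
  rw [← h1] at h2
  have h3 := mvfderiv_metric_id (G := A.metric) hD hx hx v
  have e' : ∀ᶠ z in 𝓝 y, A.metric.val z (A.xi z) (A.xi z) = 1 :=
    Filter.Eventually.of_forall fun z ↦ by rw [metric_xi, A.eta_xi]
  rw [mvfderiv_congr e', mvfderiv_const, A.metric.symm y (A.xi y), metric_xi] at h3
  have h4 : A.eta y (D A.xi y v) = 0 := by
    have : (0 : ℝ) = A.eta y (D A.xi y v) + A.eta y (D A.xi y v) := h3
    linarith
  have h5 : -D A.xi y v = 0 := by
    rw [h4, zero_smul, add_zero] at h2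
    rw [← h2]
    exact map_zero (A.phi y)
  exact neg_eq_zero.1 h5

theorem IsF0.mvfderiv_assocMetric [T2Space Mb] (hF : A.IsF0 D) (hD : IsLeviCivita A.g D) (y : Mb)
    (σ τ : VField (2 * n + 1) Mb) (hσ : SmoothNear (f := id) (2 * n + 1) σ y)
    (hτ : SmoothNear (f := id) (2 * n + 1) τ y) (v : TangentSpace (𝓡 (2 * n + 1)) y) :
    mvfderiv (𝓡 (2 * n + 1)) (fun z ↦ A.assocMetric z (σ z) (τ z)) y v =
      A.assocMetric y (D σ y v) (τ y) + A.assocMetric y (σ y) (D τ y v) := by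
  have hx := A.xi_smoothNear y
  have hφτ : SmoothNear (f := id) (2 * n + 1) (fun z ↦ A.phi z (τ z)) y :=
    SmoothNear.endomorphism (f := id) A.phi_smooth hτ
  have fn : ∀ {σ τ : VField (2 * n + 1) Mb}, SmoothNear (f := id) (2 * n + 1) σ y →
      SmoothNear (f := id) (2 * n + 1) τ y →
      MDifferentiableAt (𝓡 (2 * n + 1)) 𝓘(ℝ, ℝ) (fun q ↦ A.metric.val q (σ q) (τ q)) y :=
    fun h h' ↦ (SmoothNear.metric (f := id) h h').mdifferentiableAt
  have e : (fun z ↦ A.assocMetric z (σ z) (τ z)) = fun z ↦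
      A.metric.val z (σ z) (A.phi z (τ z)) +
        A.metric.val z (σ z) (A.xi z) * A.metric.val z (τ z) (A.xi z) := by
    funext z
    rw [metric_xi, metric_xi]
    rfl
  have mul : MDifferentiableAt (𝓡 (2 * n + 1)) 𝓘(ℝ, ℝ) (fun z ↦
      A.metric.val z (σ z) (A.xi z) * A.metric.val z (τ z) (A.xi z)) y :=
    (FunSmoothNear.mul (SmoothNear.metric (f := id) hσ hx)
      (SmoothNear.metric (f := id) hτ hx)).mdifferentiableAt
  rw [e, mvfderiv_fun_add (fn hσ hφτ) mul, mvfderiv_fun_mul (fn hσ hx) (fn hτ hx)]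
  simp only [add_apply, smul_apply]
  rw [mvfderiv_metric_id (G := A.metric) hD hσ hφτ, mvfderiv_metric_id (G := A.metric) hD hσ hx,
    mvfderiv_metric_id (G := A.metric) hD hτ hx, hF.connection_xi hD, hF.parallel y τ hτ]
  simp only [map_zero, metric_xi, assocMetric, g, smul_eq_mul]
  ring

/-- The associated metric is built from the parallel data g, φ and xi, so the connection of g also
preserves it, and uniqueness applies. Hence ν and ν' are both read off one curvature tensor. -/
theorem connection_assocMetric [T2Space Mb] (hF : A.IsF0 D) (hD : IsLeviCivita A.g D)
    (hD' : IsLeviCivita A.assocMetric D') (y : Mb) (σ : VField (2 * n + 1) Mb)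
    (hσ : SmoothNear (f := id) (2 * n + 1) σ y) (v : TangentSpace (𝓡 (2 * n + 1)) y) :
    D' σ y v = D σ y v := by
  refine connection_eq_of_metric (h := A.assocMetric) ?_ ?_ ?_ hD.torsion_free hD'.torsion_free
    (hF.mvfderiv_assocMetric hD) (fun y σ τ hσ hτ v ↦
      hD'.metric y σ τ hσ.mdifferentiableAt hτ.mdifferentiableAt v) hσ v
  · intro p x x' z
    simp only [assocMetric, g, map_add, add_apply]
    ring
  · intro p x z
    simp only [assocMetric, g]
    rw [← metric_phi_left, A.metric.symm]
    ring
  · intro p x hx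
    have h1 := hx (A.xi p)
    simp only [assocMetric, g, phi_xi, map_zero, A.eta_xi, zero_add, mul_one] at h1
    have h2 : A.phi p x = 0 := A.metric.nondegenerate p _ fun z ↦ by
      have := hx z
      simp only [assocMetric, g, h1] at this
      rw [metric_phi_left]
      linarith
    have h3 := A.phi_sq p x
    rw [h2, h1, map_zero, zero_smul, add_zero] at h3
    exact neg_eq_zero.1 h3.symm

theorem isTotallyRealSection_of_orthonormal {x y : TangentSpace (𝓡 (2 * n + 1)) p}
    (hx : A.eta p x = 0) (hy : A.eta p y = 0) (hxx : A.g p x x = 1) (hyy : A.g p y y = 1)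
    (hxy : A.g p x y = 0) (hx' : A.g p x (A.phi p x) = 0) (hy' : A.g p y (A.phi p y) = 0)
    (hxy' : A.g p x (A.phi p y) = 0) : A.IsTotallyRealSection p x y where
  nondegenerate := by simp [hxx, hyy, hxy]
  orthogonal_xi v hv := by
    obtain ⟨a, b, rfl⟩ := Submodule.mem_span_pair.1 hv
    rw [g, metric_xi, map_add, map_smul, map_smul, hx, hy, smul_zero, smul_zero, add_zero]
  totally_real v hv w hw := by
    obtain ⟨a, b, rfl⟩ := Submodule.mem_span_pair.1 hv
    obtain ⟨c, d, rfl⟩ := Submodule.mem_span_pair.1 hw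
    have hyx : A.metric.val p y (A.phi p x) = 0 := by
      rw [← metric_phi_left, A.metric.symm]
      exact hxy'
    simp only [g] at *
    simp only [metric_phi_left, map_add, map_smul, add_apply, smul_apply, hx', hy', hxy', hyx,
      smul_zero, add_zero]

section Curvature

variable [T2Space Mb] {ν ν' : Mb → ℝ}

theorem isCurvatureLike_curv (hD : IsLeviCivita A.g D) (p : Mb) :
    IsCurvatureLike ℝ (fun x y z w : TangentSpace (𝓡 (2 * n + 1)) p ↦
      A.metric.val p (curv D p x y z) w) where
  add x x' y z w := by rw [curv_add_left hD.smooth, map_add, add_apply]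
  smul c x y z w := by rw [curv_smul_left hD.smooth, map_smul, smul_apply, smul_eq_mul]
  swap x y z w := by rw [curv_swap, map_neg, neg_apply]
  pair x y z w := metric_curv_pair hD x y z w
  bianchi x y z w := by
    rw [← add_apply, ← map_add, ← add_apply, ← map_add, bianchi hD.smooth hD.torsion_free]
    simp

theorem curv_xi (hF : A.IsF0 D) (hD : IsLeviCivita A.g D)
    (x y : TangentSpace (𝓡 (2 * n + 1)) p) : curv D p x y (A.xi p) = 0 := by
  have h := nabla_curvature hD.smooth hD.torsion_free (smoothNear_localExt x)
    (smoothNear_localExt y) (A.xi_smoothNear p)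
  have e : ∀ v : TangentSpace (𝓡 (2 * n + 1)) p, ∀ᶠ z in 𝓝 p,
      (0 : TangentSpace (𝓡 (2 * n + 1)) z) = D A.xi z (localExt v z) := fun v ↦
    Filter.Eventually.of_forall fun z ↦ (hF.connection_xi hD z _).symm
  rw [← connection_congr D SmoothNear.zero (e y), ← connection_congr D SmoothNear.zero (e x),
    connection_zero, hF.connection_xi hD] at h
  simpa using h.symm

/-- Otherwise x, φx and xi would span a space of dimension 2n + 1 ≥ 5. This is where `2 ≤ n` enters:
the kernel of η must have complex dimension at least two. -/
theorem exists_notMem_span (hn : 2 ≤ n) (p : Mb) (x : LinearMap.ker (A.eta p).toLinearMap) :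
    ∃ v : LinearMap.ker (A.eta p).toLinearMap, ∀ a b : ℝ,
      (v : TangentSpace (𝓡 (2 * n + 1)) p) ≠
        a • (x : TangentSpace (𝓡 (2 * n + 1)) p) + b • A.phi p x := by
  by_contra! h
  have hfd : FiniteDimensional ℝ (TangentSpace (𝓡 (2 * n + 1)) p) :=
    inferInstanceAs (FiniteDimensional ℝ (Model (2 * n + 1)))
  have hr : Module.finrank ℝ (TangentSpace (𝓡 (2 * n + 1)) p) = 2 * n + 1 :=
    finrank_euclideanSpace_fin (𝕜 := ℝ) (n := 2 * n + 1)
  have htop : Submodule.span ℝ (Set.range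
      ![(x : TangentSpace (𝓡 (2 * n + 1)) p), A.phi p x, A.xi p]) = ⊤ := by
    rw [eq_top_iff]
    intro v _
    have hv : A.eta p (v - A.eta p v • A.xi p) = 0 := by
      rw [map_sub, map_smul, A.eta_xi]
      simp
    obtain ⟨a, b, hab⟩ := h ⟨_, hv⟩
    have e : v = a • (x : TangentSpace (𝓡 (2 * n + 1)) p) + b • A.phi p x + A.eta p v • A.xi p := by
      rw [← hab]
      simp
    rw [e]
    refine Submodule.add_mem _ (Submodule.add_mem _ ?_ ?_) ?_ <;>
      refine Submodule.smul_mem _ _ (Submodule.subset_span ?_)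
    exacts [⟨0, rfl⟩, ⟨1, rfl⟩, ⟨2, rfl⟩]
  have h1 := finrank_range_le_card (R := ℝ)
    ![(x : TangentSpace (𝓡 (2 * n + 1)) p), A.phi p x, A.xi p]
  rw [Set.finrank, htop, finrank_top, hr, Fintype.card_fin] at h1
  omega

/-- The purely algebraic `eq_of_totallyReal`, applied to the kernel of η with J = φ. -/
theorem metric_curv_eq (hn : 2 ≤ n) (hF : A.IsF0 D) (hD : IsLeviCivita A.g D)
    (hD' : IsLeviCivita A.assocMetric D') (hν : A.HasConstTotallyRealCurvatures D D' ν ν')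
    {x y z w : TangentSpace (𝓡 (2 * n + 1)) p} (hx : A.eta p x = 0) (hy : A.eta p y = 0)
    (hz : A.eta p z = 0) (hw : A.eta p w = 0) :
    A.metric.val p (curv D p x y z) w =
      ν p * (A.g p y z * A.g p x w - A.g p y (A.phi p z) * A.g p x (A.phi p w)) -
        ν' p * (A.g p y z * A.g p x (A.phi p w) + A.g p y (A.phi p z) * A.g p x w) -
      (ν p * (A.g p x z * A.g p y w - A.g p x (A.phi p z) * A.g p y (A.phi p w)) -
        ν' p * (A.g p x z * A.g p y (A.phi p w) + A.g p x (A.phi p z) * A.g p y w)) := by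
  have hK := isCurvatureLike_curv hD p
  let W := LinearMap.ker (A.eta p).toLinearMap
  let J : W →ₗ[ℝ] W := (A.phi p).toLinearMap.restrict fun v _ ↦ A.eta_phi v
  let gW : W →ₗ[ℝ] W →ₗ[ℝ] ℝ := LinearMap.mk₂ ℝ
    (fun x y ↦ A.metric.val p (x : TangentSpace (𝓡 (2 * n + 1)) p) y)
    (by intros; simp) (by intros; simp) (by intros; simp) (by intros; simp)
  have hKW : IsCurvatureLike ℝ (fun x y z w : W ↦
      A.metric.val p (curv D p (x : TangentSpace (𝓡 (2 * n + 1)) p) y z) w) :=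
    ⟨fun x x' y z w ↦ hK.add x x' y z w, fun c x y z w ↦ hK.smul c x y z w,
      fun x y z w ↦ hK.swap x y z w, fun x y z w ↦ hK.pair x y z w,
      fun x y z w ↦ hK.bianchi x y z w⟩
  refine hKW.eq_of_totallyReal (J := J) ?_ gW (fun x y ↦ A.metric.symm _ _ _)
    (fun x y ↦ A.metric_phi_left _ _) ?_ ?_ ?_ (ν p) (ν' p) ?_ ⟨x, hx⟩ ⟨y, hy⟩ ⟨z, hz⟩ ⟨w, hw⟩
  · rintro ⟨x, hx⟩
    have hx : A.eta p x = 0 := hx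
    refine Subtype.ext ?_
    change A.phi p (A.phi p x) = -x
    rw [A.phi_sq, hx, zero_smul, add_zero]
  · rintro ⟨x, hx⟩ h
    have hx : A.eta p x = 0 := hx
    refine Subtype.ext (A.metric.nondegenerate p x fun v ↦ ?_)
    have hv : A.eta p (v - A.eta p v • A.xi p) = 0 := by
      rw [map_sub, map_smul, A.eta_xi]
      simp
    have h1 : A.metric.val p x (v - A.eta p v • A.xi p) = 0 := h ⟨_, hv⟩
    rw [map_sub, map_smul, metric_xi, hx, smul_zero, sub_zero] at h1
    exact h1
  · intro x
    obtain ⟨v, hv⟩ := exists_notMem_span (A := A) hn p x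
    exact ⟨v, fun a b h ↦ hv a b (congrArg Subtype.val h)⟩
  · rintro ⟨x, hx⟩ ⟨y, hy⟩ ⟨z, hz⟩ ⟨w, hw⟩
    change A.metric.val p (curv D p x y (A.phi p z)) w = A.metric.val p (curv D p x y z) (A.phi p w)
    rw [curv_endomorphism hD.smooth hD.torsion_free A.phi_smooth hF.parallel, metric_phi_left]
  · rintro ⟨x, hx⟩ ⟨y, hy⟩ hxx hyy hxy hx' hy' hxy'
    have hx : A.eta p x = 0 := hx
    have hy : A.eta p y = 0 := hy
    have hxx : A.g p x x = 1 := hxx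
    have hyy : A.g p y y = 1 := hyy
    have hxy : A.g p x y = 0 := hxy
    obtain ⟨h1, h2⟩ := hν p x y
      (isTotallyRealSection_of_orthonormal hx hy hxx hyy hxy hx' hy' hxy')
    rw [curvatureAt_eq_curv hD.smooth hD.torsion_free] at h1
    -- Since η(x) = 0, pairing with x in the associated metric is pairing with φx in g, so this
    -- value is K(x,y,y,Jx).
    rw [curvatureAt_eq_curv hD'.smooth hD'.torsion_free,
      curv_congr (connection_assocMetric hF hD hD') hD.smooth hD'.smooth] at h2
    simp only [hxx, hyy, hxy, assocMetric, hx, mul_zero, add_zero] at h1 h2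
    norm_num at h1 h2
    exact ⟨h1, h2⟩

/-- The curvature tensor of an `F₀`-manifold of pointwise constant totally real sectional
curvatures. -/
theorem curv_eq (hn : 2 ≤ n) (hF : A.IsF0 D) (hD : IsLeviCivita A.g D)
    (hD' : IsLeviCivita A.assocMetric D') (hν : A.HasConstTotallyRealCurvatures D D' ν ν')
    (x y z : TangentSpace (𝓡 (2 * n + 1)) p) :
    curv D p x y z =
      -(ν p * A.g p (A.phi p y) (A.phi p z) + ν' p * A.g p y (A.phi p z)) • (x - A.eta p x • A.xi p)
      + (ν p * A.g p (A.phi p x) (A.phi p z) + ν' p * A.g p x (A.phi p z)) •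
        (y - A.eta p y • A.xi p)
      - (ν p * A.g p y (A.phi p z) - ν' p * A.g p (A.phi p y) (A.phi p z)) • A.phi p x
      + (ν p * A.g p x (A.phi p z) - ν' p * A.g p (A.phi p x) (A.phi p z)) • A.phi p y := by
  have hK := isCurvatureLike_curv hD p
  -- The curvature vanishes as soon as xi occupies any slot, so all arguments may be projected to
  -- the kernel of η.
  have h0 : ∀ x y w, A.metric.val p (curv D p x y (A.xi p)) w = 0 := fun x y w ↦ by
    rw [curv_xi hF hD, map_zero, zero_apply]
  have k1 : ∀ y z w, A.metric.val p (curv D p (A.xi p) y z) w = 0 := fun y z w ↦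
    (hK.pair _ _ _ _).trans (h0 z w y)
  have k2 : ∀ x z w, A.metric.val p (curv D p x (A.xi p) z) w = 0 := fun x z w ↦ by
    rw [curv_swap, map_neg, neg_apply, k1, neg_zero]
  have k4 : ∀ x y z, A.metric.val p (curv D p x y z) (A.xi p) = 0 := fun x y z ↦
    (hK.pair _ _ _ _).trans (k2 z x y)
  have heta : ∀ x : TangentSpace (𝓡 (2 * n + 1)) p, A.eta p (x - A.eta p x • A.xi p) = 0 := by
    intro x
    rw [map_sub, map_smul, A.eta_xi]
    simp
  rw [← sub_eq_zero]
  refine A.metric.nondegenerate p _ fun w ↦ ?_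
  rw [map_sub, sub_apply, sub_eq_zero]
  have key := metric_curv_eq hn hF hD hD' hν (heta x) (heta y) (heta z) (heta w)
  have e1 : A.metric.val p (curv D p x y z) w = A.metric.val p
      (curv D p (x - A.eta p x • A.xi p) (y - A.eta p y • A.xi p) (z - A.eta p z • A.xi p))
      (w - A.eta p w • A.xi p) := by
    have a1 : ∀ (c : ℝ) x y z w, A.metric.val p (curv D p (x - c • A.xi p) y z) w =
        A.metric.val p (curv D p x y z) w := by
      intro c x y z w
      have := hK.add (x - c • A.xi p) (c • A.xi p) y z w
      have h2 := hK.smul c (A.xi p) y z w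
      simp only [sub_add_cancel, k1, mul_zero] at this h2
      rw [this, h2, add_zero]
    have a2 : ∀ (c : ℝ) x y z w, A.metric.val p (curv D p x (y - c • A.xi p) z) w =
        A.metric.val p (curv D p x y z) w := by
      intro c x y z w
      rw [curv_swap, curv_swap x y, map_neg, map_neg, neg_apply, neg_apply, a1]
    have a3 : ∀ (c : ℝ) x y z w, A.metric.val p (curv D p x y (z - c • A.xi p)) w =
        A.metric.val p (curv D p x y z) w := by
      intro c x y z w
      exact ((hK.pair _ _ _ _).trans (a1 c z w x y)).trans (hK.pair _ _ _ _)
    rw [a1, a2, a3, map_sub, map_smul, k4, smul_zero, sub_zero]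
  -- The metric of the projected vectors is -g(φx,φy), which accounts for the shape of the final
  -- formula.
  have g1 : ∀ x y : TangentSpace (𝓡 (2 * n + 1)) p,
      A.g p (x - A.eta p x • A.xi p) (y - A.eta p y • A.xi p) =
      -A.g p (A.phi p x) (A.phi p y) := by
    intro x y
    have := A.metric_phi p x y
    have h2 : A.metric.val p (A.xi p) y = A.eta p y := by rw [A.metric.symm, metric_xi]
    simp only [g, map_sub, map_smul, sub_apply, smul_apply, metric_xi, A.eta_xi, h2, this,
      smul_eq_mul]
    ring
  have g2 : ∀ x y : TangentSpace (𝓡 (2 * n + 1)) p,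
      A.g p (x - A.eta p x • A.xi p) (A.phi p (y - A.eta p y • A.xi p)) =
      A.g p x (A.phi p y) := by
    intro x y
    have h2 : A.metric.val p (A.xi p) (A.phi p y) = 0 := by
      rw [A.metric.symm, metric_xi, eta_phi]
    simp only [g, map_sub, map_smul, phi_xi, sub_apply, smul_apply, h2, smul_zero, sub_zero]
  have g3 : ∀ x : TangentSpace (𝓡 (2 * n + 1)) p, A.metric.val p (x - A.eta p x • A.xi p) w =
      -A.g p (A.phi p x) (A.phi p w) := by
    intro x
    rw [← g1]
    rw [g, (A.metric.val p (x - A.eta p x • A.xi p)).map_sub,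
      (A.metric.val p (x - A.eta p x • A.xi p)).map_smul, metric_xi, heta, smul_zero, sub_zero]
  rw [e1, key]
  simp only [g1, g2]
  rw [map_add, map_sub, map_add, map_smul, map_smul, map_smul, map_smul]
  simp only [add_apply, sub_apply, smul_apply, g3, metric_phi_left, smul_eq_mul]
  simp only [g, metric_phi_left]
  ring

end Curvature

end AlmostContactBMetric

namespace HalfLightlike

/-! ### Linear algebra at a point of an ascreen RSTHL submanifold -/

section Pointwise

variable {n k : ℕ} {Mb : Type*} [TopologicalSpace Mb] [ChartedSpace (Model (2 * n + 1)) Mb]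
  [IsManifold (𝓡 (2 * n + 1)) ∞ Mb] {M : Type*} [TopologicalSpace M] [ChartedSpace (Model k) M]
  [IsManifold (𝓡 k) ∞ M] {A : AlmostContactBMetric n Mb} {H : HalfLightlike A.metric k M}
  {p : M} {r : TangentSpace (𝓡 k) p} {v : TangentSpace (𝓡 (2 * n + 1)) (H.f p)}

theorem metric_d_rad (hr : r ∈ H.rad p) (x : TangentSpace (𝓡 k) p) :
    A.metric.val (H.f p) (H.d p x) (H.d p r) = 0 := by
  rw [A.metric.symm]
  exact hr x

theorem metric_d_screenTr {t : TangentSpace (𝓡 (2 * n + 1)) (H.f p)} (ht : t ∈ H.screenTr p)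
    (x : TangentSpace (𝓡 k) p) : A.metric.val (H.f p) (H.d p x) t = 0 := by
  have : t ∈ normalSpace (k := k) A.metric H.f p := by
    rw [← H.screenTr_sup p]
    exact Submodule.mem_sup_left ht
  rw [A.metric.symm]
  exact this x

theorem phi_mem_screenTr (h1 : H.IsRSTHL) (hr : r ∈ H.rad p) :
    A.phi (H.f p) (H.d p r) ∈ H.screenTr p := by
  rw [← h1 p]
  exact ⟨_, ⟨r, hr, rfl⟩, rfl⟩

theorem exists_eq_smul_of_mem_rad (hr : r ∈ H.rad p) (hv : H.IsLightlikeTransversal p r v)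
    {x : TangentSpace (𝓡 k) p} (hx : x ∈ H.rad p) : x = A.metric.val (H.f p) v (H.d p x) • r := by
  have h1 : Module.finrank ℝ (H.rad p) = 1 := H.finrank_radical p
  have hr0 : (⟨r, hr⟩ : H.rad p) ≠ 0 := by
    intro h
    have h0 : r = 0 := congrArg Subtype.val h
    have := hv.pairing
    rw [h0, map_zero, map_zero] at this
    exact zero_ne_one this
  obtain ⟨c, hc⟩ := exists_smul_eq_of_finrank_eq_one h1 hr0 ⟨x, hx⟩
  have hc' : c • r = x := congrArg Subtype.val hc
  rw [← hc', map_smul, map_smul, hv.pairing, smul_eq_mul, mul_one]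

theorem exists_screenTr_eq_smul (h1 : H.IsRSTHL) (hr : r ∈ H.rad p)
    (hv : H.IsLightlikeTransversal p r v) {t : TangentSpace (𝓡 (2 * n + 1)) (H.f p)}
    (ht : t ∈ H.screenTr p) : ∃ c : ℝ, t = c • A.phi (H.f p) (H.d p r) := by
  rw [← h1 p] at ht
  obtain ⟨_, ⟨x, hx, rfl⟩, rfl⟩ := ht
  refine ⟨A.metric.val (H.f p) v (H.d p x), ?_⟩
  change A.phi (H.f p) (H.d p x) = _
  conv_lhs => rw [exists_eq_smul_of_mem_rad hr hv hx]
  rw [map_smul, map_smul]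

theorem screen_add_rad (x : TangentSpace (𝓡 k) p) :
    ∃ s ∈ H.screen p, ∃ y ∈ H.rad p, x = s + y := by
  have : x ∈ H.screen p ⊔ H.rad p := by
    have := (H.screen_isCompl p).sup_eq_top
    unfold rad
    rw [this]
    trivial
  obtain ⟨s, hs, y, hy, h⟩ := Submodule.mem_sup.1 this
  exact ⟨s, hs, y, hy, h.symm⟩

/-- Such a `w` is orthogonal to the normal space, hence tangent; being orthogonal to the screen and
the radical as well, it is radical. -/
theorem exists_eq_smul_of_orthogonal (hr : r ∈ H.rad p) (hv : H.IsLightlikeTransversal p r v)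
    {w : TangentSpace (𝓡 (2 * n + 1)) (H.f p)}
    (hs : ∀ s ∈ H.screen p, A.metric.val (H.f p) w (H.d p s) = 0)
    (ht : ∀ t ∈ H.screenTr p, A.metric.val (H.f p) w t = 0)
    (hw : A.metric.val (H.f p) w (H.d p r) = 0) : ∃ c : ℝ, w = c • H.d p r := by
  have hrad : ∀ y ∈ H.rad p, A.metric.val (H.f p) w (H.d p y) = 0 := by
    intro y hy
    rw [exists_eq_smul_of_mem_rad hr hv hy, map_smul, map_smul, hw, smul_zero]
  obtain ⟨u, rfl⟩ := H.exists_d_eq p w fun z hz ↦ by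
    rw [← H.screenTr_sup p] at hz
    obtain ⟨t, ht', _, ⟨y, hy, rfl⟩, rfl⟩ := Submodule.mem_sup.1 hz
    rw [map_add, ht t ht', zero_add]
    exact hrad y hy
  have hu : u ∈ H.rad p := fun y ↦ by
    obtain ⟨s, hs', y, hy, rfl⟩ := screen_add_rad (H := H) y
    change A.metric.val (H.f p) (H.d p u) (H.d p (s + y)) = 0
    rw [map_add, map_add, hs s hs', hrad y hy, add_zero]
  refine ⟨A.metric.val (H.f p) v (H.d p u), ?_⟩
  conv_lhs => rw [exists_eq_smul_of_mem_rad hr hv hu]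
  rw [map_smul]

theorem ltr_eq_add (hr : r ∈ H.rad p) (hv : H.IsLightlikeTransversal p r v)
    {l : TangentSpace (𝓡 (2 * n + 1)) (H.f p)} (hl : l ∈ H.ltr p) :
    ∃ c : ℝ, l = A.metric.val (H.f p) l (H.d p r) • v + c • H.d p r := by
  have horth : (∀ s ∈ H.screen p, A.metric.val (H.f p) l (H.d p s) = 0) ∧
      ∀ t ∈ H.screenTr p, A.metric.val (H.f p) l t = 0 := by
    induction hl using Submodule.span_induction with
    | mem l hl =>
      obtain ⟨r, _, h⟩ := hl
      exact ⟨h.screen, h.screenTr⟩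
    | zero => simp
    | add a b _ _ ha hb =>
      exact ⟨fun s hs ↦ by rw [map_add, add_apply, ha.1 s hs, hb.1 s hs, add_zero],
        fun s hs ↦ by rw [map_add, add_apply, ha.2 s hs, hb.2 s hs, add_zero]⟩
    | smul c a _ ha =>
      exact ⟨fun s hs ↦ by rw [map_smul, smul_apply, ha.1 s hs, smul_zero],
        fun s hs ↦ by rw [map_smul, smul_apply, ha.2 s hs, smul_zero]⟩
  obtain ⟨c, hc⟩ := exists_eq_smul_of_orthogonal hr hv
    (w := l - A.metric.val (H.f p) l (H.d p r) • v)
    (fun s hs ↦ by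
      rw [map_sub, map_smul, sub_apply, smul_apply, horth.1 s hs, hv.screen s hs]; simp)
    (fun t ht ↦ by
      rw [map_sub, map_smul, sub_apply, smul_apply, horth.2 t ht, hv.screenTr t ht]; simp)
    (by rw [map_sub, map_smul, sub_apply, smul_apply, hv.pairing]; simp)
  exact ⟨c, by rw [← hc]; abel⟩

theorem transversal_mem_tr (hr : r ∈ H.rad p) (hv : H.IsLightlikeTransversal p r v) :
    v ∈ H.tr p :=
  Submodule.mem_sup_right (Submodule.subset_span ⟨r, hr, hv⟩)

theorem tan_d (x : TangentSpace (𝓡 k) p) : H.tan p (H.d p x) = x :=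
  LinearMap.linearProjOfIsCompl_apply_left (q := H.tr p) (i := H.d p)
    (H.immersion p) (H.isCompl_tr p) x

theorem tan_tr {w : TangentSpace (𝓡 (2 * n + 1)) (H.f p)} (hw : w ∈ H.tr p) : H.tan p w = 0 :=
  LinearMap.linearProjOfIsCompl_apply_right' (q := H.tr p) (i := H.d p) (hi := H.immersion p)
    (h := H.isCompl_tr p) w hw

theorem sub_d_tan_mem_tr (w : TangentSpace (𝓡 (2 * n + 1)) (H.f p)) :
    w - H.d p (H.tan p w) ∈ H.tr p := by
  have hw : w ∈ LinearMap.range (H.d p) ⊔ H.tr p := by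
    rw [(H.isCompl_tr p).sup_eq_top]
    trivial
  obtain ⟨_, ⟨x, rfl⟩, t, ht, rfl⟩ := Submodule.mem_sup.1 hw
  rw [map_add, tan_d, tan_tr ht, add_zero, add_sub_cancel_left]
  exact ht

/-- The tangential projection kills the whole transversal bundle, so the multiple of `r` left open
by `ltr_eq_add` is zero. -/
theorem ltr_eq_smul (hr : r ∈ H.rad p) (hv : H.IsLightlikeTransversal p r v)
    {l : TangentSpace (𝓡 (2 * n + 1)) (H.f p)} (hl : l ∈ H.ltr p) :
    l = A.metric.val (H.f p) l (H.d p r) • v := by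
  obtain ⟨c, hc⟩ := ltr_eq_add hr hv hl
  have h1 := congrArg (H.tan p) hc
  rw [map_add, map_smul, map_smul, tan_tr (Submodule.mem_sup_right hl),
    tan_tr (transversal_mem_tr hr hv), tan_d, smul_zero, zero_add] at h1
  have h2 : c • H.d p r = 0 := by rw [← map_smul, ← h1, map_zero]
  rw [h2, add_zero] at hc
  exact hc

variable (h1 : H.IsRSTHL) (h2 : H.IsAscreen) (hr : r ∈ H.rad p)
  (hv : H.IsLightlikeTransversal p r v)

include h2 hr hv in
-- Write the Reeb vector as a·r + b·v. Pairing with r gives b = η(r), and its unit length gives 2ab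
-- = 1; in particular η(r) ≠ 0.
theorem reeb_eq : A.eta (H.f p) (H.d p r) ≠ 0 ∧ A.xi (H.f p) =
    (2 * A.eta (H.f p) (H.d p r))⁻¹ • H.d p r + A.eta (H.f p) (H.d p r) • v := by
  obtain ⟨_, ⟨x, hx, rfl⟩, l, hl, h⟩ := Submodule.mem_sup.1 (h2 p)
  rw [exists_eq_smul_of_mem_rad hr hv hx, ltr_eq_smul hr hv hl, map_smul] at h
  set a := A.metric.val (H.f p) v (H.d p x)
  set b := A.metric.val (H.f p) l (H.d p r)
  have hrr : A.metric.val (H.f p) (H.d p r) (H.d p r) = 0 := metric_d_rad hr r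
  have hrv : A.metric.val (H.f p) (H.d p r) v = 1 := by rw [A.metric.symm]; exact hv.pairing
  have hb : A.eta (H.f p) (H.d p r) = b := by
    rw [← A.metric_xi, ← h, map_add, map_smul, map_smul, hrr, hrv]
    simp
  have hab : 2 * a * b = 1 := by
    have e := A.eta_xi (H.f p)
    rw [← A.metric_xi, ← h] at e
    simp only [map_add, map_smul, add_apply, smul_apply, hrr, hrv, hv.null, hv.pairing,
      smul_eq_mul] at e
    linarith
  have hb0 : b ≠ 0 := by
    rintro h0
    rw [h0] at hab
    simp at hab
  rw [hb]
  refine ⟨hb0, ?_⟩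
  rw [← h]
  congr 2
  field_simp
  linarith

include h1 hr in
theorem metric_phi_rad_d (x : TangentSpace (𝓡 k) p) :
    A.metric.val (H.f p) (H.d p x) (A.phi (H.f p) (H.d p r)) = 0 :=
  metric_d_screenTr (phi_mem_screenTr h1 hr) x

include hr in
theorem metric_phi_rad_self : A.metric.val (H.f p) (A.phi (H.f p) (H.d p r))
    (A.phi (H.f p) (H.d p r)) = A.eta (H.f p) (H.d p r) ^ 2 := by
  rw [A.metric_phi, metric_d_rad hr]
  ring

include h1 h2 hr hv in
/-- The decomposition of a vector along an ascreen RSTHL submanifold. -/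
theorem eq_d_tan_add (w : TangentSpace (𝓡 (2 * n + 1)) (H.f p)) :
    w = H.d p (H.tan p w) + A.metric.val (H.f p) w (H.d p r) • v +
      (A.metric.val (H.f p) w (A.phi (H.f p) (H.d p r)) / A.eta (H.f p) (H.d p r) ^ 2) •
        A.phi (H.f p) (H.d p r) := by
  have hμ := (reeb_eq h2 hr hv).1
  obtain ⟨t, ht, l, hl, h⟩ := Submodule.mem_sup.1 (sub_d_tan_mem_tr (H := H) w)
  obtain ⟨c, rfl⟩ := exists_screenTr_eq_smul h1 hr hv ht
  rw [ltr_eq_smul hr hv hl] at h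
  set e := A.metric.val (H.f p) l (H.d p r)
  have hw : w = H.d p (H.tan p w) + e • v + c • A.phi (H.f p) (H.d p r) := by
    rw [add_assoc, add_comm (e • v), h]
    abel
  -- Coefficients are read off by pairing: r meets only v, and φr meets only itself, with square
  -- η(r)².
  have he : A.metric.val (H.f p) w (H.d p r) = e := by
    have : A.metric.val (H.f p) (A.phi (H.f p) (H.d p r)) (H.d p r) = 0 := by
      rw [A.metric.symm, metric_phi_rad_d h1 hr]
    rw [hw]
    simp only [map_add, map_smul, add_apply, smul_apply, this, hv.pairing, metric_d_rad hr,
      smul_eq_mul]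
    ring
  have hc : A.metric.val (H.f p) w (A.phi (H.f p) (H.d p r)) =
      c * A.eta (H.f p) (H.d p r) ^ 2 := by
    rw [hw]
    simp only [map_add, map_smul, add_apply, smul_apply, metric_phi_rad_d h1 hr,
      hv.screenTr _ (phi_mem_screenTr h1 hr), metric_phi_rad_self hr, smul_eq_mul]
    ring
  rw [he, hc, mul_div_cancel_right₀ _ (pow_ne_zero 2 hμ)]
  exact hw

include h2 hr hv in
-- Solving `reeb_eq` for v. It yields the smoothness of N, and φv as a multiple of φr because φ
-- kills the Reeb vector.
theorem transversal_eq : v = (A.eta (H.f p) (H.d p r))⁻¹ • A.xi (H.f p) -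
    (2 * A.eta (H.f p) (H.d p r) ^ 2)⁻¹ • H.d p r := by
  obtain ⟨hμ, h⟩ := reeb_eq h2 hr hv
  set μ := A.eta (H.f p) (H.d p r)
  rw [h, smul_add, smul_smul, smul_smul, inv_mul_cancel₀ hμ, one_smul]
  have : μ⁻¹ * (2 * μ)⁻¹ = (2 * μ ^ 2)⁻¹ := by
    field_simp
  rw [this]
  abel

include h2 hr hv in
theorem phi_transversal : A.phi (H.f p) v =
    -(2 * A.eta (H.f p) (H.d p r) ^ 2)⁻¹ • A.phi (H.f p) (H.d p r) := by
  conv_lhs => rw [transversal_eq h2 hr hv]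
  rw [map_sub, map_smul, map_smul, A.phi_xi, smul_zero, zero_sub, neg_smul]

include h2 hr hv in
theorem eta_d (x : TangentSpace (𝓡 k) p) : A.eta (H.f p) (H.d p x) =
    A.eta (H.f p) (H.d p r) * A.metric.val (H.f p) (H.d p x) v := by
  rw [← A.metric_xi (H.d p x)]
  conv_lhs => rw [(reeb_eq h2 hr hv).2]
  rw [map_add, map_smul, map_smul, metric_d_rad hr, smul_zero, zero_add, smul_eq_mul]

include hr hv in
theorem P_eq (X : VField k M) : X p = H.P X p + A.metric.val (H.f p) (H.d p (X p)) v • r := by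
  have hs : H.P X p ∈ H.screen p := Subtype.prop _
  have hy : X p - H.P X p ∈ H.rad p := by
    refine (Submodule.projectionOnto_apply_eq_zero_iff (H.screen_isCompl p)).1 ?_
    rw [map_sub, sub_eq_zero]
    exact (Submodule.projectionOnto_apply_left (H.screen_isCompl p) _).symm
  have e := exists_eq_smul_of_mem_rad hr hv hy
  rw [map_sub, map_sub, hv.screen _ hs, sub_zero, A.metric.symm] at e
  rw [← e]
  abel

end Pointwise

end HalfLightlike

theorem SmoothOn.smoothNear {k : ℕ} {M : Type*} [TopologicalSpace M] [ChartedSpace (Model k) M]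
    [IsManifold (𝓡 k) ∞ M] {X : VField k M} {U : Set M} (hX : SmoothOn X U) (hU : IsOpen U) {p : M}
    (hp : p ∈ U) : SmoothNear (f := id) k X p := by
  filter_upwards [hU.mem_nhds hp] with q hq
  exact hX.contMDiffAt (hU.mem_nhds hq)

namespace HalfLightlike

/-! ### Weingarten, Gauss and Codazzi equations -/

section Local

variable {n k : ℕ} {Mb : Type*} [TopologicalSpace Mb] [T2Space Mb]
  [ChartedSpace (Model (2 * n + 1)) Mb]
  [IsManifold (𝓡 (2 * n + 1)) ∞ Mb] {M : Type*} [TopologicalSpace M] [ChartedSpace (Model k) M]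
  [IsManifold (𝓡 k) ∞ M] {A : AlmostContactBMetric n Mb} {H : HalfLightlike A.metric k M}
  {D : Connection (2 * n + 1) Mb} {U : Set M} {ξ : VField k M}
  {N : (p : M) → TangentSpace (𝓡 (2 * n + 1)) (H.f p)} {p : M} {X Y Z : VField k M}

theorem eventually_contMDiffAt (p : M) :
    ∀ᶠ q in 𝓝 p, ContMDiffAt (𝓡 k) (𝓡 (2 * n + 1)) ∞ H.f q :=
  Filter.Eventually.of_forall fun _ ↦ H.smooth.contMDiffAt

theorem smoothNear_d (hX : SmoothNear (f := id) k X p) :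
    SmoothNear k H.f (fun q ↦ H.d q (X q)) p :=
  hX.dmap (eventually_contMDiffAt p)

theorem smoothNear_phi {V : (p : M) → TangentSpace (𝓡 (2 * n + 1)) (H.f p)}
    (hV : SmoothNear k H.f V p) : SmoothNear k H.f (fun q ↦ A.phi (H.f q) (V q)) p :=
  hV.endomorphism A.phi_smooth

theorem B_eq (hξN : H.IsNullPair U ξ N) (hp : p ∈ U) (X Y : VField k M) :
    H.B D ξ X Y p = A.metric.val (H.f p) (H.ambient D X Y p) (H.d p (ξ p)) := by
  unfold B secondForm
  rw [map_sub, sub_apply, metric_d_rad (hξN.mem_rad p hp), sub_zero]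

theorem tau_eq (hξN : H.IsNullPair U ξ N) (hp : p ∈ U) (X : VField k M) :
    H.tau D ξ N X p = A.metric.val (H.f p) (covAlong D H.f N p (X p)) (H.d p (ξ p)) := by
  unfold tau
  rw [map_add, add_apply, metric_d_rad (hξN.mem_rad p hp), add_zero]

theorem d_tan_phi_d (h1 : H.IsRSTHL) (h2 : H.IsAscreen) {s : TangentSpace (𝓡 k) p}
    (hs : s ∈ H.screen p) :
    H.d p (H.tan p (A.phi (H.f p) (H.d p s))) = A.phi (H.f p) (H.d p s) := by
  have hP : H.P (localExt s) p = s := by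
    unfold P
    rw [localExt_self]
    exact congrArg Subtype.val (Submodule.projectionOnto_apply_left (H.screen_isCompl p) ⟨s, hs⟩)
  have := H.d_phiP h1 h2 (localExt s) p
  unfold phiP at this
  rwa [hP] at this

variable (hD : IsLeviCivita A.g D) (hF : A.IsF0 D) (h1 : H.IsRSTHL) (h2 : H.IsAscreen)
  (hξN : H.IsNullPair U ξ N) (hp : p ∈ U)

include hξN hp in
theorem smoothNear_rad : SmoothNear k H.f (fun q ↦ H.d q (ξ q)) p :=
  smoothNear_d (hξN.smooth.smoothNear hξN.isOpen hp)

include hξN hp in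
theorem funSmoothNear_eta_rad : FunSmoothNear k (fun q ↦ A.eta (H.f q) (H.d q (ξ q))) p := by
  have hx : SmoothNear k H.f (fun q ↦ A.xi (H.f q)) p :=
    (A.xi_smoothNear (H.f p)).comp (eventually_contMDiffAt p)
  refine ((smoothNear_rad hξN hp).metric (G := A.metric) hx).congr
    (Filter.Eventually.of_forall fun q ↦ ?_)
  rw [A.metric_xi]

include h2 hξN hp in
-- Smoothness of N is not part of `IsNullPair`; it follows from the formula for N in terms of the
-- Reeb field, ξ and μ.
theorem smoothNear_transversal : SmoothNear k H.f N p := by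
  have hx : SmoothNear k H.f (fun q ↦ A.xi (H.f q)) p :=
    (A.xi_smoothNear (H.f p)).comp (eventually_contMDiffAt p)
  have hμ := funSmoothNear_eta_rad hξN hp
  have hμ0 := (reeb_eq h2 (hξN.mem_rad p hp) (hξN.transversal p hp)).1
  have ha := hμ.inv hμ0
  have hb : FunSmoothNear k (fun q ↦ -(2 * A.eta (H.f q) (H.d q (ξ q)) ^ 2)⁻¹) p := by
    refine (((FunSmoothNear.const (2 : ℝ)).mul (hμ.mul hμ)).inv ?_).neg.congr
      (Filter.Eventually.of_forall fun q ↦ by rw [pow_two])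
    simp [hμ0]
  refine ((hx.smul ha).add ((smoothNear_rad hξN hp).smul hb)).congr ?_
  filter_upwards [hξN.isOpen.mem_nhds hp] with q hq
  conv_rhs => rw [transversal_eq h2 (hξN.mem_rad q hq) (hξN.transversal q hq)]
  rw [neg_smul, sub_eq_add_neg]

include hD hF h1 hξN hp in
-- Differentiate g(ξ,φξ) = 0: as φ is parallel and self-adjoint, the two resulting terms are equal.
theorem metric_cov_rad_phi (v : TangentSpace (𝓡 k) p) :
    A.metric.val (H.f p) (covAlong D H.f (fun q ↦ H.d q (ξ q)) p v)
      (A.phi (H.f p) (H.d p (ξ p))) = 0 := by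
  have hξ := smoothNear_rad hξN hp
  have hE := smoothNear_phi hξ
  have h := mvfderiv_metric (G := A.metric) hD hξ hE v
  have e : ∀ᶠ q in 𝓝 p, A.metric.val (H.f q) (H.d q (ξ q)) (A.phi (H.f q) (H.d q (ξ q))) = 0 := by
    filter_upwards [hξN.isOpen.mem_nhds hp] with q hq
    exact metric_phi_rad_d h1 (hξN.mem_rad q hq) _
  rw [mvfderiv_congr e, mvfderiv_const, covAlong_endomorphism A.phi_smooth hF.parallel hξ,
    A.metric.symm _ (H.d p (ξ p)), A.metric_phi_left] at h
  have h' : (0 : ℝ) = _ := h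
  linarith

include hD hF h1 hξN hp in
theorem metric_cov_phi_rad (v : TangentSpace (𝓡 k) p) :
    A.metric.val (H.f p) (covAlong D H.f (fun q ↦ A.phi (H.f q) (H.d q (ξ q))) p v)
      (H.d p (ξ p)) = 0 := by
  rw [covAlong_endomorphism A.phi_smooth hF.parallel (smoothNear_rad hξN hp), A.metric_phi_left]
  exact metric_cov_rad_phi hD hF h1 hξN hp v

include hD hF h1 h2 hξN hp in
-- Differentiate g(N,φξ) = 0 and move φ onto N, where φN is a multiple of φξ; `metric_cov_rad_phi`
-- then applies. So D_v N has no screen transversal component.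
theorem metric_cov_transversal_phi (v : TangentSpace (𝓡 k) p) :
    A.metric.val (H.f p) (covAlong D H.f N p v) (A.phi (H.f p) (H.d p (ξ p))) = 0 := by
  have hξ := smoothNear_rad hξN hp
  have h := mvfderiv_metric (G := A.metric) hD (smoothNear_transversal h2 hξN hp)
    (smoothNear_phi hξ) v
  have e : ∀ᶠ q in 𝓝 p, A.metric.val (H.f q) (N q) (A.phi (H.f q) (H.d q (ξ q))) = 0 := by
    filter_upwards [hξN.isOpen.mem_nhds hp] with q hq
    exact (hξN.transversal q hq).screenTr _ (phi_mem_screenTr h1 (hξN.mem_rad q hq))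
  rw [mvfderiv_congr e, mvfderiv_const, covAlong_endomorphism A.phi_smooth hF.parallel hξ,
    ← A.metric_phi_left (N p), phi_transversal h2 (hξN.mem_rad p hp) (hξN.transversal p hp),
    map_smul, smul_apply, A.metric.symm _ (A.phi _ (H.d p (ξ p))),
    metric_cov_rad_phi hD hF h1 hξN hp, smul_zero, add_zero] at h
  exact h.symm

include hD hF h1 h2 hξN hp in
/-- The Weingarten formula for the lightlike transversal field. -/
theorem cov_transversal_eq (v : TangentSpace (𝓡 k) p) :
    covAlong D H.f N p v = H.d p (H.tan p (covAlong D H.f N p v)) +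
      A.metric.val (H.f p) (covAlong D H.f N p v) (H.d p (ξ p)) • N p := by
  have h := eq_d_tan_add h1 h2 (hξN.mem_rad p hp) (hξN.transversal p hp) (covAlong D H.f N p v)
  rw [metric_cov_transversal_phi hD hF h1 h2 hξN hp, zero_div, zero_smul, add_zero] at h
  exact h

include hD hF h1 h2 hξN hp in
-- From g(N,N) = 0 the tangential part of D_v N is orthogonal to N, hence has no ξ component. It
-- follows that φ(A_N X) is tangent to the submanifold.
theorem tan_cov_transversal_mem_screen (v : TangentSpace (𝓡 k) p) :
    H.tan p (covAlong D H.f N p v) ∈ H.screen p := by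
  have hN := smoothNear_transversal h2 hξN hp
  have hr := hξN.mem_rad p hp
  have hv := hξN.transversal p hp
  have h := mvfderiv_metric (G := A.metric) hD hN hN v
  have e : ∀ᶠ q in 𝓝 p, A.metric.val (H.f q) (N q) (N q) = 0 := by
    filter_upwards [hξN.isOpen.mem_nhds hp] with q hq
    exact (hξN.transversal q hq).null
  rw [mvfderiv_congr e, mvfderiv_const, A.metric.symm _ (N p)] at h
  have h' : (0 : ℝ) = _ := h
  have h3 : A.metric.val (H.f p) (covAlong D H.f N p v) (N p) = 0 := by linarith
  rw [cov_transversal_eq hD hF h1 h2 hξN hp, map_add, map_smul, add_apply, smul_apply, hv.null,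
    smul_zero, add_zero] at h3
  have h4 := P_eq hr hv (localExt (H.tan p (covAlong D H.f N p v)))
  rw [localExt_self, h3, zero_smul, add_zero] at h4
  rw [h4]
  exact Subtype.prop _

include hD hF h1 h2 hξN hp in
-- Differentiate φξ = -2μ² φN. Both the derivative of μ² and the N component of D_v N contribute
-- multiples of φN, which is transversal; only φ of the tangential part of D_v N remains.
theorem d_tan_cov_phi_rad (v : TangentSpace (𝓡 k) p) :
    H.d p (H.tan p (covAlong D H.f (fun q ↦ A.phi (H.f q) (H.d q (ξ q))) p v)) =
      -(2 * A.eta (H.f p) (H.d p (ξ p)) ^ 2) •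
        A.phi (H.f p) (H.d p (H.tan p (covAlong D H.f N p v))) := by
  have hN := smoothNear_transversal h2 hξN hp
  have hr := hξN.mem_rad p hp
  have hv := hξN.transversal p hp
  have hμ := funSmoothNear_eta_rad hξN hp
  have hc : FunSmoothNear k (fun q ↦ -(2 * A.eta (H.f q) (H.d q (ξ q)) ^ 2)) p :=
    ((FunSmoothNear.const (2 : ℝ)).mul (hμ.mul hμ)).neg.congr
      (Filter.Eventually.of_forall fun q ↦ by rw [pow_two])
  have e : ∀ᶠ q in 𝓝 p, A.phi (H.f q) (H.d q (ξ q)) =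
      -(2 * A.eta (H.f q) (H.d q (ξ q)) ^ 2) • A.phi (H.f q) (N q) := by
    filter_upwards [hξN.isOpen.mem_nhds hp] with q hq
    have hμ0 := (reeb_eq h2 (hξN.mem_rad q hq) (hξN.transversal q hq)).1
    rw [phi_transversal h2 (hξN.mem_rad q hq) (hξN.transversal q hq), smul_smul, neg_mul_neg,
      mul_inv_cancel₀ (by simp [hμ0]), one_smul]
  have hφN : A.phi (H.f p) (N p) ∈ H.tr p := by
    rw [phi_transversal h2 hr hv]
    exact Submodule.mem_sup_left (Submodule.smul_mem _ _ (phi_mem_screenTr h1 hr))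
  rw [covAlong_congr D e, covAlong_smul D hc (smoothNear_phi hN),
    covAlong_endomorphism A.phi_smooth hF.parallel hN]
  have hs := tan_cov_transversal_mem_screen hD hF h1 h2 hξN hp v
  conv_lhs => rw [cov_transversal_eq hD hF h1 h2 hξN hp]
  simp only [map_add, map_smul, tan_tr hφN, smul_zero, zero_add, add_zero]
  rw [d_tan_phi_d h1 h2 hs]

include hD hF h1 h2 hξN hp in
-- Identifies the screen transversal coefficient of D_v Z with a value of B: write φ(PZ) = φZ -
-- η(Z)φξ, differentiate, and pair with ξ, to which both φξ and D_v(φξ) are orthogonal.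
theorem metric_cov_d_phi (hZ : SmoothNear (f := id) k Z p) (v : TangentSpace (𝓡 k) p) :
    A.metric.val (H.f p) (covAlong D H.f (fun q ↦ H.d q (Z q)) p v)
      (A.phi (H.f p) (H.d p (ξ p))) =
    A.metric.val (H.f p) (covAlong D H.f (fun q ↦ H.d q (H.phiP Z q)) p v) (H.d p (ξ p)) := by
  have hξ := smoothNear_rad hξN hp
  have hdZ := smoothNear_d (H := H) hZ
  have hN := smoothNear_transversal h2 hξN hp
  have hη : FunSmoothNear k (fun q ↦ -A.metric.val (H.f q) (H.d q (Z q)) (N q)) p :=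
    (hdZ.metric hN).neg
  have e : ∀ᶠ q in 𝓝 p, H.d q (H.phiP Z q) = A.phi (H.f q) (H.d q (Z q)) +
      (-A.metric.val (H.f q) (H.d q (Z q)) (N q)) • A.phi (H.f q) (H.d q (ξ q)) := by
    filter_upwards [hξN.isOpen.mem_nhds hp] with q hq
    have h := P_eq (hξN.mem_rad q hq) (hξN.transversal q hq) Z
    rw [H.d_phiP h1 h2]
    set c := A.metric.val (H.f q) (H.d q (Z q)) (N q)
    rw [h, map_add, map_add, map_smul, map_smul]
    module
  rw [covAlong_congr D e, covAlong_add D (smoothNear_phi hdZ) ((smoothNear_phi hξ).smul hη),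
    covAlong_smul D hη (smoothNear_phi hξ),
    covAlong_endomorphism A.phi_smooth hF.parallel hdZ]
  simp only [map_add, map_smul, add_apply, smul_apply, A.metric_phi_left _ (H.d p (ξ p)),
    metric_cov_phi_rad hD hF h1 hξN hp, metric_phi_rad_d h1 (hξN.mem_rad p hp), smul_zero, add_zero]

include hD hF h1 h2 hξN hp in
-- The derivative of the Gauss formula. The constant `c` is left unspecified because φξ has no
-- tangential part and is orthogonal to ξ.
theorem cov_ambient_eq (hY : SmoothNear (f := id) k Y p) (hZ : SmoothNear (f := id) k Z p)
    (v : TangentSpace (𝓡 k) p) :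
    ∃ c : ℝ, covAlong D H.f (H.ambient D Y Z) p v =
      covAlong D H.f (fun q ↦ H.d q (H.nabla D Y Z q)) p v +
      (mvfderiv (𝓡 k) (H.B D ξ Y Z) p v • N p + H.B D ξ Y Z p • covAlong D H.f N p v) +
      (c • A.phi (H.f p) (H.d p (ξ p)) +
        (H.B D ξ Y (H.phiP Z) p / A.eta (H.f p) (H.d p (ξ p)) ^ 2) •
          covAlong D H.f (fun q ↦ A.phi (H.f q) (H.d q (ξ q))) p v) := by
  have hξ := smoothNear_rad hξN hp
  have hE := smoothNear_phi hξ
  have hdZ := smoothNear_d (H := H) hZ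
  have hN := smoothNear_transversal h2 hξN hp
  have hμ := funSmoothNear_eta_rad hξN hp
  have hμ0 := (reeb_eq h2 (hξN.mem_rad p hp) (hξN.transversal p hp)).1
  have hV : SmoothNear k H.f (H.ambient D Y Z) p := hdZ.covAlong hD.smooth hY
  set b : M → ℝ := fun q ↦ A.metric.val (H.f q) (H.ambient D Y Z q) (H.d q (ξ q)) with hbdef
  have hb : FunSmoothNear k b p := hV.metric hξ
  set κ : M → ℝ := fun q ↦ A.metric.val (H.f q) (H.ambient D Y Z q)
    (A.phi (H.f q) (H.d q (ξ q))) / A.eta (H.f q) (H.d q (ξ q)) ^ 2 with hκdef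
  have hκ : FunSmoothNear k κ p := by
    refine ((hV.metric (G := A.metric) hE).mul ((hμ.mul hμ).inv ?_)).congr
      (Filter.Eventually.of_forall fun q ↦ by simp only [hκdef, div_eq_mul_inv, pow_two])
    simp [hμ0]
  have dec : ∀ᶠ q in 𝓝 p, H.ambient D Y Z q =
      H.d q (H.nabla D Y Z q) + b q • N q + κ q • A.phi (H.f q) (H.d q (ξ q)) := by
    filter_upwards [hξN.isOpen.mem_nhds hp] with q hq
    exact eq_d_tan_add h1 h2 (hξN.mem_rad q hq) (hξN.transversal q hq) _
  -- The tangential part is smooth because the transversal terms subtracted from the ambient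
  -- derivative are.
  have hd : SmoothNear k H.f (fun q ↦ H.d q (H.nabla D Y Z q)) p := by
    refine ((hV.add (hN.smul hb.neg)).add (hE.smul hκ.neg)).congr ?_
    filter_upwards [dec] with q hq
    rw [hq]
    module
  have eb : ∀ᶠ q in 𝓝 p, H.B D ξ Y Z q = b q := by
    filter_upwards [hξN.isOpen.mem_nhds hp] with q hq
    exact B_eq hξN hq Y Z
  have eκ : κ p = H.B D ξ Y (H.phiP Z) p / A.eta (H.f p) (H.d p (ξ p)) ^ 2 := by
    rw [B_eq hξN hp]
    exact congrArg (· / A.eta (H.f p) (H.d p (ξ p)) ^ 2)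
      (metric_cov_d_phi hD hF h1 h2 hξN hp hZ (Y p))
  refine ⟨mvfderiv (𝓡 k) κ p v, ?_⟩
  rw [covAlong_congr D dec, covAlong_add D (hd.add (hN.smul hb)) (hE.smul hκ),
    covAlong_add D hd (hN.smul hb), covAlong_smul D hb hN, covAlong_smul D hκ hE,
    mvfderiv_congr eb, eb.self_of_nhds, eκ]

include hD hF h1 h2 hξN hp in
theorem d_tan_cov_ambient (hY : SmoothNear (f := id) k Y p) (hZ : SmoothNear (f := id) k Z p) :
    H.d p (H.tan p (covAlong D H.f (H.ambient D Y Z) p (X p))) =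
      H.d p (H.nabla D X (H.nabla D Y Z) p) - H.B D ξ Y Z p • H.d p (H.shape D N X p) +
        (2 * H.B D ξ Y (H.phiP Z) p) • H.phiD (H.shape D N X) p := by
  have hr := hξN.mem_rad p hp
  have hv := hξN.transversal p hp
  have hμ0 := (reeb_eq h2 hr hv).1
  obtain ⟨c, h⟩ := cov_ambient_eq hD hF h1 h2 hξN hp hY hZ (X p)
  rw [h]
  simp only [map_add, map_smul, tan_tr (transversal_mem_tr hr hv),
    tan_tr (Submodule.mem_sup_left (phi_mem_screenTr h1 hr) : _ ∈ H.tr p),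
    d_tan_cov_phi_rad hD hF h1 h2 hξN hp, smul_zero, zero_add]
  -- The factor μ⁻² of the Gauss formula meets the factor -2μ² of D(φξ): this is the origin of the
  -- coefficient 2 in (15).
  have e : (H.B D ξ Y (H.phiP Z) p / A.eta (H.f p) (H.d p (ξ p)) ^ 2) *
      -(2 * A.eta (H.f p) (H.d p (ξ p)) ^ 2) = -(2 * H.B D ξ Y (H.phiP Z) p) := by
    field_simp
  rw [smul_smul, e]
  simp only [phiD, shape, map_neg]
  change H.d p (H.nabla D X (H.nabla D Y Z) p) + _ + _ = _
  module

include hD hF h1 h2 hξN hp in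
theorem metric_cov_ambient (hY : SmoothNear (f := id) k Y p) (hZ : SmoothNear (f := id) k Z p) :
    A.metric.val (H.f p) (covAlong D H.f (H.ambient D Y Z) p (X p)) (H.d p (ξ p)) =
      H.B D ξ X (H.nabla D Y Z) p + lieD X (H.B D ξ Y Z) p +
        H.tau D ξ N X p * H.B D ξ Y Z p := by
  have hr := hξN.mem_rad p hp
  have hv := hξN.transversal p hp
  obtain ⟨c, h⟩ := cov_ambient_eq hD hF h1 h2 hξN hp hY hZ (X p)
  have hE : A.metric.val (H.f p) (A.phi (H.f p) (H.d p (ξ p))) (H.d p (ξ p)) = 0 := by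
    rw [A.metric.symm, metric_phi_rad_d h1 hr]
  rw [h, tau_eq hξN hp, B_eq hξN hp X]
  simp only [map_add, map_smul, add_apply, smul_apply, hv.pairing, hE,
    metric_cov_phi_rad hD hF h1 hξN hp, smul_eq_mul]
  unfold lieD ambient
  ring

include hD in
theorem nabla_sub_nabla (hX : SmoothNear (f := id) k X p) (hY : SmoothNear (f := id) k Y p) :
    H.nabla D X Y p - H.nabla D Y X p = VectorField.mlieBracket (𝓡 k) X Y p := by
  have h := covAlong_dmap_sub hD.torsion_free (eventually_contMDiffAt (H := H) p) hX hY
  have h' : H.ambient D X Y p - H.ambient D Y X p = H.d p (VectorField.mlieBracket (𝓡 k) X Y p) := h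
  unfold nabla
  rw [← map_sub, h', tan_d]

include hD in
theorem curv_d_eq (hX : SmoothNear (f := id) k X p) (hY : SmoothNear (f := id) k Y p)
    (hZ : SmoothNear (f := id) k Z p) :
    covAlong D H.f (H.ambient D Y Z) p (X p) - covAlong D H.f (H.ambient D X Z) p (Y p) -
      H.ambient D (VectorField.mlieBracket (𝓡 k) X Y) Z p =
      curv D (H.f p) (H.d p (X p)) (H.d p (Y p)) (H.d p (Z p)) :=
  covAlong_curvature hD.smooth hD.torsion_free hX hY (smoothNear_d hZ)

include hD hF h1 h2 hξN hp in
/-- The Gauss equation. -/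
theorem d_tan_curv (hX : SmoothNear (f := id) k X p) (hY : SmoothNear (f := id) k Y p)
    (hZ : SmoothNear (f := id) k Z p) :
    H.d p (H.tan p (curv D (H.f p) (H.d p (X p)) (H.d p (Y p)) (H.d p (Z p)))) =
      H.d p (curvature (H.nabla D) X Y Z p) +
      H.B D ξ X Z p • H.d p (H.shape D N Y p) -
      (2 * H.B D ξ X (H.phiP Z) p) • H.phiD (H.shape D N Y) p -
      H.B D ξ Y Z p • H.d p (H.shape D N X p) +
      (2 * H.B D ξ Y (H.phiP Z) p) • H.phiD (H.shape D N X) p := by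
  rw [← curv_d_eq hD hX hY hZ, map_sub, map_sub, map_sub, map_sub,
    d_tan_cov_ambient hD hF h1 h2 hξN hp hY hZ, d_tan_cov_ambient hD hF h1 h2 hξN hp hX hZ]
  unfold curvature
  rw [map_sub, map_sub]
  change _ - _ - H.d p (H.nabla D (VectorField.mlieBracket (𝓡 k) X Y) Z p) = _
  module

include hD hF h1 h2 hξN hp in
/-- The Codazzi equation. -/
theorem metric_curv_rad (hX : SmoothNear (f := id) k X p) (hY : SmoothNear (f := id) k Y p)
    (hZ : SmoothNear (f := id) k Z p) :
    A.metric.val (H.f p) (curv D (H.f p) (H.d p (X p)) (H.d p (Y p)) (H.d p (Z p)))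
      (H.d p (ξ p)) =
    covDerivForm (H.nabla D) (H.B D ξ) X Y Z p - covDerivForm (H.nabla D) (H.B D ξ) Y X Z p
      + H.tau D ξ N X p * H.B D ξ Y Z p - H.tau D ξ N Y p * H.B D ξ X Z p := by
  -- The induced connection is torsion-free and B is linear in its first slot, so the correction
  -- terms of `covDerivForm` add up to the bracket term of the curvature.
  have hb : H.B D ξ (H.nabla D X Y) Z p - H.B D ξ (H.nabla D Y X) Z p =
      A.metric.val (H.f p) (H.ambient D (VectorField.mlieBracket (𝓡 k) X Y) Z p)
        (H.d p (ξ p)) := by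
    rw [B_eq hξN hp, B_eq hξN hp, ← sub_apply, ← map_sub]
    unfold ambient
    rw [← nabla_sub_nabla (H := H) hD hX hY]
    congr 2
    simp only [covAlong_eq, map_sub]
    abel
  rw [← curv_d_eq hD hX hY hZ, map_sub, map_sub, sub_apply, sub_apply,
    metric_cov_ambient hD hF h1 h2 hξN hp hY hZ, metric_cov_ambient hD hF h1 h2 hξN hp hX hZ, ← hb]
  unfold covDerivForm
  ring

end Local

end HalfLightlike

end LightlikeGeometry

end

/-! ### Substitution of the ambient curvature into the Gauss and Codazzi equations -/

open LightlikeGeometry in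
theorem proposition4p2 (n : ℕ) (hn : 2 ≤ n)
    -- the ambient manifold
    {Mb : Type*} [TopologicalSpace Mb] [T2Space Mb] [SecondCountableTopology Mb]
    [ChartedSpace (Model (2 * n + 1)) Mb] [IsManifold (𝓡 (2 * n + 1)) ∞ Mb]
    (A : AlmostContactBMetric n Mb) (Db Db' : Connection (2 * n + 1) Mb)
    (hDb : IsLeviCivita A.g Db) (hDb' : IsLeviCivita A.assocMetric Db') (hF0 : A.IsF0 Db)
    (ν ν' : Mb → ℝ) (hν : A.HasConstTotallyRealCurvatures Db Db' ν ν')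
    -- the submanifold
    {k : ℕ} {M : Type*} [TopologicalSpace M] [T2Space M] [SecondCountableTopology M]
    [ChartedSpace (Model k) M] [IsManifold (𝓡 k) ∞ M]
    (H : HalfLightlike A.metric k M) (hRSTHL : H.IsRSTHL) (hasc : H.IsAscreen)
    -- a local section of `Rad(TM)` and the corresponding section of `ltr(TM)`
    (U : Set M) (ξ : VField k M) (N : (p : M) → TangentSpace (𝓡 (2 * n + 1)) (H.f p))
    (hξN : H.IsNullPair U ξ N)
    (X Y Z : VField k M) (hX : SmoothOn X U) (hY : SmoothOn Y U) (hZ : SmoothOn Z U)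
    (p : M) (hp : p ∈ U) :
    H.d p (curvature (H.nabla Db) X Y Z p) =
        -(H.B Db ξ X Z p) • H.d p (H.shape Db N Y p)
        + (2 * H.B Db ξ X (H.phiP Z) p) • H.phiD (H.shape Db N Y) p
        + H.B Db ξ Y Z p • H.d p (H.shape Db N X p)
        - (2 * H.B Db ξ Y (H.phiP Z) p) • H.phiD (H.shape Db N X) p
        - (ν (H.f p) * H.gphiXphiY Y Z p + ν' (H.f p) * H.gXphiY Y Z p) • H.d p (H.P X p)
        + (ν (H.f p) * H.gphiXphiY X Z p + ν' (H.f p) * H.gXphiY X Z p) • H.d p (H.P Y p)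
        - (ν (H.f p) * H.gXphiY Y Z p - ν' (H.f p) * H.gphiXphiY Y Z p) • H.phiD (H.P X) p
        + (ν (H.f p) * H.gXphiY X Z p - ν' (H.f p) * H.gphiXphiY X Z p) • H.phiD (H.P Y) p
        + ((1 / 2 : ℝ) *
            (ν (H.f p) * (H.gXY Y Z p * H.eta N X p - H.gXY X Z p * H.eta N Y p)
              - ν' (H.f p) * (H.gXphiY Y Z p * H.eta N X p - H.gXphiY X Z p * H.eta N Y p)))
          • H.d p (ξ p)
    ∧ covDerivForm (H.nabla Db) (H.B Db ξ) X Y Z p - covDerivForm (H.nabla Db) (H.B Db ξ) Y X Z p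
          + H.tau Db ξ N X p * H.B Db ξ Y Z p - H.tau Db ξ N Y p * H.B Db ξ X Z p =
        H.mu ξ p ^ 2 *
          (ν (H.f p) * (H.gXY X Z p * H.eta N Y p - H.gXY Y Z p * H.eta N X p)
            - ν' (H.f p) * (H.gXphiY X Z p * H.eta N Y p - H.gXphiY Y Z p * H.eta N X p)) := by

  have hXp := hX.smoothNear hξN.isOpen hp
  have hYp := hY.smoothNear hξN.isOpen hp
  have hZp := hZ.smoothNear hξN.isOpen hp
  have hr := hξN.mem_rad p hp
  have hv := hξN.transversal p hp
  obtain ⟨hμ0, hreeb⟩ := HalfLightlike.reeb_eq hasc hr hv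
  have hcurv := AlmostContactBMetric.curv_eq hn hF0 hDb hDb' hν (H.d p (X p)) (H.d p (Y p))
    (H.d p (Z p))
  have hgauss := HalfLightlike.d_tan_curv hDb hF0 hRSTHL hasc hξN hp hXp hYp hZp
  have hcodazzi := HalfLightlike.metric_curv_rad hDb hF0 hRSTHL hasc hξN hp hXp hYp hZp
  rw [hcurv] at hgauss hcodazzi
  have hη := HalfLightlike.eta_d hasc hr hv
  have hgphi : ∀ X Y : VField k M, H.gphiXphiY X Y p = -H.gXY X Y p +
      H.mu ξ p ^ 2 * H.eta N X p * H.eta N Y p := by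
    intro X Y
    have := A.metric_phi (H.f p) (H.d p (X p)) (H.d p (Y p))
    rw [hη (X p), hη (Y p)] at this
    refine this.trans ?_
    unfold HalfLightlike.gXY HalfLightlike.mu HalfLightlike.eta AlmostContactBMetric.g
    ring
  -- The Reeb component of X is ½η(X)ξ + μ²η(X)N, whose tangential part removes half of the ξ
  -- component of X = PX + η(X)ξ.
  have tanh : ∀ X : VField k M, H.d p (H.tan p (H.d p (X p) -
      A.eta (H.f p) (H.d p (X p)) • A.xi (H.f p))) =
      H.d p (H.P X p) + ((1 / 2 : ℝ) * H.eta N X p) • H.d p (ξ p) := by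
    intro X
    have hP := congrArg (H.d p) (HalfLightlike.P_eq hr hv X)
    have ht := HalfLightlike.tan_tr (HalfLightlike.transversal_mem_tr hr hv)
    rw [hη, hreeb]
    simp only [map_sub, map_smul, map_add, HalfLightlike.tan_d, ht] at hP ⊢
    have e : (A.eta (H.f p) (H.d p (ξ p)) * A.metric.val (H.f p) (H.d p (X p)) (N p)) *
        (2 * A.eta (H.f p) (H.d p (ξ p)))⁻¹ = (1 / 2 : ℝ) * H.eta N X p := by
      unfold HalfLightlike.eta
      field_simp
    rw [map_zero, smul_zero, add_zero, smul_smul, e, hP]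
    unfold HalfLightlike.eta
    module
  -- The ξ component of X contributes a multiple of φξ, which is transversal.
  have tanphi : ∀ X : VField k M, H.d p (H.tan p (A.phi (H.f p) (H.d p (X p)))) =
      H.phiD (H.P X) p := by
    intro X
    have hP := HalfLightlike.P_eq hr hv X
    have ht := HalfLightlike.tan_tr (H := H)
      (Submodule.mem_sup_left (HalfLightlike.phi_mem_screenTr hRSTHL hr) : _ ∈ H.tr p)
    rw [congrArg (H.d p) hP]
    simp only [map_add, map_smul, ht]
    rw [map_zero, smul_zero, add_zero]
    exact H.d_phiP hRSTHL hasc X p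
  constructor
  · simp only [map_sub, map_smul] at tanh
    simp only [map_add, map_sub, map_smul, tanh, tanphi] at hgauss
    have c : ∀ X Y : VField k M, A.g (H.f p) (A.phi (H.f p) (H.d p (X p)))
        (A.phi (H.f p) (H.d p (Y p))) = H.gphiXphiY X Y p := fun X Y ↦ rfl
    have c' : ∀ X Y : VField k M, A.g (H.f p) (H.d p (X p))
        (A.phi (H.f p) (H.d p (Y p))) = H.gXphiY X Y p := fun X Y ↦ rfl
    simp only [c, c'] at hgauss
    -- In g(φY,φZ) = -g(Y,Z) + μ²η(Y)η(Z) the μ² terms cancel after antisymmetrisation in X and Y.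
    have hξc : (1 / 2 : ℝ) *
            (ν (H.f p) * (H.gXY Y Z p * H.eta N X p - H.gXY X Z p * H.eta N Y p)
              - ν' (H.f p) * (H.gXphiY Y Z p * H.eta N X p - H.gXphiY X Z p * H.eta N Y p)) =
        -(ν (H.f p) * H.gphiXphiY Y Z p + ν' (H.f p) * H.gXphiY Y Z p) *
          ((1 / 2 : ℝ) * H.eta N X p) +
        (ν (H.f p) * H.gphiXphiY X Z p + ν' (H.f p) * H.gXphiY X Z p) *
          ((1 / 2 : ℝ) * H.eta N Y p) := by
      rw [hgphi, hgphi]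
      ring
    rw [hξc]
    linear_combination (norm := module) -hgauss
  · rw [← hcodazzi]
    -- Only the Reeb components pair nontrivially with ξ: each one carries the factor μη(X), and
    -- pairing the Reeb field with ξ gives a second μ, hence the μ² in (16).
    have hφ : ∀ X : VField k M, A.metric.val (H.f p) (A.phi (H.f p) (H.d p (X p)))
        (H.d p (ξ p)) = 0 := fun X ↦ by
      rw [A.metric_phi_left, HalfLightlike.metric_phi_rad_d hRSTHL hr]
    have hx : A.metric.val (H.f p) (A.xi (H.f p)) (H.d p (ξ p)) = H.mu ξ p := by
      rw [A.metric.symm, A.metric_xi]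
      rfl
    have hη' : ∀ X : VField k M, A.eta (H.f p) (H.d p (X p)) = H.mu ξ p * H.eta N X p :=
      fun X ↦ hη _
    simp only [map_add, map_sub, map_smul, add_apply, sub_apply, smul_apply, hφ, hx,
      HalfLightlike.metric_d_rad hr, hη', smul_eq_mul]
    have c : ∀ X Y : VField k M, A.g (H.f p) (A.phi (H.f p) (H.d p (X p)))
        (A.phi (H.f p) (H.d p (Y p))) = H.gphiXphiY X Y p := fun X Y ↦ rfl
    have c' : ∀ X Y : VField k M, A.g (H.f p) (H.d p (X p))
        (A.phi (H.f p) (H.d p (Y p))) = H.gXphiY X Y p := fun X Y ↦ rfl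
    rw [c, c, c', c', hgphi, hgphi]
    ring
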